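/- **Setting.** A finite graph is a finite CW complex of dimension at most $1$; the valency of a vertex is the number of edge-ends attached to it. A core graph is a finite graph in which every vertex has valency at least $2$. Let $\Gamma$ be a connected core graph and let $f:\Gamma\to\Gamma$ be an immersion, i.e. a continuous locally injective map. Assume that all vertices of $\Gamma$ have valency at least $3$ or that $f$ maps vertices to vertices. *Pullbacks.* For $i\ge 0$ let $\Gamma_i=\{(x,y)\in\Gamma\times\Gamma : f^i(x)=f^i(y)\}$ (so $\Gamma_0$ is the diagonal), and for $i\ge1$ let $\hat\Gamma_i$ be the maximal core subgraph of $\Gamma_i\setminus\Gamma_{i-1}$, i.e. the union of all subspaces of $\Gamma_i\setminus\Gamma_{i-1}$ that are core graphs. *Annuli.* Let $M_f=(\Gamma\times[-\tfrac12,\tfrac12])/{\sim}$, where $(x,\tfrac12)\sim(f(x),-\tfrac12)$ for all $x \in \Gamma$, be the mapping torus, with edge space $\Gamma\times\{0\}$ and projection $p:M_f\to S^1=\mathbb R/\mathbb Z$, $(x,t)\mapsto t$. Let $m$ be a positive integer. An annulus of length $2m$ is a continuous map $\alpha:S^1\times[-m,m]\to M_f$ such that 1. $\alpha$ is transverse to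 the edge space: near each point mapped to $\Gamma\times\{0\}$, the coordinate $t$ of $\alpha$ in the collar $\Gamma\times(-\tfrac12,\tfrac12)$ is strictly monotone, in one direction, along the arcs $\{s\}\times[-m,m]$; 2. the $\alpha$-preimage of the edge space is $S^1\times([-m,m]\cap\mathbb Z)$; 3. for each integer $i\in[-m,m]$ the ring $\alpha|_{S^1\times\{i\}}$ is locally injective, except possibly at the basepoint $0\in S^1$; 4. for each integer $i\in[-m,m-1]$ the path $\alpha|_{\{0\}\times[i,i+1]}$ is not homotopic rel endpoints into the edge space. The annulus is tight if its rings are locally injective everywhere, also at the basepoint. It is strictly bidirectional if $\beta(-m)=\beta(m)-1<\beta(0)$, where $\beta:[-m,m]\to\mathbb R$ is a continuous lift of $t\mapsto p(\alpha(0,t))$. **Proposition.** The following are equivalent: - $\hat\Gamma_L=\emptyset$ for some integer $L\ge 1$; - there is an integer $L\ge0$ such that every strictly bidirectional tight annulus in $M_f$ has length at most $2L$. -/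

import Mathlib

open Set Topology

noncomputable section

/-! ### Finite graphs as 1-dimensional CW complexes -/

section Graphs

variable {X : Type*} [TopologicalSpace X] (C : Set X) [CWComplex C]

/-- A CW complex is (at most) `1`-dimensional: it has only `0`-cells and `1`-cells. -/
def IsOneDimensional : Prop := ∀ n : ℕ, 2 ≤ n → IsEmpty (RelCWComplex.cell C n)

/-- The point of the complex that is the `0`-cell `v`. -/
def vertexPoint (v : RelCWComplex.cell C 0) : X := RelCWComplex.map 0 v ![]

/-- The edge-ends at the vertex `v`: pairs of an edge and one of the two endpoints `1` (`true`),
`-1` (`false`) of its parametrizing interval `[-1, 1]`, such that this endpoint is attached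
to `v`. A loop edge at `v` contributes two edge-ends. -/
def edgeEnds (v : RelCWComplex.cell C 0) : Set (RelCWComplex.cell C 1 × Bool) :=
  {a | RelCWComplex.map 1 a.1 (fun _ ↦ if a.2 then (1 : ℝ) else -1) = vertexPoint C v}

/-- The valency of a vertex: its number of edge-ends, i.e. of directions at it. -/
def valency (v : RelCWComplex.cell C 0) : ℕ∞ := (edgeEnds C v).encard

end Graphs

/-- A subspace `K` is a core graph: it carries the structure of a finite `1`-dimensional CW complex
all of whose vertices have valency at least `2`. -/
def IsCoreGraph {X : Type*} [TopologicalSpace X] (K : Set X) : Prop :=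
  ∃ _ : CWComplex K, RelCWComplex.Finite K ∧ IsOneDimensional K ∧
    ∀ v : RelCWComplex.cell K 0, 2 ≤ valency K v

/-- The maximal core subgraph of a subspace `A`: the union of all core graphs contained in `A`. -/
def maximalCoreSubgraph {X : Type*} [TopologicalSpace X] (A : Set X) : Set X :=
  ⋃₀ {K | K ⊆ A ∧ IsCoreGraph K}

/-! ### Pullbacks -/

/-- `Γ_i`: the pullback of `f^i` and `f^i`. For `i = 0` this is the diagonal. -/
def iteratePullback {Γ : Type*} (f : Γ → Γ) (i : ℕ) : Set (Γ × Γ) :=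
  {p | f^[i] p.1 = f^[i] p.2}

/-- `Γ̂_i`, for `i ≥ 1`: the maximal core subgraph of `Γ_i - Γ_{i-1}`. -/
def pullbackCore {Γ : Type*} [TopologicalSpace Γ] (f : Γ → Γ) (i : ℕ) : Set (Γ × Γ) :=
  maximalCoreSubgraph (iteratePullback f i \ iteratePullback f (i - 1))

/-! ### The mapping torus -/

/-- The relation `(x, 1/2) ∼ (f x, -1/2)` on `Γ × [-1/2, 1/2]`. -/
def MappingTorusRel {Γ : Type*} (f : Γ → Γ) (p q : Γ × Icc (-(1 / 2) : ℝ) (1 / 2)) : Prop :=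
  (p.2 : ℝ) = 1 / 2 ∧ (q.2 : ℝ) = -(1 / 2) ∧ q.1 = f p.1

/-- The mapping torus `M_f`: the quotient of `Γ × [-1/2, 1/2]` by `(x, 1/2) ∼ (f x, -1/2)`. -/
def MappingTorus {Γ : Type*} (f : Γ → Γ) : Type _ := Quot (MappingTorusRel f)

instance {Γ : Type*} [TopologicalSpace Γ] (f : Γ → Γ) : TopologicalSpace (MappingTorus f) :=
  inferInstanceAs (TopologicalSpace (Quot (MappingTorusRel f)))

namespace MappingTorus

variable {Γ : Type*} (f : Γ → Γ)

/-- The edge space `Γ × {0}` of the mapping torus. -/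
def edgeSpace : Set (MappingTorus f) :=
  {z | ∃ (x : Γ) (t : Icc (-(1 / 2) : ℝ) (1 / 2)), (t : ℝ) = 0 ∧
    z = Quot.mk (MappingTorusRel f) (x, t)}

/-- The projection `p : M_f → S¹ = ℝ / ℤ`, `(x, t) ↦ t`. -/
def proj : MappingTorus f → UnitAddCircle :=
  Quot.lift (fun p ↦ (((p.2 : ℝ)) : UnitAddCircle)) <| by
    rintro p q ⟨hp, hq, -⟩
    simp only [hp, hq]
    rw [← sub_eq_zero, ← AddCircle.coe_sub]
    norm_num [AddCircle.coe_period]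

/-- The coordinate of `M_f` normal to the edge space: the representative in `[-1/2, 1/2)` of the
projection to `S¹`. On the collar `Γ × (-1/2, 1/2)` of the edge space it is `(x, t) ↦ t`. -/
def normalCoordinate (z : MappingTorus f) : ℝ :=
  (AddCircle.equivIco (1 : ℝ) (-(1 / 2)) (proj f z) : ℝ)

end MappingTorus

/-! ### Annuli -/

open MappingTorus in
/-- An annulus of length `2m` in `M_f`: a map `α : S¹ × [-m, m] → M_f`, `(s, t) ↦ toFun s t`
(the values for `t ∉ [-m, m]` are irrelevant and not constrained). -/
structure Annulus {Γ : Type*} [TopologicalSpace Γ] (f : Γ → Γ) (m : ℕ) where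
  /-- the underlying map -/
  toFun : UnitAddCircle → ℝ → MappingTorus f
  pos : 0 < m
  continuousOn : ContinuousOn (Function.uncurry toFun) (univ ×ˢ Icc (-(m : ℝ)) m)
  /-- `α` is transverse to the edge space: near every point that is mapped to the edge space,
  the coordinate normal to the edge space is strictly monotone, in one direction, along the
  arcs `{s'} × [-m, m]`, so `α` crosses from one side of the edge space to the other. -/
  transverse : ∀ s : UnitAddCircle, ∀ t ∈ Icc (-(m : ℝ)) m, toFun s t ∈ edgeSpace f →
    ∃ U ∈ 𝓝 s, ∃ V ∈ 𝓝[Icc (-(m : ℝ)) m] t,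
      (∀ s' ∈ U, StrictMonoOn (fun t' ↦ normalCoordinate f (toFun s' t')) V) ∨
      (∀ s' ∈ U, StrictAntiOn (fun t' ↦ normalCoordinate f (toFun s' t')) V)
  /-- the preimage of the edge space is `S¹ × ([-m, m] ∩ ℤ)` -/
  preimage_edgeSpace : ∀ s : UnitAddCircle, ∀ t ∈ Icc (-(m : ℝ)) m,
    (toFun s t ∈ edgeSpace f ↔ ∃ i : ℤ, (i : ℝ) = t)
  /-- every ring is locally injective, except possibly at the basepoint `0` -/
  ring_locallyInjective : ∀ i : ℤ, (i : ℝ) ∈ Icc (-(m : ℝ)) m → ∀ s : UnitAddCircle, s ≠ 0 →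
    ∃ U ∈ 𝓝 s, InjOn (fun s' ↦ toFun s' i) U
  /-- no piece `α|_{ {0} × [i, i+1]}` of the trace of the basepoint is homotopic rel endpoints
  into the edge space -/
  trace_not_homotopic : ∀ i : ℤ, -(m : ℤ) ≤ i → i + 1 ≤ (m : ℤ) →
    ¬ ∃ H : C(unitInterval × unitInterval, MappingTorus f),
      (∀ u : unitInterval, H (0, u) = toFun 0 (i + u)) ∧
      (∀ u : unitInterval, H (1, u) ∈ edgeSpace f) ∧
      (∀ r : unitInterval, H (r, 0) = toFun 0 i ∧ H (r, 1) = toFun 0 (i + 1))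

namespace Annulus

variable {Γ : Type*} [TopologicalSpace Γ] {f : Γ → Γ} {m : ℕ}

/-- The length of an annulus `S¹ × [-m, m] → M_f`. -/
def length (_ : Annulus f m) : ℕ := 2 * m

/-- An annulus is tight if all its rings are locally injective, also at the basepoint. -/
def IsTight (α : Annulus f m) : Prop :=
  ∀ i : ℤ, (i : ℝ) ∈ Icc (-(m : ℝ)) m → IsLocallyInjective (fun s ↦ α.toFun s i)

/-- `β : [-m, m] → ℝ` is a lift, through `ℝ → S¹`, of the projection to `S¹` of the trace of the
basepoint. -/
def IsTraceLift (α : Annulus f m) (β : ℝ → ℝ) : Prop :=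
  ContinuousOn β (Icc (-(m : ℝ)) m) ∧
    ∀ t ∈ Icc (-(m : ℝ)) m, (β t : UnitAddCircle) = MappingTorus.proj f (α.toFun 0 t)

/-- An annulus is strictly bidirectional if `β(-m) = β(m) - 1 < β(0)`. The lift `β` is unique up
to adding an integer, so the condition does not depend on its choice. -/
def IsStrictlyBidirectional (α : Annulus f m) : Prop :=
  ∃ β : ℝ → ℝ, α.IsTraceLift β ∧ β (-(m : ℝ)) = β m - 1 ∧ β m - 1 < β 0

end Annulus

end

/-!
Both conditions of the equivalence are about immersed loops, that is, `1`-periodic locally injective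
lines. A nonempty core graph contains an immersed loop, as an edge path can always be continued
without backtracking; conversely a shortest arc of an immersed loop with equal ends is an embedded
circle, which is a core graph (`maximalCoreSubgraph_nonempty_iff`). So `Γ̂_L` is nonempty if and
only if there is a pair of immersed loops `γ`, `δ` in `Γ` with `f^L ∘ γ = f^L ∘ δ` and
`f^(L-1) (γ s) ≠ f^(L-1) (δ s)` for all `s`. Composition with `f` turns such a pair for `L + 1` into
one for `L`.

From a pair for `L = m + 1` one obtains an annulus of length `2 m`: rise along the flow lines of `γ`
through `m + 1` rings up to the height `m + 1/2`, turn around, and descend along the flow lines of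
`δ` through `m` rings (`Annulus.exists_of_immersed_loops`). Its trace is not homotopic into the edge
space at the turn, because immersions are injective on homotopy classes of paths in the sense of
`ForestCovering.eq_of_comp_homotopicRel_const`, and elsewhere because the ends have distinct
heights.

Conversely, lift the heights of a strictly bidirectional tight annulus of length `2 m` to the real
numbers. The trace cannot leave a level downwards and return to it in one step, as the semiflow of
the mapping torus would push such a step into the edge space. So it rises through `m` levels, turns
once between the rings `0` and `1`, and descends through `m - 1` levels
(`Annulus.exists_height_bounds`). The semiflow pushes each of these three parts to a homotopy in `Γ`
between images of rings under powers of `f`. Homotopic immersed loops agree up to a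
reparametrization (`ForestCovering.exists_reparametrization_of_homotopy`), and hence the two
boundary rings, the first one moved on by `f`, form an immersed loop in `Γ_m`. If it met `Γ_{m-1}`,
then the rings `0` and `1` would agree up to the same reparametrization, and the turn would be
homotopic into the edge space (`Annulus.ring_ne_ring`). So the loop lies in the complement of
`Γ_{m-1}`.

The two facts about immersions are proved in a covering of `Γ` by a forest, which is built from the
free group on the edges. The forest carries a height function, for which every point has a unique
descent to a root and branching is upwards (`HeightedForest`). Therefore its components are
contractible, a locally injective path has no local maximum of the height and is injective, and two
locally injective lines at bounded distance coincide up to reparametrization: far out both lie on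
the descent from the same point.
-/

/-! ### Forests with a height function -/

/-- A height function on a forest `T`, given by its downward flow: `lower q h` is the point of
height `h` below `q` (and `q` itself if `h` is at least the height of `q`). The fields
`eventually_comparable` and `eventually_lower_mem` say that a point has arbitrarily small
neighbourhoods all of whose points are comparable with it, which makes `T` branch only upwards. -/
structure HeightedForest (T : Type*) [TopologicalSpace T] where
  /-- the height -/
  height : T → ℝ
  /-- the downward flow -/
  lower : T → ℝ → T
  continuous_height : Continuous height
  height_nonneg : ∀ q, 0 ≤ height q
  lower_of_le : ∀ q h, height q ≤ h → lower q h = q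
  height_lower : ∀ q h, 0 ≤ h → h ≤ height q → height (lower q h) = h
  lower_lower : ∀ q h h', h' ≤ h → lower (lower q h) h' = lower q h'
  continuous_lower : ∀ q, Continuous (lower q)
  eventually_comparable : ∀ q, ∀ᶠ q' in 𝓝 q,
    q' = lower q (height q') ∨ q = lower q' (height q)
  eventually_lower_mem : ∀ q, ∀ W ∈ 𝓝 q, ∀ᶠ q' in 𝓝 q, ∀ h, height q ≤ h → lower q' h ∈ W

lemma locallyInjOn_comp_neg {T : Type*} {S : Set ℝ} {γ : ℝ → T}
    (hinj : ∀ t ∈ S, ∃ U ∈ 𝓝[S] t, InjOn γ U) :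
    ∀ t ∈ -S, ∃ U ∈ 𝓝[-S] t, InjOn (fun t ↦ γ (-t)) U := by
  intro t ht
  obtain ⟨U, hU, h⟩ := hinj (-t) ht
  refine ⟨-U, ?_, fun u hu v hv heq ↦ neg_injective (h hu hv heq)⟩
  have : Filter.Tendsto (fun t : ℝ ↦ -t) (𝓝[-S] t) (𝓝[S] (-t)) :=
    continuous_neg.continuousWithinAt.tendsto_nhdsWithin fun x hx ↦ hx
  exact this hU

namespace HeightedForest

variable {T : Type*} [TopologicalSpace T] (P : HeightedForest T)

/-- Nearby points have the same lower points. -/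
lemma eventually_lower_eq (q : T) : ∀ᶠ q' in 𝓝 q,
    ∀ h, h ≤ P.height q → h ≤ P.height q' → P.lower q' h = P.lower q h := by
  filter_upwards [P.eventually_comparable q] with q' hq' h h1 h2
  rcases hq' with hq' | hq'
  · rw [hq', P.lower_lower _ _ _ h2]
  · conv_rhs => rw [hq', P.lower_lower _ _ _ h1]

/-- Points of a connected set of height at least `h` lie over the same point of height `h`. -/
lemma lower_eq_of_isPreconnected {X : Type*} [TopologicalSpace X] {K : Set X}
    (hK : IsPreconnected K) {g : X → T} (hg : ContinuousOn g K) {h : ℝ}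
    (hh : ∀ x ∈ K, h ≤ P.height (g x)) {x y : X} (hx : x ∈ K) (hy : y ∈ K) :
    P.lower (g x) h = P.lower (g y) h := by
  refine hK.induction₂ (fun x y ↦ P.lower (g x) h = P.lower (g y) h) ?_
    (fun x y z _ _ _ h1 h2 ↦ h1.trans h2) (fun x y _ _ h1 ↦ h1.symm) hx hy
  intro x hx
  filter_upwards [(hg x hx).eventually (P.eventually_lower_eq (g x)), self_mem_nhdsWithin]
    with y hy hyK
  exact (hy h (hh x hx) (hh y hyK)).symm

/-- The downward flow is jointly continuous. -/
lemma continuous_uncurry_lower : Continuous (fun p : T × ℝ ↦ P.lower p.1 p.2) := by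
  rw [continuous_iff_continuousAt]
  rintro ⟨q, h⟩
  have hq : Filter.Tendsto (fun p : T × ℝ ↦ p.1) (𝓝 (q, h)) (𝓝 q) := continuous_fst.continuousAt
  have hl : Filter.Tendsto (fun p : T × ℝ ↦ P.lower q p.2) (𝓝 (q, h)) (𝓝 (P.lower q h)) :=
    ((P.continuous_lower q).comp continuous_snd).continuousAt
  have hc := hq.eventually (P.eventually_lower_eq q)
  rcases lt_or_ge h (P.height q) with hlt | hge
  · refine hl.congr' ?_
    have e1 : ∀ᶠ p : T × ℝ in 𝓝 (q, h), p.2 < P.height q :=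
      (continuous_snd.tendsto (q, h)).eventually_lt_const hlt
    have e2 : ∀ᶠ p : T × ℝ in 𝓝 (q, h), p.2 < P.height p.1 :=
      (continuous_snd.tendsto (q, h)).eventually_lt
        ((P.continuous_height.comp continuous_fst).tendsto (q, h)) hlt
    filter_upwards [hc, e1, e2] with p h1 h2 h3
    exact (h1 _ h2.le h3.le).symm
  · change Filter.Tendsto _ _ (𝓝 (P.lower q h))
    intro W hW
    have hW' : W ∈ 𝓝 q := by rwa [P.lower_of_le q h hge] at hW
    have h34 := hq.eventually (P.eventually_lower_mem q W hW')
    change ∀ᶠ p : T × ℝ in 𝓝 (q, h), P.lower p.1 p.2 ∈ W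
    filter_upwards [hc, hl hW, hq hW', h34] with p h1 h2 h3 h4
    rcases le_total (P.height q) p.2 with h5 | h5
    · exact h4 _ h5
    · rcases le_total (P.height p.1) p.2 with h6 | h6
      · rw [P.lower_of_le _ _ h6]; exact h3
      · rw [h1 _ h5 h6]; exact h2

/-- The component of a forest over a root is contracted by the downward flow. -/
lemma contractibleSpace_component (r : T) (hr : P.lower r 0 = r) :
    ContractibleSpace {q : T // P.lower q 0 = r} := by
  rw [contractible_iff_id_nullhomotopic]
  refine ⟨⟨r, hr⟩, ⟨ContinuousMap.Homotopy.symm ⟨⟨fun p ↦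
    ⟨P.lower p.2.1 (p.1 * P.height p.2.1), ?_⟩, ?_⟩, ?_, ?_⟩⟩⟩
  · rw [P.lower_lower _ _ _ (mul_nonneg p.1.2.1 (P.height_nonneg _)), p.2.2]
  · refine Continuous.subtype_mk (P.continuous_uncurry_lower.comp (.prodMk (by fun_prop) ?_)) _
    exact (by fun_prop : Continuous fun p : unitInterval × {q : T // P.lower q 0 = r} ↦
      (p.1 : ℝ)).mul (P.continuous_height.comp (by fun_prop))
  · intro q
    ext
    simp [q.2]
  · intro q
    ext
    simp [P.lower_of_le]

/-- Two points on a preconnected set lie over the same root. -/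
lemma lower_zero_eq {X : Type*} [TopologicalSpace X] [PreconnectedSpace X] {g : X → T}
    (hg : Continuous g) (x y : X) : P.lower (g x) 0 = P.lower (g y) 0 :=
  P.lower_eq_of_isPreconnected isPreconnected_univ hg.continuousOn (fun _ _ ↦ P.height_nonneg _)
    (mem_univ x) (mem_univ y)

/-- The components of a forest are simply connected. -/
lemma homotopic (P : HeightedForest T) {a b : T} (p p' : Path a b) : p.Homotopic p' := by
  have hr : P.lower (P.lower a 0) 0 = P.lower a 0 := P.lower_lower _ _ _ le_rfl
  have := P.contractibleSpace_component (P.lower a 0) hr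
  have key : ∀ (p : Path a b) t, P.lower (p t) 0 = P.lower a 0 := fun p t ↦ by
    rw [P.lower_zero_eq p.continuous t 0, p.source]
  have hb : P.lower b 0 = P.lower a 0 := by simpa using key p 1
  let lift : Path a b → Path (⟨a, rfl⟩ : {q : T // P.lower q 0 = P.lower a 0}) ⟨b, hb⟩ :=
    fun p ↦ ⟨⟨fun t ↦ ⟨p t, key p t⟩, by fun_prop⟩, by ext; simp, by ext; simp⟩
  have := (SimplyConnectedSpace.paths_homotopic (lift p) (lift p')).map
    (⟨Subtype.val, continuous_subtype_val⟩ : C({q : T // P.lower q 0 = P.lower a 0}, T))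
  exact this

/-- Two distinct points over the same root are joined by an arc: descend from `a` to the highest
common lower point, then ascend to `b`. -/
lemma exists_injective_path [T2Space T] {a b : T} (hab : a ≠ b)
    (h0 : P.lower a 0 = P.lower b 0) : ∃ p : Path a b, Function.Injective p := by
  set m := min (P.height a) (P.height b) with hm
  let S : Set ℝ := Icc 0 m ∩ {h | P.lower a h = P.lower b h}
  have hScl : IsCompact S := isCompact_Icc.inter_right
    (isClosed_eq (P.continuous_lower a) (P.continuous_lower b))
  have hm0 : 0 ≤ m := le_min (P.height_nonneg _) (P.height_nonneg _)
  obtain ⟨μ, hμ, hmax⟩ := hScl.exists_isMaxOn ⟨0, ⟨le_rfl, hm0⟩, h0⟩ continuousOn_id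
  have hμa : μ ≤ P.height a := hμ.1.2.trans (min_le_left _ _)
  have hμb : μ ≤ P.height b := hμ.1.2.trans (min_le_right _ _)
  set A := P.height a - μ
  set B := P.height b - μ
  have hA : 0 ≤ A := sub_nonneg.2 hμa
  have hB : 0 ≤ B := sub_nonneg.2 hμb
  have hAB : 0 < A + B := by
    by_contra! hle
    have h1 : P.height a = μ := by simp only [A, B] at *; linarith
    have h2 : P.height b = μ := by simp only [A, B] at *; linarith
    apply hab
    have := hμ.2
    rwa [mem_ofPred_eq, P.lower_of_le a μ h1.le, P.lower_of_le b μ h2.le] at this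
  let g : ℝ → T := fun t ↦ if t ≤ A then P.lower a (P.height a - t) else P.lower b (μ + (t - A))
  have hg : Continuous g := by
    refine Continuous.if_le ((P.continuous_lower a).comp (by fun_prop))
      ((P.continuous_lower b).comp (by fun_prop)) continuous_id continuous_const ?_
    intro t ht
    have h1 : P.height a - t = μ := by rw [ht]; simp [A]
    have h2 : μ + (t - A) = μ := by rw [ht]; simp
    rw [h1, h2]; exact hμ.2
  have g0 : g 0 = a := by simp [g, hA, P.lower_of_le]
  have g1 : g (A + B) = b := by
    by_cases h : A + B ≤ A
    · have hB0 : B = 0 := le_antisymm (by linarith) hB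
      have h1 : P.height a - (A + B) = μ := by simp [A, hB0]
      have h2 : P.height b = μ := by simp only [B] at hB0; linarith
      simp only [g, h, if_true, h1]
      rw [show P.lower a μ = P.lower b μ from hμ.2, P.lower_of_le b μ h2.le]
    · simp only [g, h, if_false]
      rw [P.lower_of_le]
      simp only [A, B]; linarith
  have hleft : ∀ t, 0 ≤ t → t ≤ A → P.height (g t) = P.height a - t := fun t h1 h2 ↦ by
    simp only [g, h2, if_true]
    exact P.height_lower _ _ (by have := hμ.1.1; simp only [A] at h2; linarith) (by linarith)
  have hright : ∀ t, A < t → t ≤ A + B → P.height (g t) = μ + (t - A) := fun t h1 h2 ↦ by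
    simp only [g, h1.not_ge, if_false]
    exact P.height_lower _ _ (by have := hμ.1.1; linarith) (by simp only [B] at h2; linarith)
  -- below `a` and below `b` there is no common point above the level `μ`
  have hcross : ∀ t t', 0 ≤ t → t ≤ A → A < t' → t' ≤ A + B → g t ≠ g t' := by
    intro t t' h1 h2 h3 h4 heq
    have hh := congrArg P.height heq
    rw [hleft t h1 h2, hright t' h3 h4] at hh
    have hmem : μ + (t' - A) ∈ S := by
      refine ⟨⟨by have := hμ.1.1; linarith, le_min ?_ ?_⟩, ?_⟩
      · linarith
      · simp only [B] at h4; linarith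
      · simp only [g, h2, if_true, h3.not_ge, if_false] at heq
        rw [← hh] at heq ⊢
        exact heq
    have := hmax hmem
    simp only [id, mem_ofPred_eq] at this
    linarith
  have hinj : InjOn g (Icc 0 (A + B)) := by
    intro t ht t' ht' heq
    rcases le_or_gt t A with h1 | h1 <;> rcases le_or_gt t' A with h2 | h2
    · have := congrArg P.height heq
      rw [hleft t ht.1 h1, hleft t' ht'.1 h2] at this
      linarith
    · exact absurd heq (hcross t t' ht.1 h1 h2 ht'.2)
    · exact absurd heq.symm (hcross t' t ht'.1 h2 h1 ht.2)
    · have := congrArg P.height heq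
      rw [hright t h1 ht.2, hright t' h2 ht'.2] at this
      linarith
  refine ⟨⟨⟨fun t ↦ g (t * (A + B)), by fun_prop⟩, by simp [g0], by simp [g1]⟩, ?_⟩
  intro t t' heq
  have hmem : ∀ t : unitInterval, (t : ℝ) * (A + B) ∈ Icc 0 (A + B) := fun t ↦
    ⟨mul_nonneg t.2.1 hAB.le, mul_le_of_le_one_left hAB.le t.2.2⟩
  have := hinj (hmem t) (hmem t') heq
  exact Subtype.ext (mul_right_cancel₀ hAB.ne' this)

section Immersed

variable {P} {S : Set ℝ} {γ : ℝ → T}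

/-- The height has no local maximum along a locally injective path: near a point all lower points
lie on one descending arc. -/
lemma height_lt_max (hS : S.OrdConnected) (hγ : ContinuousOn γ S)
    (hinj : ∀ t ∈ S, ∃ U ∈ 𝓝[S] t, InjOn γ U) {t₁ t₂ t₃ : ℝ} (h₁ : t₁ ∈ S) (h₃ : t₃ ∈ S)
    (h12 : t₁ < t₂) (h23 : t₂ < t₃) :
    P.height (γ t₂) < max (P.height (γ t₁)) (P.height (γ t₃)) := by
  by_contra! hmax
  have hsub : Icc t₁ t₃ ⊆ S := hS.out h₁ h₃
  have hd : ContinuousOn (fun t ↦ P.height (γ t)) (Icc t₁ t₃) :=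
    P.continuous_height.comp_continuousOn (hγ.mono hsub)
  obtain ⟨c, hc, hcmax⟩ : ∃ c ∈ Ioo t₁ t₃, ∀ t ∈ Icc t₁ t₃, P.height (γ t) ≤ P.height (γ c) := by
    obtain ⟨c, hc, hcm⟩ := isCompact_Icc.exists_isMaxOn ⟨t₂, h12.le, h23.le⟩ hd
    have hcm' : ∀ t ∈ Icc t₁ t₃, P.height (γ t) ≤ P.height (γ c) := fun t ht ↦ hcm ht
    by_cases hc' : c ∈ Ioo t₁ t₃
    · exact ⟨c, hc', hcm'⟩
    · refine ⟨t₂, ⟨h12, h23⟩, fun t ht ↦ (hcm' t ht).trans ?_⟩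
      have : c = t₁ ∨ c = t₃ := by
        by_contra! hne
        exact hc' ⟨lt_of_le_of_ne hc.1 hne.1.symm, lt_of_le_of_ne hc.2 hne.2⟩
      rcases this with rfl | rfl
      · exact (le_max_left _ _).trans hmax
      · exact (le_max_right _ _).trans hmax
  have hcS : S ∈ 𝓝 c := Filter.mem_of_superset (Icc_mem_nhds hc.1 hc.2) hsub
  obtain ⟨U, hU, hUinj⟩ := hinj c (mem_of_mem_nhds hcS)
  rw [nhdsWithin_eq_nhds.2 hcS] at hU
  have hcomp := (hγ.continuousAt hcS).eventually (P.eventually_comparable (γ c))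
  obtain ⟨ε, hε, hball⟩ := Metric.nhds_basis_closedBall.mem_iff.1
    (Filter.inter_mem (Filter.inter_mem hU hcomp) (Icc_mem_nhds hc.1 hc.2))
  rw [Real.closedBall_eq_Icc] at hball
  have hlow : ∀ t ∈ Icc (c - ε) (c + ε), γ t = P.lower (γ c) (P.height (γ t)) := by
    intro t ht
    obtain ⟨⟨-, h1⟩, h2⟩ := hball ht
    rcases h1 with h1 | h1
    · exact h1
    · rw [P.lower_of_le _ _ (hcmax t h2)] at h1
      rw [h1, P.lower_of_le _ _ le_rfl]
  have hkey : ∀ t ∈ Icc (c - ε) (c + ε), ∀ t' ∈ Icc (c - ε) (c + ε),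
      P.height (γ t) = P.height (γ t') → t = t' := by
    intro t ht t' ht' heq
    refine hUinj (hball ht).1.1 (hball ht').1.1 ?_
    rw [hlow t ht, hlow t' ht', heq]
  have hsub' : Icc (c - ε) (c + ε) ⊆ Icc t₁ t₃ := fun t ht ↦ (hball ht).2
  rcases le_total (P.height (γ (c - ε))) (P.height (γ (c + ε))) with hle | hle
  · obtain ⟨t, ht, heq⟩ := intermediate_value_Icc (by linarith : c - ε ≤ c)
      (hd.mono ((Icc_subset_Icc_right (by linarith)).trans hsub'))
      ⟨hle, hcmax _ (hsub' ⟨by linarith, le_rfl⟩)⟩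
    have := hkey t ⟨ht.1, by linarith [ht.2]⟩ (c + ε) ⟨by linarith, le_rfl⟩ heq
    linarith [ht.2]
  · obtain ⟨t, ht, heq⟩ := intermediate_value_Icc' (by linarith : c ≤ c + ε)
      (hd.mono ((Icc_subset_Icc_left (by linarith)).trans hsub'))
      ⟨hle, hcmax _ (hsub' ⟨le_rfl, by linarith⟩)⟩
    have := hkey t ⟨by linarith [ht.1], ht.2⟩ (c - ε) ⟨le_rfl, by linarith⟩ heq
    linarith [ht.1]

/-- A locally injective path climbs strictly after its lowest point. -/
lemma strictMonoOn_height (hS : S.OrdConnected) (hγ : ContinuousOn γ S)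
    (hinj : ∀ t ∈ S, ∃ U ∈ 𝓝[S] t, InjOn γ U) {c : ℝ} (hc : c ∈ S)
    (hmin : ∀ t ∈ S, P.height (γ c) ≤ P.height (γ t)) :
    StrictMonoOn (fun t ↦ P.height (γ t)) (S ∩ Ici c) := by
  have key : ∀ u ∈ S, ∀ v ∈ S, c < u → u < v → P.height (γ u) < P.height (γ v) := by
    intro u hu v hv h1 h2
    have := height_lt_max (P := P) hS hγ hinj hc hv h1 h2
    rcases lt_max_iff.1 this with h | h
    · exact absurd h (hmin u hu).not_gt
    · exact h
  rintro u ⟨hu, hcu⟩ v ⟨hv, -⟩ huv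
  rcases (mem_Ici.1 hcu).eq_or_lt with rfl | h
  · obtain ⟨w, h1, h2⟩ := exists_between huv
    exact (hmin w (hS.out hc hv ⟨h1.le, h2.le⟩)).trans_lt
      (key w (hS.out hc hv ⟨h1.le, h2.le⟩) v hv h1 h2)
  · exact key u hu v hv h huv

/-- After its lowest point `c`, a locally injective path runs on the descent from any of its later
points. -/
lemma eq_lower (hS : S.OrdConnected) (hγ : ContinuousOn γ S)
    (hinj : ∀ t ∈ S, ∃ U ∈ 𝓝[S] t, InjOn γ U) {c : ℝ} (hc : c ∈ S)
    (hmin : ∀ t ∈ S, P.height (γ c) ≤ P.height (γ t)) {u v : ℝ} (hv : v ∈ S) (hcu : c ≤ u)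
    (huv : u ≤ v) : γ u = P.lower (γ v) (P.height (γ u)) := by
  have hmono := (strictMonoOn_height hS hγ hinj hc hmin).monotoneOn
  have hsub : Icc u v ⊆ S ∩ Ici c := fun t ht ↦
    ⟨hS.out hc hv ⟨hcu.trans ht.1, ht.2⟩, hcu.trans ht.1⟩
  have := P.lower_eq_of_isPreconnected isPreconnected_Icc
    (hγ.mono (hsub.trans inter_subset_left)) (h := P.height (γ u))
    (fun t ht ↦ hmono (hsub ⟨le_rfl, huv⟩) (hsub ht) ht.1) (left_mem_Icc.2 huv)
    (right_mem_Icc.2 huv)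
  rwa [P.lower_of_le _ _ le_rfl] at this

lemma strictAntiOn_height (hS : S.OrdConnected) (hγ : ContinuousOn γ S)
    (hinj : ∀ t ∈ S, ∃ U ∈ 𝓝[S] t, InjOn γ U) {c : ℝ} (hc : c ∈ S)
    (hmin : ∀ t ∈ S, P.height (γ c) ≤ P.height (γ t)) :
    StrictAntiOn (fun t ↦ P.height (γ t)) (S ∩ Iic c) := by
  have := strictMonoOn_height (P := P) (S := -S) (γ := fun t ↦ γ (-t)) (c := -c)
    ⟨fun x hx y hy z hz ↦ hS.out hy hx ⟨neg_le_neg hz.2, neg_le_neg hz.1⟩⟩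
    (hγ.comp continuous_neg.continuousOn fun t ht ↦ ht) (locallyInjOn_comp_neg hinj) (by simpa)
    (by simpa using fun t ht ↦ hmin (-t) ht)
  intro u hu v hv huv
  have := this (a := -v) (b := -u) ⟨by simpa using hv.1, neg_le_neg (mem_Iic.1 hv.2)⟩
    ⟨by simpa using hu.1, neg_le_neg (mem_Iic.1 hu.2)⟩ (neg_lt_neg huv)
  simpa using this

lemma eq_lower' (hS : S.OrdConnected) (hγ : ContinuousOn γ S)
    (hinj : ∀ t ∈ S, ∃ U ∈ 𝓝[S] t, InjOn γ U) {c : ℝ} (hc : c ∈ S)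
    (hmin : ∀ t ∈ S, P.height (γ c) ≤ P.height (γ t)) {u v : ℝ} (hv : v ∈ S) (huc : u ≤ c)
    (hvu : v ≤ u) : γ u = P.lower (γ v) (P.height (γ u)) := by
  have := eq_lower (P := P) (S := -S) (γ := fun t ↦ γ (-t)) (c := -c)
    ⟨fun x hx y hy z hz ↦ hS.out hy hx ⟨neg_le_neg hz.2, neg_le_neg hz.1⟩⟩
    (hγ.comp continuous_neg.continuousOn fun t ht ↦ ht) (locallyInjOn_comp_neg hinj) (by simpa)
    (by simpa using fun t ht ↦ hmin (-t) ht) (u := -u) (v := -v) (by simpa) (neg_le_neg huc)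
    (neg_le_neg hvu)
  simpa using this

/-- A locally injective path in a forest is injective. If it closed up, its two branches on either
side of the lowest point would both run on the descent from the common endpoint, hence agree near
the lowest point. -/
lemma injOn_of_locallyInjOn (P : HeightedForest T) (hS : S.OrdConnected) (hγ : ContinuousOn γ S)
    (hinj : ∀ t ∈ S, ∃ U ∈ 𝓝[S] t, InjOn γ U) : InjOn γ S := by
  have main : ∀ a ∈ S, ∀ b ∈ S, a < b → γ a ≠ γ b := by
    intro a ha b hb hab heq
    have hsub : Icc a b ⊆ S := hS.out ha hb
    have hγ' := hγ.mono hsub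
    have hinj' : ∀ t ∈ Icc a b, ∃ U ∈ 𝓝[Icc a b] t, InjOn γ U := fun t ht ↦ by
      obtain ⟨U, hU, h⟩ := hinj t (hsub ht)
      exact ⟨U, nhdsWithin_mono _ hsub hU, h⟩
    have hd : ContinuousOn (fun t ↦ P.height (γ t)) (Icc a b) :=
      P.continuous_height.comp_continuousOn hγ'
    obtain ⟨c, hc, hmin⟩ := isCompact_Icc.exists_isMinOn ⟨a, le_rfl, hab.le⟩ hd
    have hmin' : ∀ t ∈ Icc a b, P.height (γ c) ≤ P.height (γ t) := fun t ht ↦ hmin ht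
    have hlt : P.height (γ c) < P.height (γ a) := by
      obtain ⟨w, h1, h2⟩ := exists_between hab
      have := height_lt_max (P := P) hS hγ hinj ha hb h1 h2
      rw [← heq, max_self] at this
      exact (hmin' w ⟨h1.le, h2.le⟩).trans_lt this
    have hca : c ≠ a := fun h ↦ by rw [h] at hlt; exact lt_irrefl _ hlt
    have hcb : c ≠ b := fun h ↦ by rw [h, heq] at hlt; exact lt_irrefl _ hlt
    have hac : a < c := lt_of_le_of_ne hc.1 hca.symm
    have hcb : c < b := lt_of_le_of_ne hc.2 hcb
    obtain ⟨U, hU, hUinj⟩ := hinj' c hc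
    rw [nhdsWithin_eq_nhds.2 (Icc_mem_nhds hac hcb)] at hU
    obtain ⟨ε, hε, hball⟩ := Metric.nhds_basis_closedBall.mem_iff.1
      (Filter.inter_mem hU (Icc_mem_nhds hac hcb))
    rw [Real.closedBall_eq_Icc] at hball
    have hl := hball (⟨le_rfl, by linarith⟩ : c - ε ∈ Icc (c - ε) (c + ε))
    have hr := hball (⟨by linarith, le_rfl⟩ : c + ε ∈ Icc (c - ε) (c + ε))
    have hmono := strictMonoOn_height (P := P) ordConnected_Icc hγ' hinj' hc hmin'
    have hanti := strictAntiOn_height (P := P) ordConnected_Icc hγ' hinj' hc hmin'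
    have hdr : P.height (γ c) < P.height (γ (c + ε)) :=
      hmono ⟨hc, self_mem_Ici⟩ ⟨hr.2, mem_Ici.2 (by linarith)⟩ (by linarith)
    have hdl : P.height (γ c) < P.height (γ (c - ε)) :=
      hanti ⟨hl.2, mem_Iic.2 (by linarith)⟩ ⟨hc, self_mem_Iic⟩ (by linarith)
    set h := min (P.height (γ (c - ε))) (P.height (γ (c + ε)))
    have hh : P.height (γ c) < h := lt_min hdl hdr
    obtain ⟨u, hu, hu'⟩ := intermediate_value_Icc' (by linarith : c - ε ≤ c)
      (hd.mono (Icc_subset_Icc hl.2.1 hc.2)) ⟨hh.le, min_le_left _ _⟩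
    obtain ⟨v, hv, hv'⟩ := intermediate_value_Icc (by linarith : c ≤ c + ε)
      (hd.mono (Icc_subset_Icc hc.1 hr.2.2)) ⟨hh.le, min_le_right _ _⟩
    have e1 := eq_lower' (P := P) ordConnected_Icc hγ' hinj' hc hmin' (v := a) ⟨le_rfl, hab.le⟩
      hu.2 (hl.2.1.trans hu.1)
    have e2 := eq_lower (P := P) ordConnected_Icc hγ' hinj' hc hmin' (v := b) ⟨hab.le, le_rfl⟩
      hv.1 (hv.2.trans hr.2.2)
    simp only at hu' hv'
    have huv : γ u = γ v := by rw [e1, e2, hu', hv', heq]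
    have := hUinj (hball ⟨hu.1, by linarith [hu.2]⟩).1 (hball ⟨by linarith [hv.1], hv.2⟩).1 huv
    have : u = c := le_antisymm hu.2 (this ▸ hv.1)
    rw [this] at hu'
    exact hh.ne hu'
  intro a ha b hb heq
  by_contra hne
  rcases lt_or_gt_of_ne hne with h | h
  · exact main a ha b hb h heq
  · exact main b hb a ha h heq.symm

end Immersed

end HeightedForest

/-! ### Lines in a forest at bounded distance -/

namespace HeightedForest

open Filter

lemma locallyInjOn_univ {T : Type*} {γ : ℝ → T} (hi : IsLocallyInjective γ) :
    ∀ t ∈ (univ : Set ℝ), ∃ U ∈ 𝓝[univ] t, InjOn γ U := fun t _ ↦ by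
  obtain ⟨U, hU, ht, h⟩ := hi t
  exact ⟨U, by rw [nhdsWithin_univ]; exact hU.mem_nhds ht, h⟩

lemma isLocallyInjective_comp_neg {T : Type*} {γ : ℝ → T} (hi : IsLocallyInjective γ) :
    IsLocallyInjective (fun t : ℝ ↦ γ (-t)) :=
  hi.comp_right continuous_neg neg_injective

variable {T : Type*} [TopologicalSpace T] {P : HeightedForest T} {γ γ₀ γ₁ : ℝ → T}

lemma not_strictAnti_of_finite {d : ℝ → ℝ}
    (hfin : ∀ B, {r | ∃ n : ℤ, d n = r ∧ r ≤ B}.Finite) : ¬ StrictAnti d := fun hanti ↦ by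
  refine (hfin (d 0)).not_infinite (Set.infinite_of_injective_forall_mem (f := fun n : ℕ ↦ d n)
    (fun a b hab ↦ by exact_mod_cast hanti.injective hab) fun n ↦ ⟨n, by simp, ?_⟩)
  exact hanti.antitone (Nat.cast_nonneg n)

/-- A function without local maxima whose values at the integers are discrete and bounded below
tends to infinity. -/
lemma tendsto_atTop_of_finite {d : ℝ → ℝ} (hd : ∀ a b c, a < b → b < c → d b < max (d a) (d c))
    (hfin : ∀ B, {r | ∃ n : ℤ, d n = r ∧ r ≤ B}.Finite) : Tendsto d atTop atTop := by
  obtain ⟨u, v, huv, hle⟩ : ∃ u v, u < v ∧ d u ≤ d v := by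
    by_contra! h
    exact not_strictAnti_of_finite hfin fun a b hab ↦ h a b hab
  have h1 : ∀ w, v < w → d v < d w := fun w hw ↦ by
    rcases lt_max_iff.1 (hd u v w huv hw) with h | h
    · exact absurd hle h.not_ge
    · exact h
  have h2 : StrictMonoOn d (Ici v) := by
    intro w hw w' _ hww'
    rcases (mem_Ici.1 hw).eq_or_lt with rfl | hlt
    · exact h1 _ hww'
    · rcases lt_max_iff.1 (hd v w w' hlt hww') with h | h
      · exact absurd (h1 w hlt) h.not_gt
      · exact h
  rw [tendsto_atTop]
  intro B
  obtain ⟨N, hN⟩ := exists_nat_gt v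
  have hmem : ∀ n : ℕ, ((n + N : ℕ) : ℝ) ∈ Ici v := fun n ↦ by
    rw [mem_Ici, Nat.cast_add]; linarith [(Nat.cast_nonneg n : (0 : ℝ) ≤ n)]
  obtain ⟨n, hn⟩ : ∃ n : ℕ, B < d (n + N : ℕ) := by
    by_contra! h
    refine (hfin B).not_infinite (Set.infinite_of_injective_forall_mem
      (f := fun n : ℕ ↦ d (n + N : ℕ)) (fun a b hab ↦ ?_) fun n ↦ ⟨((n + N : ℕ) : ℤ), ?_, h n⟩)
    · have := h2.injOn (hmem a) (hmem b) hab
      exact Nat.add_right_cancel (by exact_mod_cast this)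
    · simp
  filter_upwards [eventually_ge_atTop (((n + N : ℕ) : ℝ))] with s hs
  exact hn.le.trans (h2.monotoneOn (hmem n) ((hmem n).trans hs) hs)

/-- The height is proper along a line whose integer points have heights in a discrete set. -/
lemma exists_min_tendsto (hγ : Continuous γ) (hi : IsLocallyInjective γ)
    (hfin : ∀ B, {r | ∃ n : ℤ, P.height (γ n) = r ∧ r ≤ B}.Finite) :
    Tendsto (fun t ↦ P.height (γ t)) atTop atTop ∧
      ∃ c, ∀ t, P.height (γ c) ≤ P.height (γ t) := by
  have hq : ∀ a b c, a < b → b < c →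
      P.height (γ b) < max (P.height (γ a)) (P.height (γ c)) := fun a b c hab hbc ↦
    height_lt_max ordConnected_univ hγ.continuousOn (locallyInjOn_univ hi) (mem_univ a)
      (mem_univ c) hab hbc
  have h1 := tendsto_atTop_of_finite (d := fun t ↦ P.height (γ t)) hq hfin
  have h2 := tendsto_atTop_of_finite (d := fun t ↦ P.height (γ (-t)))
    (fun a b c hab hbc ↦ by rw [max_comm]; exact hq _ _ _ (neg_lt_neg hbc) (neg_lt_neg hab))
    (fun B ↦ (hfin B).subset (by
      rintro r ⟨n, hn, hr⟩
      exact ⟨-n, by simpa using hn, hr⟩))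
  refine ⟨h1, (P.continuous_height.comp hγ).exists_forall_le ?_⟩
  rw [cocompact_eq_atBot_atTop, tendsto_sup]
  refine ⟨?_, h1⟩
  have := h2.comp tendsto_neg_atBot_atTop
  simpa [Function.comp_def] using this

/-- If two lines stay at bounded distance, then the positive ray of the first is contained in that
of the second, down to the lowest level of the second: descend from far away. -/
lemma exists_eq_of_ge (h₀ : Continuous γ₀) (h₁ : Continuous γ₁) (i₀ : IsLocallyInjective γ₀)
    (i₁ : IsLocallyInjective γ₁)
    (hfin₀ : ∀ B, {r | ∃ n : ℤ, P.height (γ₀ n) = r ∧ r ≤ B}.Finite) {C : ℝ}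
    (hK : ∀ n : ℤ, ∃ K : Set T, IsPreconnected K ∧ γ₀ n ∈ K ∧ γ₁ n ∈ K ∧
      ∀ q ∈ K, ∀ q' ∈ K, P.height q ≤ P.height q' + C) {c₀ c₁ : ℝ}
    (hc₀ : ∀ t, P.height (γ₀ c₀) ≤ P.height (γ₀ t))
    (hc₁ : ∀ t, P.height (γ₁ c₁) ≤ P.height (γ₁ t)) {s : ℝ} (hs : c₀ ≤ s)
    (hle : P.height (γ₁ c₁) ≤ P.height (γ₀ s)) : ∃ s', c₁ ≤ s' ∧ γ₀ s = γ₁ s' := by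
  have ht : Tendsto (fun n : ℕ ↦ P.height (γ₀ n)) atTop atTop :=
    (exists_min_tendsto h₀ i₀ hfin₀).1.comp tendsto_natCast_atTop_atTop
  obtain ⟨n, hn1, hn2, hn3⟩ := ((ht.eventually_ge_atTop (P.height (γ₀ s) + C)).and
    ((tendsto_natCast_atTop_atTop.eventually_ge_atTop s).and
      (tendsto_natCast_atTop_atTop.eventually_ge_atTop c₁))).exists
  obtain ⟨K, hKc, hK0, hK1, hKC⟩ := hK n
  simp only [Int.cast_natCast] at hK0 hK1
  have hge : ∀ q ∈ K, P.height (γ₀ s) ≤ P.height q := fun q hq ↦ by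
    linarith [hKC _ hK0 q hq]
  have e0 := eq_lower (P := P) ordConnected_univ h₀.continuousOn (locallyInjOn_univ i₀)
    (mem_univ c₀) (fun t _ ↦ hc₀ t) (mem_univ (n : ℝ)) hs hn2
  have e1 := P.lower_eq_of_isPreconnected hKc continuousOn_id hge hK0 hK1
  obtain ⟨s', hs', heq⟩ := intermediate_value_Icc hn3
    (P.continuous_height.comp h₁).continuousOn ⟨hle, hge _ hK1⟩
  have e2 := eq_lower (P := P) ordConnected_univ h₁.continuousOn (locallyInjOn_univ i₁)
    (mem_univ c₁) (fun t _ ↦ hc₁ t) (mem_univ (n : ℝ)) hs'.1 hs'.2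
  refine ⟨s', hs'.1, ?_⟩
  simp only [Function.comp_apply, id] at heq e1
  rw [e0, e1, e2, heq]

lemma exists_eq_of_le (h₀ : Continuous γ₀) (h₁ : Continuous γ₁) (i₀ : IsLocallyInjective γ₀)
    (i₁ : IsLocallyInjective γ₁)
    (hfin₀ : ∀ B, {r | ∃ n : ℤ, P.height (γ₀ n) = r ∧ r ≤ B}.Finite) {C : ℝ}
    (hK : ∀ n : ℤ, ∃ K : Set T, IsPreconnected K ∧ γ₀ n ∈ K ∧ γ₁ n ∈ K ∧
      ∀ q ∈ K, ∀ q' ∈ K, P.height q ≤ P.height q' + C) {c₀ c₁ : ℝ}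
    (hc₀ : ∀ t, P.height (γ₀ c₀) ≤ P.height (γ₀ t))
    (hc₁ : ∀ t, P.height (γ₁ c₁) ≤ P.height (γ₁ t)) {s : ℝ} (hs : s ≤ c₀)
    (hle : P.height (γ₁ c₁) ≤ P.height (γ₀ s)) : ∃ s', s' ≤ c₁ ∧ γ₀ s = γ₁ s' := by
  obtain ⟨s', hs', heq⟩ := exists_eq_of_ge (P := P) (h₀.comp continuous_neg)
    (h₁.comp continuous_neg) (isLocallyInjective_comp_neg i₀) (isLocallyInjective_comp_neg i₁)
    (fun B ↦ (hfin₀ B).subset (by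
      rintro r ⟨n, hn, hr⟩
      exact ⟨-n, by simpa using hn, hr⟩))
    (fun n ↦ by simpa using hK (-n)) (c₀ := -c₀) (c₁ := -c₁) (by simpa using fun t ↦ hc₀ (-t))
    (by simpa using fun t ↦ hc₁ (-t)) (neg_le_neg hs) (by simpa using hle)
  exact ⟨-s', neg_le.1 hs', by simpa using heq⟩

/-- Two locally injective lines in a forest that stay at bounded distance differ by a monotone
reparametrization. Bounded distance means here that the points with the same integer parameter `n`
lie on a connected set `K` on which the height varies by at most a constant `C`. -/
theorem exists_reparametrization (h₀ : Continuous γ₀) (h₁ : Continuous γ₁)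
    (i₀ : IsLocallyInjective γ₀) (i₁ : IsLocallyInjective γ₁)
    (hfin₀ : ∀ B, {r | ∃ n : ℤ, P.height (γ₀ n) = r ∧ r ≤ B}.Finite)
    (hfin₁ : ∀ B, {r | ∃ n : ℤ, P.height (γ₁ n) = r ∧ r ≤ B}.Finite) {C : ℝ}
    (hK : ∀ n : ℤ, ∃ K : Set T, IsPreconnected K ∧ γ₀ n ∈ K ∧ γ₁ n ∈ K ∧
      ∀ q ∈ K, ∀ q' ∈ K, P.height q ≤ P.height q' + C) :
    ∃ φ : ℝ → ℝ, Continuous φ ∧ ∀ s, γ₀ s = γ₁ (φ s) := by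
  obtain ⟨-, c₀, hc₀⟩ := exists_min_tendsto (P := P) h₀ i₀ hfin₀
  obtain ⟨-, c₁, hc₁⟩ := exists_min_tendsto (P := P) h₁ i₁ hfin₁
  have inj : ∀ {γ : ℝ → T}, Continuous γ → IsLocallyInjective γ → Function.Injective γ :=
    fun {γ} h i ↦ injOn_univ.1 (P.injOn_of_locallyInjOn ordConnected_univ
      h.continuousOn (locallyInjOn_univ i))
  have hK' : ∀ n : ℤ, ∃ K : Set T, IsPreconnected K ∧ γ₁ n ∈ K ∧ γ₀ n ∈ K ∧
      ∀ q ∈ K, ∀ q' ∈ K, P.height q ≤ P.height q' + C := fun n ↦ by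
    obtain ⟨K, a, b, c, d⟩ := hK n
    exact ⟨K, a, c, b, d⟩
  -- the lowest points of the two lines have the same height: the lowest point of the higher line
  -- would lie on both rays of the other line
  have h10 : P.height (γ₁ c₁) ≤ P.height (γ₀ c₀) := by
    by_contra! hlt
    obtain ⟨s, hs, hs'⟩ := exists_eq_of_ge h₁ h₀ i₁ i₀ hfin₁ hK' hc₁ hc₀ le_rfl hlt.le
    obtain ⟨t, ht, ht'⟩ := exists_eq_of_le h₁ h₀ i₁ i₀ hfin₁ hK' hc₁ hc₀ le_rfl hlt.le
    have hst : s = t := inj h₀ i₀ (hs'.symm.trans ht')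
    have : s = c₀ := le_antisymm (hst ▸ ht) hs
    rw [hs', this] at hlt
    exact lt_irrefl _ hlt
  have h01 : P.height (γ₀ c₀) ≤ P.height (γ₁ c₁) := by
    by_contra! hlt
    obtain ⟨s, hs, hs'⟩ := exists_eq_of_ge h₀ h₁ i₀ i₁ hfin₀ hK hc₀ hc₁ le_rfl hlt.le
    obtain ⟨t, ht, ht'⟩ := exists_eq_of_le h₀ h₁ i₀ i₁ hfin₀ hK hc₀ hc₁ le_rfl hlt.le
    have hst : s = t := inj h₁ i₁ (hs'.symm.trans ht')
    have : s = c₁ := le_antisymm (hst ▸ ht) hs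
    rw [hs', this] at hlt
    exact lt_irrefl _ hlt
  -- every point of the first line lies on the second one, on the same side of the lowest point
  have hex : ∀ s, ∃ s', γ₀ s = γ₁ s' ∧ (c₀ ≤ s → c₁ ≤ s') ∧ (s ≤ c₀ → s' ≤ c₁) := by
    intro s
    have hle : P.height (γ₁ c₁) ≤ P.height (γ₀ s) := h10.trans (hc₀ s)
    rcases lt_trichotomy s c₀ with h | h | h
    · obtain ⟨s', hs', heq⟩ := exists_eq_of_le h₀ h₁ i₀ i₁ hfin₀ hK hc₀ hc₁ h.le hle
      exact ⟨s', heq, fun h' ↦ absurd h h'.not_gt, fun _ ↦ hs'⟩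
    · obtain ⟨s', hs', heq⟩ := exists_eq_of_le h₀ h₁ i₀ i₁ hfin₀ hK hc₀ hc₁ h.le hle
      obtain ⟨t', ht', heq'⟩ := exists_eq_of_ge h₀ h₁ i₀ i₁ hfin₀ hK hc₀ hc₁ h.ge hle
      obtain rfl : s' = t' := inj h₁ i₁ (heq.symm.trans heq')
      exact ⟨s', heq, fun _ ↦ ht', fun _ ↦ hs'⟩
    · obtain ⟨s', hs', heq⟩ := exists_eq_of_ge h₀ h₁ i₀ i₁ hfin₀ hK hc₀ hc₁ h.le hle
      exact ⟨s', heq, fun _ ↦ hs', fun h' ↦ absurd h h'.not_gt⟩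
  choose φ hφ hφ1 hφ2 using hex
  have mono0 := strictMonoOn_height (P := P) ordConnected_univ h₀.continuousOn
    (locallyInjOn_univ i₀) (mem_univ c₀) (fun t _ ↦ hc₀ t)
  have anti0 := strictAntiOn_height (P := P) ordConnected_univ h₀.continuousOn
    (locallyInjOn_univ i₀) (mem_univ c₀) (fun t _ ↦ hc₀ t)
  have mono1 := strictMonoOn_height (P := P) ordConnected_univ h₁.continuousOn
    (locallyInjOn_univ i₁) (mem_univ c₁) (fun t _ ↦ hc₁ t)
  have anti1 := strictAntiOn_height (P := P) ordConnected_univ h₁.continuousOn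
    (locallyInjOn_univ i₁) (mem_univ c₁) (fun t _ ↦ hc₁ t)
  have hmono : Monotone φ := by
    have key1 : ∀ s t, c₀ ≤ s → s ≤ t → φ s ≤ φ t := by
      intro s t hs hst
      refine (mono1.le_iff_le ⟨mem_univ _, hφ1 s hs⟩ ⟨mem_univ _, hφ1 t (hs.trans hst)⟩).1 ?_
      simp only [← hφ]
      exact mono0.monotoneOn ⟨mem_univ _, hs⟩ ⟨mem_univ _, hs.trans hst⟩ hst
    have key2 : ∀ s t, t ≤ c₀ → s ≤ t → φ s ≤ φ t := by
      intro s t ht hst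
      refine (anti1.le_iff_ge ⟨mem_univ _, hφ2 t ht⟩ ⟨mem_univ _, hφ2 s (hst.trans ht)⟩).1 ?_
      simp only [← hφ]
      exact anti0.antitoneOn ⟨mem_univ _, hst.trans ht⟩ ⟨mem_univ _, ht⟩ hst
    intro s t hst
    rcases le_total c₀ s with h | h
    · exact key1 s t h hst
    · rcases le_total c₀ t with h' | h'
      · exact (hφ2 s h).trans (hφ1 t h')
      · exact key2 s t h' hst
  have hsurj : Function.Surjective φ := by
    intro s'
    have hle : P.height (γ₀ c₀) ≤ P.height (γ₁ s') := h01.trans (hc₁ s')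
    obtain ⟨s, hs⟩ : ∃ s, γ₁ s' = γ₀ s := by
      rcases le_total c₁ s' with h | h
      · obtain ⟨s, -, hs⟩ := exists_eq_of_ge h₁ h₀ i₁ i₀ hfin₁ hK' hc₁ hc₀ h hle
        exact ⟨s, hs⟩
      · obtain ⟨s, -, hs⟩ := exists_eq_of_le h₁ h₀ i₁ i₀ hfin₁ hK' hc₁ hc₀ h hle
        exact ⟨s, hs⟩
    exact ⟨s, inj h₁ i₁ ((hφ s).symm.trans hs.symm)⟩
  exact ⟨φ, hmono.continuous_of_surjective hsurj, hφ⟩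

end HeightedForest

/-! ### Graphs in parametrized form -/

/-- The data of a graph with vertex set `V` and edge set `E` on a subset `C` of a space: its
vertices as points and its edges as paths on `[0, 1]`, with disjoint injective interiors. -/
structure GraphOn {X : Type*} [TopologicalSpace X] (C : Set X) (V E : Type*) where
  /-- the point of a vertex -/
  vert : V → X
  /-- the parametrization of an edge by `[0, 1]` -/
  edge : E → ℝ → X
  /-- the initial vertex of an edge -/
  src : E → V
  /-- the terminal vertex of an edge -/
  tgt : E → V
  vert_injective : Function.Injective vert
  continuousOn_edge : ∀ e, ContinuousOn (edge e) (Icc 0 1)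
  edge_zero : ∀ e, edge e 0 = vert (src e)
  edge_one : ∀ e, edge e 1 = vert (tgt e)
  edge_injective : ∀ {e e' t t'}, t ∈ Ioo (0 : ℝ) 1 → t' ∈ Ioo (0 : ℝ) 1 →
    edge e t = edge e' t' → e = e' ∧ t = t'
  edge_ne_vert : ∀ {e t v}, t ∈ Ioo (0 : ℝ) 1 → edge e t ≠ vert v
  exists_eq : ∀ {x}, x ∈ C → (∃ v, x = vert v) ∨ ∃ e, ∃ t ∈ Ioo (0 : ℝ) 1, x = edge e t
  edge_mem : ∀ {e t}, t ∈ Icc (0 : ℝ) 1 → edge e t ∈ C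

namespace GraphOn

variable {X V E : Type*} [TopologicalSpace X] {C : Set X} (G : GraphOn C V E)

/-- The orientation reversal on oriented edges; `(e, true)` is `e` with its own orientation. -/
def rev (a : E × Bool) : E × Bool := (a.1, !a.2)

/-- The initial vertex of an oriented edge. -/
def osrc (a : E × Bool) : V := if a.2 then G.src a.1 else G.tgt a.1

/-- The terminal vertex of an oriented edge. -/
def otgt (a : E × Bool) : V := if a.2 then G.tgt a.1 else G.src a.1

/-- The parametrization of an oriented edge. -/
def oedge (a : E × Bool) (t : ℝ) : X := if a.2 then G.edge a.1 t else G.edge a.1 (1 - t)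

@[simp] lemma rev_rev (a : E × Bool) : rev (rev a) = a := by simp [rev]

@[simp] lemma osrc_rev (a : E × Bool) : G.osrc (rev a) = G.otgt a := by
  rcases a with ⟨e, _ | _⟩ <;> rfl

@[simp] lemma otgt_rev (a : E × Bool) : G.otgt (rev a) = G.osrc a := by
  rcases a with ⟨e, _ | _⟩ <;> rfl

lemma oedge_zero (a : E × Bool) : G.oedge a 0 = G.vert (G.osrc a) := by
  rcases a with ⟨e, _ | _⟩ <;> simp [oedge, osrc, edge_zero, edge_one]

lemma oedge_one (a : E × Bool) : G.oedge a 1 = G.vert (G.otgt a) := by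
  rcases a with ⟨e, _ | _⟩ <;> simp [oedge, otgt, edge_zero, edge_one]

lemma one_sub_mem_Ioo {t : ℝ} (ht : t ∈ Ioo (0 : ℝ) 1) : 1 - t ∈ Ioo (0 : ℝ) 1 :=
  ⟨by linarith [ht.2], by linarith [ht.1]⟩

lemma one_sub_mem_Icc {t : ℝ} (ht : t ∈ Icc (0 : ℝ) 1) : 1 - t ∈ Icc (0 : ℝ) 1 :=
  ⟨by linarith [ht.2], by linarith [ht.1]⟩

lemma oedge_ne_vert {a : E × Bool} {t : ℝ} {v : V} (ht : t ∈ Ioo (0 : ℝ) 1) :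
    G.oedge a t ≠ G.vert v := by
  rcases a with ⟨e, _ | _⟩
  · exact G.edge_ne_vert (one_sub_mem_Ioo ht)
  · exact G.edge_ne_vert ht

lemma oedge_mem {a : E × Bool} {t : ℝ} (ht : t ∈ Icc (0 : ℝ) 1) : G.oedge a t ∈ C := by
  rcases a with ⟨e, _ | _⟩
  · exact G.edge_mem (one_sub_mem_Icc ht)
  · exact G.edge_mem ht

lemma continuousOn_oedge (a : E × Bool) : ContinuousOn (G.oedge a) (Icc 0 1) := by
  rcases a with ⟨e, _ | _⟩
  · exact (G.continuousOn_edge e).comp (by fun_prop) fun t ht ↦ one_sub_mem_Icc ht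
  · exact G.continuousOn_edge e

lemma oedge_eq {a b : E × Bool} {t s : ℝ} (ht : t ∈ Ioo (0 : ℝ) 1) (hs : s ∈ Ioo (0 : ℝ) 1)
    (h : G.oedge a t = G.oedge b s) : a = b ∧ t = s ∨ b = rev a ∧ s = 1 - t := by
  rcases a with ⟨e, _ | _⟩ <;> rcases b with ⟨e', _ | _⟩
  · obtain ⟨rfl, h⟩ := G.edge_injective (one_sub_mem_Ioo ht) (one_sub_mem_Ioo hs) h
    exact .inl ⟨rfl, by linarith⟩
  · obtain ⟨rfl, h'⟩ := G.edge_injective (one_sub_mem_Ioo ht) hs h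
    exact .inr ⟨rfl, h'.symm⟩
  · obtain ⟨rfl, h⟩ := G.edge_injective ht (one_sub_mem_Ioo hs) h
    exact .inr ⟨rfl, by linarith⟩
  · obtain ⟨rfl, h'⟩ := G.edge_injective ht hs h
    exact .inl ⟨rfl, h'⟩

end GraphOn

/-! ### The graph of a one-dimensional CW complex -/

section OfCW

open RelCWComplex Metric

variable {X : Type*} [TopologicalSpace X] (C : Set X) [CWComplex C]

/-- The edge `e` of a CW complex, with its parametrization transported to `[0, 1]`. -/
def cwEdge (e : cell C 1) (t : ℝ) : X := map 1 e (fun _ ↦ 2 * t - 1)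

lemma cwArg_mem_ball {t : ℝ} : (fun _ : Fin 1 ↦ 2 * t - 1) ∈ ball (0 : Fin 1 → ℝ) 1 ↔
    t ∈ Ioo (0 : ℝ) 1 := by
  rw [mem_ball_zero_iff, pi_norm_lt_iff one_pos]
  simp only [Real.norm_eq_abs, abs_lt, mem_Ioo, Fin.forall_fin_one]
  constructor <;> rintro ⟨h1, h2⟩ <;> constructor <;> linarith

lemma cwArg_mem_closedBall {t : ℝ} :
    (fun _ : Fin 1 ↦ 2 * t - 1) ∈ closedBall (0 : Fin 1 → ℝ) 1 ↔ t ∈ Icc (0 : ℝ) 1 := by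
  rw [mem_closedBall_zero_iff, pi_norm_le_iff_of_nonneg zero_le_one]
  simp only [Real.norm_eq_abs, abs_le, mem_Icc, Fin.forall_fin_one]
  constructor <;> rintro ⟨h1, h2⟩ <;> constructor <;> linarith

lemma exists_cwArg_eq (y : Fin 1 → ℝ) : ∃ t, y = fun _ ↦ 2 * t - 1 :=
  ⟨(y 0 + 1) / 2, by ext i; rw [Subsingleton.elim i 0]; ring⟩

lemma exists_cwEdge_eq_vertexPoint (e : cell C 1) {t : ℝ} (ht : t = 0 ∨ t = 1) :
    ∃ v, cwEdge C e t = vertexPoint C v := by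
  obtain ⟨x, y, hxy⟩ := CWComplex.exists_cellFrontier_one_eq e
  have hmem : cwEdge C e t ∈ cellFrontier 1 e := by
    refine mem_image_of_mem _ ?_
    rw [mem_sphere_zero_iff_norm, pi_norm_const]
    rcases ht with rfl | rfl <;> norm_num
  rw [hxy, closedCell_zero_eq_singleton, closedCell_zero_eq_singleton] at hmem
  rcases hmem with h | h
  · exact ⟨x, h⟩
  · exact ⟨y, h⟩

/-- The graph underlying a one-dimensional CW complex. -/
noncomputable def graphOfCW (hdim : IsOneDimensional C) : GraphOn C (cell C 0) (cell C 1) where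
  vert := vertexPoint C
  edge := cwEdge C
  src e := (exists_cwEdge_eq_vertexPoint C e (.inl rfl)).choose
  tgt e := (exists_cwEdge_eq_vertexPoint C e (.inr rfl)).choose
  vert_injective := injective_map_zero C
  continuousOn_edge e := (continuousOn 1 e).comp (by fun_prop) fun _ ht ↦ cwArg_mem_closedBall.2 ht
  edge_zero e := (exists_cwEdge_eq_vertexPoint C e (.inl rfl)).choose_spec
  edge_one e := (exists_cwEdge_eq_vertexPoint C e (.inr rfl)).choose_spec
  edge_injective {e e' t t'} ht ht' h := by
    obtain rfl : e = e' := by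
      have := eq_of_not_disjoint_openCell (C := C) (n := 1) (m := 1) (j := e) (i := e') (by
        rw [not_disjoint_iff]
        refine ⟨cwEdge C e t, mem_image_of_mem _ (cwArg_mem_ball.2 ht), ?_⟩
        rw [h]
        exact mem_image_of_mem _ (cwArg_mem_ball.2 ht'))
      simpa using this
    refine ⟨rfl, ?_⟩
    have := (map 1 e).injOn (by rw [source_eq]; exact cwArg_mem_ball.2 ht)
      (by rw [source_eq]; exact cwArg_mem_ball.2 ht') h
    have := congrFun this 0
    linarith
  edge_ne_vert {e t v} ht h := by
    have := eq_of_not_disjoint_openCell (C := C) (n := 1) (m := 0) (j := e) (i := v) (by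
        rw [not_disjoint_iff, openCell_zero_eq_singleton]
        exact ⟨_, mem_image_of_mem _ (cwArg_mem_ball.2 ht), h⟩)
    simp at this
  exists_eq {x} hx := by
    rw [← CWComplex.iUnion_openCell_eq_complex (C := C)] at hx
    obtain ⟨n, e, hx⟩ := by simpa only [mem_iUnion] using hx
    match n, e, hx with
    | 0, v, hx =>
      rw [openCell_zero_eq_singleton] at hx
      exact .inl ⟨v, hx⟩
    | 1, e, hx =>
      obtain ⟨y, hy, rfl⟩ := hx
      obtain ⟨t, rfl⟩ := exists_cwArg_eq y
      exact .inr ⟨e, t, cwArg_mem_ball.1 hy, rfl⟩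
    | n + 2, e, hx => exact ((hdim (n + 2) (by omega)).false e).elim
  edge_mem {e t} ht := closedCell_subset_complex 1 e
    (mem_image_of_mem _ (cwArg_mem_closedBall.2 ht))

/-- The edge-ends at a vertex correspond to the oriented edges that end there. -/
lemma mem_edgeEnds_iff (hdim : IsOneDimensional C) (v : cell C 0) (a : cell C 1 × Bool) :
    a ∈ edgeEnds C v ↔ (graphOfCW C hdim).otgt a = v := by
  rw [← (graphOfCW C hdim).vert_injective.eq_iff, ← GraphOn.oedge_one]
  rcases a with ⟨e, _ | _⟩ <;>
    simp [edgeEnds, GraphOn.oedge, graphOfCW, cwEdge]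
  norm_num

end OfCW

namespace GraphOn

variable {X V E : Type*} [TopologicalSpace X] [T2Space X] [Finite V] [Finite E]
  (G : GraphOn (univ : Set X) V E)

/-- A finite graph has the quotient topology from its edges: a set is open if its preimage in
every edge is. -/
lemma isOpen_of_forall {U : Set X} (hU : ∀ e, ∀ t ∈ Icc (0 : ℝ) 1, G.edge e t ∈ U →
    ∀ᶠ t' in 𝓝[Icc 0 1] t, G.edge e t' ∈ U) : IsOpen U := by
  have hcl : IsClosed ((G.vert '' (G.vert ⁻¹' Uᶜ)) ∪
      ⋃ e, G.edge e '' (Icc 0 1 ∩ G.edge e ⁻¹' Uᶜ)) := by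
    refine (Set.toFinite _).isClosed.union (isClosed_iUnion_of_finite fun e ↦ ?_)
    refine IsCompact.isClosed (IsCompact.image_of_continuousOn ?_
      ((G.continuousOn_edge e).mono inter_subset_left))
    have : Icc 0 1 ∩ G.edge e ⁻¹' Uᶜ = Icc 0 1 \ (Icc 0 1 ∩ G.edge e ⁻¹' U) := by
      ext; simp
    rw [this]
    have hop : ∀ t ∈ Icc (0 : ℝ) 1 ∩ G.edge e ⁻¹' U, Icc (0 : ℝ) 1 ∩ G.edge e ⁻¹' U ∈
        𝓝[Icc 0 1] t := fun t ht ↦ Filter.inter_mem self_mem_nhdsWithin (hU e t ht.1 ht.2)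
    choose! u hu using fun t ht ↦ mem_nhdsWithin.1 (hop t ht)
    have : Icc (0 : ℝ) 1 \ (Icc 0 1 ∩ G.edge e ⁻¹' U) =
        Icc 0 1 \ ⋃ t ∈ Icc (0 : ℝ) 1 ∩ G.edge e ⁻¹' U, u t := by
      ext t
      simp only [mem_sdiff, mem_iUnion, not_exists]
      refine and_congr_right fun ht ↦ ⟨fun h t' ht' hmem ↦ h ((hu t' ht').2.2 ⟨hmem, ht⟩),
        fun h hmem ↦ h t hmem (hu t hmem).2.1⟩
    rw [this]
    exact isCompact_Icc.diff (isOpen_biUnion fun t ht ↦ (hu t ht).1)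
  rw [← isClosed_compl_iff]
  convert hcl using 1
  ext x
  constructor
  · intro hx
    rcases G.exists_eq (mem_univ x) with ⟨v, rfl⟩ | ⟨e, t, ht, rfl⟩
    · exact .inl ⟨v, hx, rfl⟩
    · exact .inr (mem_iUnion.2 ⟨e, t, ⟨Ioo_subset_Icc_self ht, hx⟩, rfl⟩)
  · rintro (⟨v, hv, rfl⟩ | hx)
    · exact hv
    · obtain ⟨e, t, ht, rfl⟩ := mem_iUnion.1 hx
      exact ht.2

lemma isOpen_edge_image (e : E) {r s : ℝ} (hr : 0 ≤ r) (hs : s ≤ 1) :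
    IsOpen (G.edge e '' Ioo r s) := by
  have hsub : Ioo r s ⊆ Ioo 0 1 := Ioo_subset_Ioo hr hs
  refine G.isOpen_of_forall fun e' t ht ⟨t', ht', heq⟩ ↦ ?_
  have ht0 : t ∈ Ioo (0 : ℝ) 1 := by
    rcases ht.1.eq_or_lt with rfl | h0
    · rw [G.edge_zero] at heq
      exact (G.edge_ne_vert (hsub ht') heq).elim
    · rcases ht.2.eq_or_lt with rfl | h1
      · rw [G.edge_one] at heq
        exact (G.edge_ne_vert (hsub ht') heq).elim
      · exact ⟨h0, h1⟩
  obtain ⟨rfl, rfl⟩ := G.edge_injective (hsub ht') ht0 heq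
  filter_upwards [mem_nhdsWithin_of_mem_nhds (isOpen_Ioo.mem_nhds ht')] with t'' h
  exact mem_image_of_mem _ h

/-- The open star of radius `ε` about the vertex `v`. -/
def star {C : Set X} (G : GraphOn C V E) (v : V) (ε : ℝ) : Set X :=
  {x | x = G.vert v ∨ ∃ a t, G.osrc a = v ∧ t ∈ Ioo 0 ε ∧ x = G.oedge a t}

lemma isOpen_star (v : V) {ε : ℝ} (hε : 0 < ε) (hε1 : ε ≤ 1) : IsOpen (G.star v ε) := by
  -- the edge parameter is compared with that of the oriented edge leaving `v`
  have key : ∀ a : E × Bool, ∀ t ∈ Ico (0 : ℝ) 1, G.oedge a t ∈ G.star v ε → t = 0 ∨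
      (t ∈ Ioo 0 ε ∧ G.osrc a = v) ∨ (1 - t ∈ Ioo 0 ε ∧ G.otgt a = v) := by
    intro a t ht hmem
    rcases ht.1.eq_or_lt with h0 | h0
    · exact .inl h0.symm
    · rcases hmem with h | ⟨b, s, hb, hs, h⟩
      · exact (G.oedge_ne_vert ⟨h0, ht.2⟩ h).elim
      · rcases G.oedge_eq ⟨h0, ht.2⟩ ⟨hs.1, hs.2.trans_le hε1⟩ h with ⟨rfl, rfl⟩ | ⟨rfl, rfl⟩
        · exact .inr (.inl ⟨hs, hb⟩)
        · exact .inr (.inr ⟨hs, by simpa using hb⟩)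
  have key0 : ∀ a : E × Bool, G.oedge a 0 ∈ G.star v ε → G.osrc a = v := by
    rintro a (h | ⟨b, s, hb, hs, h⟩)
    · rw [G.oedge_zero] at h
      exact G.vert_injective h
    · rw [G.oedge_zero] at h
      exact (G.oedge_ne_vert ⟨hs.1, hs.2.trans_le hε1⟩ h.symm).elim
  have hout : ∀ a : E × Bool, G.osrc a = v → ∀ t ∈ Ico 0 ε, G.oedge a t ∈ G.star v ε := by
    intro a ha t ht
    rcases ht.1.eq_or_lt with rfl | h0
    · exact .inl (by rw [G.oedge_zero, ha])
    · exact .inr ⟨a, t, ha, ⟨h0, ht.2⟩, rfl⟩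
  have hmain : ∀ a : E × Bool, ∀ t ∈ Ico (0 : ℝ) 1, G.oedge a t ∈ G.star v ε →
      ∀ᶠ t' in 𝓝[Icc 0 1] t, G.oedge a t' ∈ G.star v ε := by
    intro a t ht hmem
    rcases key a t ht hmem with rfl | ⟨h, ha⟩ | ⟨h, ha⟩
    · filter_upwards [self_mem_nhdsWithin, mem_nhdsWithin_of_mem_nhds (Iio_mem_nhds hε)]
        with t' h1 h2
      exact hout a (key0 a hmem) t' ⟨h1.1, h2⟩
    · filter_upwards [mem_nhdsWithin_of_mem_nhds (isOpen_Ioo.mem_nhds h)] with t' h1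
      exact hout a ha t' ⟨h1.1.le, h1.2⟩
    · have : (fun t : ℝ ↦ 1 - t) ⁻¹' Ioo 0 ε ∈ 𝓝 t :=
        (isOpen_Ioo.preimage (by fun_prop)).mem_nhds h
      filter_upwards [mem_nhdsWithin_of_mem_nhds this] with t' h1
      have := hout (rev a) (by simpa using ha) (1 - t') ⟨h1.1.le, h1.2⟩
      rcases a with ⟨e, _ | _⟩ <;> simpa [oedge, rev] using this
  refine G.isOpen_of_forall fun e t ht hmem ↦ ?_
  rcases ht.2.lt_or_eq with h1 | rfl
  · exact hmain (e, true) t ⟨ht.1, h1⟩ hmem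
  · have h := hmain (e, false) 0 ⟨le_rfl, one_pos⟩ (by simpa [oedge] using hmem)
    have htend : Filter.Tendsto (fun t : ℝ ↦ 1 - t) (𝓝[Icc 0 1] 1) (𝓝[Icc 0 1] 0) := by
      have : ContinuousWithinAt (fun t : ℝ ↦ 1 - t) (Icc 0 1) 1 := by fun_prop
      have := this.tendsto_nhdsWithin (t := Icc 0 1) fun t ht ↦ one_sub_mem_Icc ht
      simpa using this
    filter_upwards [htend.eventually h] with t' ht'
    simpa [oedge] using ht'

end GraphOn

/-! ### The covering of a graph by a forest -/

namespace GraphOn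

variable {X V E : Type*} [TopologicalSpace X] [T2Space X] [Finite V] [Finite E]
  (G : GraphOn (univ : Set X) V E)

local instance : TopologicalSpace (FreeGroup E) := ⊥
local instance : DiscreteTopology (FreeGroup E) := ⟨rfl⟩

open Classical in
/-- The change of label on passing the midpoint of the edge `e` is left multiplication by the
generator `e`. -/
noncomputable def coordChange (i j : Option E) (x : X) (g : FreeGroup E) : FreeGroup E :=
  match i, j with
  | none, some e => if x ∈ G.edge e '' Ioo (1 / 2) 1 then (FreeGroup.of e)⁻¹ * g else g
  | some e, none => if x ∈ G.edge e '' Ioo (1 / 2) 1 then FreeGroup.of e * g else g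
  | _, _ => g

/-- The open sets over which the covering is trivialized: the open edges, and the complement of the
midpoints of all edges. -/
def chart : Option E → Set X
  | none => {x | ∀ e, x ≠ G.edge e (1 / 2)}
  | some e => G.edge e '' Ioo 0 1

lemma isOpen_chart (i : Option E) : IsOpen (G.chart i) := by
  match i with
  | none =>
    have : G.chart none = (range fun e ↦ G.edge e (1 / 2))ᶜ := by
      ext x; simp [chart, eq_comm]
    rw [this]
    exact (Set.finite_range _).isClosed.isOpen_compl
  | some e => exact G.isOpen_edge_image e le_rfl le_rfl

lemma eq_of_mem_chart {e e' : E} {x : X} (h : x ∈ G.chart (some e)) (h' : x ∈ G.chart (some e')) :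
    e = e' := by
  obtain ⟨t, ht, rfl⟩ := h
  obtain ⟨t', ht', heq⟩ := h'
  exact (G.edge_injective ht ht' heq.symm).1

lemma eventually_mem_half (e : E) {x : X} (h : x ∈ G.chart (some e)) (h0 : x ∈ G.chart none) :
    ∀ᶠ y in 𝓝 x, (y ∈ G.edge e '' Ioo (1 / 2) 1 ↔ x ∈ G.edge e '' Ioo (1 / 2) 1) := by
  obtain ⟨t, ht, rfl⟩ := h
  rcases lt_trichotomy t (1 / 2) with hlt | rfl | hlt
  · have hnot : ∀ s ∈ Ioo (0 : ℝ) (1 / 2), G.edge e s ∉ G.edge e '' Ioo (1 / 2) 1 := by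
      rintro s hs ⟨s', hs', heq⟩
      have := (G.edge_injective ⟨hs.1, hs.2.trans (by norm_num)⟩
        ⟨lt_trans (by norm_num) hs'.1, hs'.2⟩ heq.symm).2
      linarith [hs.2, hs'.1]
    have hmem : G.edge e t ∈ G.edge e '' Ioo 0 (1 / 2) := mem_image_of_mem _ ⟨ht.1, hlt⟩
    filter_upwards [(G.isOpen_edge_image e le_rfl (by norm_num : (1 / 2 : ℝ) ≤ 1)).mem_nhds hmem]
    rintro y ⟨s, hs, rfl⟩
    exact iff_of_false (hnot s hs) (hnot t ⟨ht.1, hlt⟩)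
  · exact (h0 e rfl).elim
  · have hmem : G.edge e t ∈ G.edge e '' Ioo (1 / 2) 1 := mem_image_of_mem _ ⟨hlt, ht.2⟩
    filter_upwards [(G.isOpen_edge_image e (by norm_num : (0 : ℝ) ≤ 1 / 2) le_rfl).mem_nhds hmem]
      with y hy
    exact iff_of_true hy hmem

open Classical in
/-- The chart used at a point: its open edge, or the complement of the midpoints at a vertex. -/
noncomputable def indexAt (x : X) : Option E :=
  if h : ∃ e, x ∈ G.edge e '' Ioo 0 1 then some h.choose else none

lemma indexAt_vert (v : V) : G.indexAt (G.vert v) = none := by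
  rw [indexAt, dif_neg]
  rintro ⟨e, t, ht, h⟩
  exact G.edge_ne_vert ht h

lemma indexAt_edge (e : E) {t : ℝ} (ht : t ∈ Ioo (0 : ℝ) 1) :
    G.indexAt (G.edge e t) = some e := by
  have h : ∃ e', G.edge e t ∈ G.edge e' '' Ioo 0 1 := ⟨e, t, ht, rfl⟩
  rw [indexAt, dif_pos h, Option.some_inj]
  exact G.eq_of_mem_chart h.choose_spec ⟨t, ht, rfl⟩

/-- The covering of a graph with fibre the free group on the edges, in which crossing the midpoint
of an edge `e` multiplies the label on the left by `e`. Edge paths with the same label are related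
by cancelling backtracks, so the components are trees. -/
noncomputable def bundle : FiberBundleCore (Option E) X (FreeGroup E) where
  baseSet := G.chart
  isOpen_baseSet := G.isOpen_chart
  indexAt := G.indexAt
  mem_baseSet_at x := by
    rcases G.exists_eq (mem_univ x) with ⟨v, rfl⟩ | ⟨e, t, ht, rfl⟩
    · rw [indexAt_vert]
      exact fun e h ↦ G.edge_ne_vert ⟨by norm_num, by norm_num⟩ h.symm
    · rw [G.indexAt_edge e ht]
      exact mem_image_of_mem _ ht
  coordChange := G.coordChange
  coordChange_self i x _ g := by cases i <;> rfl
  continuousOn_coordChange i j := by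
    rintro ⟨x, g⟩ ⟨⟨hi, hj⟩, -⟩
    refine ContinuousAt.continuousWithinAt ?_
    refine (continuousAt_const (y := G.coordChange i j x g)).congr ?_
    have h2 : ∀ᶠ p : X × FreeGroup E in 𝓝 (x, g), p.2 = g :=
      (continuous_snd.tendsto (x, g)).eventually (by simp : ∀ᶠ g' in 𝓝 g, g' = g)
    match i, j, hi, hj with
    | none, none, _, _ | some _, some _, _, _ =>
      filter_upwards [h2] with p hp
      simp [coordChange, hp]
    | none, some e, hi, hj | some e, none, hj, hi =>
      filter_upwards [h2, (continuous_fst.tendsto (x, g)).eventually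
        (G.eventually_mem_half e hj hi)] with p hp hp'
      by_cases hx : x ∈ G.edge e '' Ioo (1 / 2) 1
      · simp only [coordChange, hp, if_pos hx, if_pos (hp'.2 hx)]
      · simp only [coordChange, hp, if_neg hx, if_neg (mt hp'.1 hx)]
  coordChange_comp i j k x hx g := by
    obtain ⟨⟨hi, hj⟩, hk⟩ := hx
    match i, j, k with
    | none, none, none | none, none, some e | some e, none, none | some e, some e', some e''
    | some e, some e', none | none, some e, some e' =>
      simp_all only [coordChange]
      try rw [G.eq_of_mem_chart hi hj]
      try rw [G.eq_of_mem_chart hj hk]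
    | none, some e, none =>
      simp only [coordChange]
      split_ifs <;> simp
    | some e, none, some e' =>
      obtain rfl := G.eq_of_mem_chart hi hk
      simp only [coordChange]
      split_ifs <;> simp

/-- The total space of the covering of a graph by a forest. -/
abbrev Forest : Type _ := Bundle.TotalSpace (FreeGroup E) G.bundle.Fiber

/-- The covering projection. -/
abbrev forestProj : G.Forest → X := Bundle.TotalSpace.proj

lemma isCoveringMap_forestProj : IsCoveringMap G.forestProj :=
  FiberBundle.isCoveringMap (F := FreeGroup E) (E := G.bundle.Fiber)

lemma surjective_forestProj : Function.Surjective G.forestProj :=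
  fun x ↦ ⟨⟨x, (1 : FreeGroup E)⟩, rfl⟩

/-- The point of the covering over `x` with label `g` in the chart used at `x`. -/
def pt (x : X) (g : FreeGroup E) : G.Forest := ⟨x, g⟩

lemma exists_eq_pt (q : G.Forest) : ∃ g, q = G.pt q.1 g := ⟨q.2, rfl⟩

/-- The label of a point of the covering with respect to a chart. -/
noncomputable def label (i : Option E) (q : G.Forest) : FreeGroup E :=
  G.coordChange (G.indexAt q.1) i q.1 q.2

lemma label_pt (i : Option E) (x : X) (g : FreeGroup E) :
    G.label i (G.pt x g) = G.coordChange (G.indexAt x) i x g := rfl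

lemma eventually_label {q : G.Forest} {i : Option E} (h : q.1 ∈ G.chart i) :
    ∀ᶠ q' in 𝓝 q, G.label i q' = G.label i q := by
  have hmem : q ∈ (G.bundle.localTriv i).source := (G.bundle.mem_localTriv_source i q).2 h
  have := (continuous_snd.continuousAt (x := G.bundle.localTriv i q)).comp
    ((G.bundle.localTriv i).continuousAt hmem)
  exact this.eventually (by simp : ∀ᶠ g' in 𝓝 (G.label i q), g' = G.label i q)

/-- The vertex of the covering over `v` with label `g`. -/
def vertPt (v : V) (g : FreeGroup E) : G.Forest := G.pt (G.vert v) g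

open Classical in
/-- The edge of the covering over `e` that starts with label `g`. -/
noncomputable def edgePt (e : E) (g : FreeGroup E) (t : ℝ) : G.Forest :=
  if t ≤ 0 then G.vertPt (G.src e) g else if 1 ≤ t then G.vertPt (G.tgt e) (FreeGroup.of e * g)
  else G.pt (G.edge e t) g

lemma edgePt_of_le (e : E) (g : FreeGroup E) {t : ℝ} (ht : t ≤ 0) :
    G.edgePt e g t = G.vertPt (G.src e) g := if_pos ht

lemma edgePt_of_ge (e : E) (g : FreeGroup E) {t : ℝ} (ht : 1 ≤ t) :
    G.edgePt e g t = G.vertPt (G.tgt e) (FreeGroup.of e * g) := by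
  rw [edgePt, if_neg (by linarith), if_pos ht]

lemma edgePt_of_mem (e : E) (g : FreeGroup E) {t : ℝ} (ht : t ∈ Ioo (0 : ℝ) 1) :
    G.edgePt e g t = G.pt (G.edge e t) g := by
  rw [edgePt, if_neg ht.1.not_ge, if_neg ht.2.not_ge]

lemma forestProj_edgePt (e : E) (g : FreeGroup E) (t : ℝ) :
    G.forestProj (G.edgePt e g t) = G.edge e (projIcc (0 : ℝ) 1 zero_le_one t) := by
  rcases le_or_gt t 0 with h | h
  · rw [G.edgePt_of_le e g h, projIcc_of_le_left _ h, G.edge_zero]; rfl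
  rcases le_or_gt 1 t with h' | h'
  · rw [G.edgePt_of_ge e g h', projIcc_of_right_le _ h', G.edge_one]; rfl
  · rw [G.edgePt_of_mem e g ⟨h, h'⟩, projIcc_of_mem _ ⟨h.le, h'.le⟩]; rfl

lemma continuous_edgePt (e : E) (g : FreeGroup E) : Continuous (G.edgePt e g) := by
  rw [continuous_iff_continuousAt]
  intro t
  rw [FiberBundle.continuousAt_totalSpace]
  constructor
  · have : (fun t ↦ (G.edgePt e g t).proj) =
        (fun t : Icc (0 : ℝ) 1 ↦ G.edge e t) ∘ projIcc (0 : ℝ) 1 zero_le_one := by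
      ext t; exact G.forestProj_edgePt e g t
    rw [this]
    exact ((continuousOn_iff_continuous_domRestrict.1 (G.continuousOn_edge e)).comp
      continuous_projIcc).continuousAt
  · change ContinuousAt (fun t' ↦ G.label (G.indexAt (G.edgePt e g t).1) (G.edgePt e g t')) t
    -- near the ends the chart of the vertices is used, in which the label on the second half of the
    -- edge has an additional letter `e`
    rcases le_or_gt t 0 with h | h
    · refine (continuousAt_const (y := g)).congr ?_
      filter_upwards [Iio_mem_nhds (h.trans_lt (by norm_num : (0 : ℝ) < 1 / 2))] with t' ht'
      rw [G.edgePt_of_le e g h]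
      change _ = G.label (G.indexAt (G.vert _)) _
      rw [indexAt_vert]
      rcases le_or_gt t' 0 with h' | h'
      · rw [G.edgePt_of_le e g h']
        simp [vertPt, label_pt, indexAt_vert, coordChange]
      · have hmem : t' ∈ Ioo (0 : ℝ) 1 := ⟨h', lt_trans ht' (by norm_num)⟩
        rw [G.edgePt_of_mem e g hmem]
        simp only [label_pt, G.indexAt_edge e hmem, coordChange]
        rw [if_neg]
        rintro ⟨s, hs, heq⟩
        have := (G.edge_injective ⟨lt_trans (by norm_num) hs.1, hs.2⟩ hmem heq).2
        have h1 := hs.1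
        rw [mem_Iio] at ht'
        linarith
    rcases le_or_gt 1 t with h' | h'
    · refine (continuousAt_const (y := FreeGroup.of e * g)).congr ?_
      filter_upwards [Ioi_mem_nhds (lt_of_lt_of_le (by norm_num : (1 / 2 : ℝ) < 1) h')] with t' ht'
      rw [G.edgePt_of_ge e g h']
      change _ = G.label (G.indexAt (G.vert _)) _
      rw [indexAt_vert]
      rcases le_or_gt 1 t' with h' | h'
      · rw [G.edgePt_of_ge e g h']
        simp [vertPt, label_pt, indexAt_vert, coordChange]
      · have hmem : t' ∈ Ioo (0 : ℝ) 1 := ⟨lt_trans (by norm_num) ht', h'⟩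
        rw [G.edgePt_of_mem e g hmem]
        simp only [label_pt, G.indexAt_edge e hmem, coordChange]
        rw [if_pos]
        exact mem_image_of_mem _ ⟨ht', h'⟩
    · refine (continuousAt_const (y := g)).congr ?_
      filter_upwards [isOpen_Ioo.mem_nhds (⟨h, h'⟩ : t ∈ Ioo (0 : ℝ) 1)] with t' ht'
      rw [G.edgePt_of_mem e g ⟨h, h'⟩, G.edgePt_of_mem e g ht']
      change _ = G.label (G.indexAt (G.edge e t)) _
      simp only [label_pt, G.indexAt_edge e ⟨h, h'⟩, G.indexAt_edge e ht', coordChange]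

/-- The edge of the covering over the oriented edge `a` that starts with label `g`. -/
noncomputable def oPt (a : E × Bool) (g : FreeGroup E) (t : ℝ) : G.Forest :=
  if a.2 then G.edgePt a.1 g t else G.edgePt a.1 ((FreeGroup.of a.1)⁻¹ * g) (1 - t)

lemma continuous_oPt (a : E × Bool) (g : FreeGroup E) : Continuous (G.oPt a g) := by
  rcases a with ⟨e, _ | _⟩
  · exact (G.continuous_edgePt e _).comp (by fun_prop)
  · exact G.continuous_edgePt e g

lemma mk_false (e : E) : FreeGroup.mk [(e, false)] = (FreeGroup.of e)⁻¹ := by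
  rfl

lemma oPt_of_le (a : E × Bool) (g : FreeGroup E) {t : ℝ} (ht : t ≤ 0) :
    G.oPt a g t = G.vertPt (G.osrc a) g := by
  rcases a with ⟨e, _ | _⟩
  · simp [oPt, osrc, G.edgePt_of_ge e _ (by linarith : 1 ≤ 1 - t)]
  · exact G.edgePt_of_le e g ht

lemma oPt_of_ge (a : E × Bool) (g : FreeGroup E) {t : ℝ} (ht : 1 ≤ t) :
    G.oPt a g t = G.vertPt (G.otgt a) (FreeGroup.mk [a] * g) := by
  rcases a with ⟨e, _ | _⟩
  · rw [mk_false]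
    exact G.edgePt_of_le e _ (by linarith : 1 - t ≤ 0)
  · exact G.edgePt_of_ge e g ht

lemma oPt_rev (a : E × Bool) (g : FreeGroup E) (t : ℝ) :
    G.oPt (rev a) (FreeGroup.mk [a] * g) (1 - t) = G.oPt a g t := by
  rcases a with ⟨e, _ | _⟩
  · simp [oPt, rev, mk_false]
  · change G.edgePt e ((FreeGroup.of e)⁻¹ * (FreeGroup.of e * g)) (1 - (1 - t)) = G.edgePt e g t
    simp

lemma forest_cases (q : G.Forest) : (∃ v g, q = G.vertPt v g) ∨
    ∃ e g, ∃ t ∈ Ioo (0 : ℝ) 1, q = G.edgePt e g t := by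
  obtain ⟨x, g⟩ := q
  rcases G.exists_eq (mem_univ x) with ⟨v, rfl⟩ | ⟨e, t, ht, rfl⟩
  · exact .inl ⟨v, g, rfl⟩
  · exact .inr ⟨e, g, t, ht, (G.edgePt_of_mem e g ht).symm⟩

/-- The points near a vertex of the covering lie on the edges that leave it. -/
lemma eventually_vertPt (v : V) (g : FreeGroup E) {ε : ℝ} (hε : 0 < ε) :
    ∀ᶠ q in 𝓝 (G.vertPt v g), q = G.vertPt v g ∨
      ∃ a t, G.osrc a = v ∧ t ∈ Ioo 0 ε ∧ t < 1 ∧ q = G.oPt a g t := by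
  have hl : G.label none (G.vertPt v g) = g := by
    simp [vertPt, label_pt, indexAt_vert, coordChange]
  have hv : (G.vertPt v g).1 ∈ G.chart none := fun e h ↦
    G.edge_ne_vert ⟨by norm_num, by norm_num⟩ h.symm
  have hδ : 0 < min ε (1 / 2) := lt_min hε (by norm_num)
  have hs : G.star v (min ε (1 / 2)) ∈ 𝓝 (G.forestProj (G.vertPt v g)) :=
    (G.isOpen_star v hδ ((min_le_right _ _).trans (by norm_num))).mem_nhds (.inl rfl)
  filter_upwards [G.eventually_label hv,
    G.isCoveringMap_forestProj.continuous.continuousAt.preimage_mem_nhds hs] with q h1 h2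
  rw [hl] at h1
  obtain ⟨g', hq⟩ := G.exists_eq_pt q
  generalize q.1 = x at hq
  subst hq
  rcases h2 with h2 | ⟨a, t, ha, ht, h2⟩ <;> (change x = _ at h2; subst h2)
  · left
    have : g' = g := by simpa [label_pt, indexAt_vert, coordChange] using h1
    rw [this]; rfl
  · obtain ⟨e, b⟩ := a
    have hε' := ht.2.trans_le (min_le_left _ _)
    have h12 := ht.2.trans_le (min_le_right _ _)
    have ht1 : t ∈ Ioo (0 : ℝ) 1 := ⟨ht.1, h12.trans (by norm_num)⟩
    refine .inr ⟨(e, b), t, ha, ⟨ht.1, hε'⟩, ht1.2, ?_⟩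
    cases b
    · have ht1' := one_sub_mem_Ioo ht1
      have hx : G.oedge (e, false) t = G.edge e (1 - t) := rfl
      simp only [label_pt, hx, G.indexAt_edge e ht1', coordChange] at h1
      rw [if_pos ⟨1 - t, ⟨by linarith, ht1'.2⟩, rfl⟩] at h1
      simp only [oPt, Bool.false_eq_true, if_false]
      rw [G.edgePt_of_mem e _ ht1', ← h1]
      simp only [inv_mul_cancel_left, hx]
    · have hx : G.oedge (e, true) t = G.edge e t := rfl
      simp only [label_pt, hx, G.indexAt_edge e ht1, coordChange] at h1
      rw [if_neg] at h1
      · simp only [oPt, if_true]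
        rw [G.edgePt_of_mem e _ ht1, ← h1, hx]
      · rintro ⟨s, hs, heq⟩
        have := (G.edge_injective ⟨lt_trans (by norm_num) hs.1, hs.2⟩ ht1 heq).2
        linarith [hs.1]

/-- The points near an interior point of an edge of the covering lie on that edge. -/
lemma eventually_edgePt (e : E) (g : FreeGroup E) {t : ℝ} (ht : t ∈ Ioo (0 : ℝ) 1) {ε : ℝ}
    (hε : 0 < ε) : ∀ᶠ q in 𝓝 (G.edgePt e g t),
      ∃ t' ∈ Ioo (0 : ℝ) 1, |t' - t| < ε ∧ q = G.edgePt e g t' := by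
  have hl : G.label (some e) (G.edgePt e g t) = g := by
    simp [label_pt, G.edgePt_of_mem e g ht, G.indexAt_edge e ht, coordChange]
  have hproj : (G.edgePt e g t).1 = G.edge e t := by
    rw [G.edgePt_of_mem e g ht]; rfl
  have hv : (G.edgePt e g t).1 ∈ G.chart (some e) := by
    rw [hproj]; exact mem_image_of_mem _ ht
  have hs : G.edge e '' Ioo (max 0 (t - ε)) (min 1 (t + ε)) ∈ 𝓝 (G.forestProj (G.edgePt e g t)) :=
    (G.isOpen_edge_image e (le_max_left _ _) (min_le_left _ _)).mem_nhds (by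
      change (G.edgePt e g t).1 ∈ _
      rw [hproj]
      exact mem_image_of_mem _ ⟨max_lt ht.1 (by linarith), lt_min ht.2 (by linarith)⟩)
  filter_upwards [G.eventually_label hv,
    G.isCoveringMap_forestProj.continuous.continuousAt.preimage_mem_nhds hs] with q h1 h2
  rw [hl] at h1
  obtain ⟨g', hq⟩ := G.exists_eq_pt q
  obtain ⟨t', ht', h2⟩ := h2
  change _ = q.1 at h2
  rw [← h2] at hq
  subst hq
  have h01 : t' ∈ Ioo (0 : ℝ) 1 :=
    ⟨(le_max_left _ _).trans_lt ht'.1, ht'.2.trans_le (min_le_left _ _)⟩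
  refine ⟨t', h01, ?_, ?_⟩
  · have := (le_max_right _ _).trans_lt ht'.1
    have := ht'.2.trans_le (min_le_right _ _)
    rw [abs_lt]
    constructor <;> linarith
  · simp only [label_pt, G.indexAt_edge e h01, coordChange] at h1
    rw [G.edgePt_of_mem e _ h01, ← h1]

lemma eventually_oPt (a : E × Bool) (g : FreeGroup E) {t : ℝ} (ht : t ∈ Ioo (0 : ℝ) 1) {ε : ℝ}
    (hε : 0 < ε) : ∀ᶠ q in 𝓝 (G.oPt a g t),
      ∃ t' ∈ Ioo (0 : ℝ) 1, |t' - t| < ε ∧ q = G.oPt a g t' := by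
  rcases a with ⟨e, _ | _⟩
  · filter_upwards [G.eventually_edgePt e ((FreeGroup.of e)⁻¹ * g) (one_sub_mem_Ioo ht) hε]
    rintro q ⟨t', ht', h1, h2⟩
    refine ⟨1 - t', one_sub_mem_Ioo ht', ?_, by simp [oPt, h2]⟩
    rw [abs_sub_comm] at h1
    convert h1 using 2
    ring
  · exact G.eventually_edgePt e g ht hε

/-- The deck transformation given by right multiplication of the labels. -/
def deck (k : FreeGroup E) (q : G.Forest) : G.Forest :=
  G.pt q.1 (HMul.hMul (α := FreeGroup E) q.2 k)

lemma deck_pt (k : FreeGroup E) (x : X) (g : FreeGroup E) :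
    G.deck k (G.pt x g) = G.pt x (g * k) := rfl

lemma deck_vertPt (k : FreeGroup E) (v : V) (g : FreeGroup E) :
    G.deck k (G.vertPt v g) = G.vertPt v (g * k) := rfl

lemma deck_edgePt (k : FreeGroup E) (e : E) (g : FreeGroup E) (t : ℝ) :
    G.deck k (G.edgePt e g t) = G.edgePt e (g * k) t := by
  unfold edgePt
  split_ifs
  · rfl
  · rw [deck_vertPt, mul_assoc]
  · rfl

lemma deck_oPt (k : FreeGroup E) (a : E × Bool) (g : FreeGroup E) (t : ℝ) :
    G.deck k (G.oPt a g t) = G.oPt a (g * k) t := by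
  rcases a with ⟨e, _ | _⟩
  · exact (G.deck_edgePt _ _ _ _).trans (by rw [mul_assoc]; rfl)
  · exact G.deck_edgePt _ _ _ _

lemma forestProj_deck (k : FreeGroup E) (q : G.Forest) :
    G.forestProj (G.deck k q) = G.forestProj q := rfl

lemma exists_deck_eq {q q' : G.Forest} (h : G.forestProj q = G.forestProj q') :
    ∃ k, G.deck k q = q' := by
  obtain ⟨g, hq⟩ := G.exists_eq_pt q
  obtain ⟨g', hq'⟩ := G.exists_eq_pt q'
  refine ⟨g⁻¹ * g', ?_⟩
  rw [hq', ← show q.1 = q'.1 from h, hq, deck_pt, mul_inv_cancel_left]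
  rfl

lemma continuous_deck (k : FreeGroup E) : Continuous (G.deck k) := by
  rw [continuous_iff_continuousAt]
  intro q
  rw [FiberBundle.continuousAt_totalSpace]
  refine ⟨G.isCoveringMap_forestProj.continuous.continuousAt, ?_⟩
  change ContinuousAt (fun q' ↦ G.label (G.indexAt q.1) (G.deck k q')) q
  have hcomm : ∀ i q', G.label i (G.deck k q') = G.label i q' * k := by
    intro i q'
    obtain ⟨g, hq⟩ := G.exists_eq_pt q'
    generalize q'.1 = x at hq
    subst hq
    simp only [deck_pt, label_pt, coordChange]
    split
    · split_ifs <;> simp [mul_assoc]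
    · split_ifs <;> simp [mul_assoc]
    · rfl
  refine (continuousAt_const (y := G.label (G.indexAt q.1) q * k)).congr ?_
  filter_upwards [G.eventually_label (q := q) (G.bundle.mem_baseSet_at q.1)] with q' h
  rw [hcomm, show G.label (G.indexAt q.1) q' = _ from h]
  rfl

end GraphOn

/-! ### The height on the covering forest -/

namespace GraphOn

variable {X V E : Type*} [TopologicalSpace X] [T2Space X] [Finite V] [Finite E] [DecidableEq V]
  [DecidableEq E] (G : GraphOn (univ : Set X) V E)

/-- The level of a vertex over `v` whose label is the word `l`, the letter at the head being the
last edge traversed: the length of the longest initial part of `l` that is an edge path ending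
at `v`. -/
def lev : V → List (E × Bool) → ℕ
  | _, [] => 0
  | v, a :: l => if G.otgt a = v then lev (G.osrc a) l + 1 else 0

/-- The descending path from the vertex over `v` with label `l`, parametrized by height. -/
noncomputable def geo : V → List (E × Bool) → ℝ → G.Forest
  | v, [], _ => G.vertPt v (FreeGroup.mk [])
  | v, a :: l, h => if G.otgt a = v then
      if (G.lev (G.osrc a) l : ℝ) ≤ h then G.oPt a (FreeGroup.mk l) (h - G.lev (G.osrc a) l)
      else geo (G.osrc a) l h
    else G.vertPt v (FreeGroup.mk (a :: l))

lemma mk_mul_mk (a : E × Bool) (l : List (E × Bool)) :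
    FreeGroup.mk [a] * FreeGroup.mk l = FreeGroup.mk (a :: l) := rfl

lemma geo_of_ge (v : V) (l : List (E × Bool)) {h : ℝ} (hh : G.lev v l ≤ h) :
    G.geo v l h = G.vertPt v (FreeGroup.mk l) := by
  cases l with
  | nil => rfl
  | cons a l =>
    by_cases ha : G.otgt a = v
    · simp only [lev, if_pos ha, Nat.cast_add, Nat.cast_one] at hh
      rw [geo, if_pos ha, if_pos (by linarith), G.oPt_of_ge _ _ (by linarith), ha, mk_mul_mk]
    · rw [geo, if_neg ha]

lemma geo_of_le (v : V) (l : List (E × Bool)) {h : ℝ} (hh : h ≤ 0) :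
    G.geo v l h = G.geo v l 0 := by
  induction l generalizing v with
  | nil => rfl
  | cons a l ih =>
    by_cases ha : G.otgt a = v
    · rw [geo, geo, if_pos ha, if_pos ha]
      rcases (Nat.cast_nonneg (G.lev (G.osrc a) l) : (0 : ℝ) ≤ _).eq_or_lt with h0 | h0
      · rw [← h0, if_pos le_rfl, sub_zero, sub_zero, G.oPt_of_le _ _ le_rfl]
        split_ifs
        · rw [G.oPt_of_le _ _ (by linarith)]
        · rw [ih (G.osrc a), G.geo_of_ge _ _ h0.ge]
      · rw [if_neg (by linarith), if_neg (by linarith), ih]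
    · rw [geo, geo, if_neg ha, if_neg ha]

lemma continuous_geo (v : V) (l : List (E × Bool)) : Continuous (G.geo v l) := by
  induction l generalizing v with
  | nil => exact continuous_const
  | cons a l ih =>
    have : G.geo v (a :: l) = fun h ↦ G.geo v (a :: l) h := rfl
    rw [this]
    by_cases ha : G.otgt a = v
    · simp only [geo, if_pos ha]
      refine Continuous.if_le ((G.continuous_oPt a _).comp (by fun_prop)) (ih _) continuous_const
        continuous_id fun h hh ↦ ?_
      rw [← hh, sub_self, G.oPt_of_le _ _ le_rfl, G.geo_of_ge _ _ le_rfl]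
    · simp only [geo, if_neg ha]
      exact continuous_const

/-- Traversing one more edge either cancels the last letter of a reduced word or adds one. -/
lemma toWord_mk_mul (a : E × Bool) (g : FreeGroup E) :
    (∃ l, g.toWord = rev a :: l ∧ (FreeGroup.mk [a] * g).toWord = l) ∨
      (FreeGroup.mk [a] * g).toWord = a :: g.toWord := by
  have h : (FreeGroup.mk [a] * g).toWord = FreeGroup.reduce (a :: g.toWord) := by
    conv_lhs => rw [← FreeGroup.mk_toWord (x := g), mk_mul_mk, FreeGroup.toWord_mk]
  rw [h, FreeGroup.reduce.cons, FreeGroup.reduce_toWord]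
  cases hw : g.toWord with
  | nil => exact .inr rfl
  | cons b l =>
    by_cases hab : a.1 = b.1 ∧ a.2 = !b.2
    · refine .inl ⟨l, ?_, if_pos hab⟩
      have : b = rev a := by ext <;> simp [rev, hab.1, hab.2]
      rw [this]
    · exact .inr (if_neg hab)

lemma exists_coord (x : X) : ∃ c : V ⊕ E × ℝ,
    c.elim (fun v ↦ x = G.vert v) (fun p ↦ p.2 ∈ Ioo (0 : ℝ) 1 ∧ x = G.edge p.1 p.2) := by
  rcases G.exists_eq (mem_univ x) with ⟨v, h⟩ | ⟨e, t, ht, h⟩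
  · exact ⟨.inl v, h⟩
  · exact ⟨.inr (e, t), ht, h⟩

/-- The coordinates of a point of a graph: a vertex, or an edge with a parameter. -/
noncomputable def coord (x : X) : V ⊕ E × ℝ := (G.exists_coord x).choose

lemma coord_vert (v : V) : G.coord (G.vert v) = .inl v := by
  have h := (G.exists_coord (G.vert v)).choose_spec
  change (G.coord (G.vert v)).elim _ _ at h
  match hc : G.coord (G.vert v), h with
  | .inl w, h => rw [G.vert_injective h]
  | .inr p, h => exact (G.edge_ne_vert h.1 h.2.symm).elim

lemma coord_edge (e : E) {t : ℝ} (ht : t ∈ Ioo (0 : ℝ) 1) : G.coord (G.edge e t) = .inr (e, t) := by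
  have h := (G.exists_coord (G.edge e t)).choose_spec
  change (G.coord (G.edge e t)).elim _ _ at h
  match hc : G.coord (G.edge e t), h with
  | .inl w, h => exact (G.edge_ne_vert ht h).elim
  | .inr p, h =>
    obtain ⟨rfl, rfl⟩ := G.edge_injective ht h.1 h.2
    rfl

/-- The height of a point of the covering: the level at vertices, linear along edges. -/
noncomputable def heightAt (g : FreeGroup E) : V ⊕ E × ℝ → ℝ
  | .inl v => G.lev v g.toWord
  | .inr (e, t) => (1 - t) * G.lev (G.src e) g.toWord +
      t * G.lev (G.tgt e) (FreeGroup.of e * g).toWord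

/-- The lowest vertex above a point of the covering, with the reduced word of its label. -/
def topAt (g : FreeGroup E) : V ⊕ E × ℝ → V × List (E × Bool)
  | .inl v => (v, g.toWord)
  | .inr (e, _) =>
    if G.lev (G.src e) g.toWord < G.lev (G.tgt e) (FreeGroup.of e * g).toWord
    then (G.tgt e, (FreeGroup.of e * g).toWord) else (G.src e, g.toWord)

/-- The height function of the covering forest. -/
noncomputable def forestHeight (q : G.Forest) : ℝ := G.heightAt q.2 (G.coord q.1)

/-- The lowest vertex above a point of the covering forest. -/
noncomputable def forestTop (q : G.Forest) : V × List (E × Bool) := G.topAt q.2 (G.coord q.1)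

lemma forestHeight_vertPt (v : V) (g : FreeGroup E) :
    G.forestHeight (G.vertPt v g) = G.lev v g.toWord := by
  change G.heightAt g (G.coord (G.vert v)) = _
  rw [coord_vert]; rfl

lemma forestTop_vertPt (v : V) (g : FreeGroup E) :
    G.forestTop (G.vertPt v g) = (v, g.toWord) := by
  change G.topAt g (G.coord (G.vert v)) = _
  rw [coord_vert]; rfl

lemma forestHeight_edgePt (e : E) (g : FreeGroup E) {t : ℝ} (ht : t ∈ Icc (0 : ℝ) 1) :
    G.forestHeight (G.edgePt e g t) = (1 - t) * G.lev (G.src e) g.toWord +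
      t * G.lev (G.tgt e) (FreeGroup.of e * g).toWord := by
  rcases ht.1.eq_or_lt with rfl | h0
  · rw [G.edgePt_of_le e g le_rfl, forestHeight_vertPt]; simp
  rcases ht.2.eq_or_lt with rfl | h1
  · rw [G.edgePt_of_ge e g le_rfl, forestHeight_vertPt]; simp
  rw [G.edgePt_of_mem e g ⟨h0, h1⟩]
  change G.heightAt g (G.coord (G.edge e t)) = _
  rw [G.coord_edge e ⟨h0, h1⟩]; rfl

lemma forestHeight_oPt (a : E × Bool) (g : FreeGroup E) {t : ℝ} (ht : t ∈ Icc (0 : ℝ) 1) :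
    G.forestHeight (G.oPt a g t) = (1 - t) * G.lev (G.osrc a) g.toWord +
      t * G.lev (G.otgt a) (FreeGroup.mk [a] * g).toWord := by
  rcases a with ⟨e, _ | _⟩
  · have := G.forestHeight_edgePt e ((FreeGroup.of e)⁻¹ * g) (one_sub_mem_Icc ht)
    rw [mul_inv_cancel_left, sub_sub_cancel, add_comm] at this
    rw [mk_false]
    exact this
  · exact G.forestHeight_edgePt e g ht

lemma forestTop_oPt (a : E × Bool) (g : FreeGroup E) {t : ℝ} (ht : t ∈ Ioo (0 : ℝ) 1)
    (h : G.lev (G.osrc a) g.toWord < G.lev (G.otgt a) (FreeGroup.mk [a] * g).toWord) :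
    G.forestTop (G.oPt a g t) = (G.otgt a, (FreeGroup.mk [a] * g).toWord) := by
  rcases a with ⟨e, _ | _⟩
  · rw [mk_false] at h ⊢
    change G.forestTop (G.edgePt e ((FreeGroup.of e)⁻¹ * g) (1 - t)) = _
    rw [G.edgePt_of_mem e _ (one_sub_mem_Ioo ht)]
    change G.topAt ((FreeGroup.of e)⁻¹ * g) (G.coord (G.edge e (1 - t))) = _
    rw [G.coord_edge e (one_sub_mem_Ioo ht), topAt, mul_inv_cancel_left, if_neg]
    · rfl
    · exact h.not_gt
  · change G.forestTop (G.edgePt e g t) = _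
    rw [G.edgePt_of_mem e _ ht]
    change G.topAt g (G.coord (G.edge e t)) = _
    rw [G.coord_edge e ht, topAt, if_pos]
    · rfl
    · exact h

/-- The downward flow on the covering forest. -/
noncomputable def forestLower (q : G.Forest) (h : ℝ) : G.Forest :=
  if G.forestHeight q ≤ h then q else G.geo (G.forestTop q).1 (G.forestTop q).2 h

lemma toWord_mk_of_isReduced {l : List (E × Bool)} (hl : FreeGroup.IsReduced l) :
    (FreeGroup.mk l).toWord = l := by
  rw [FreeGroup.toWord_mk, hl.reduce_eq]

/-- The height and the downward flow along a descending path. -/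
lemma forestHeight_geo (v : V) (l : List (E × Bool)) (hl : FreeGroup.IsReduced l) {s : ℝ}
    (h0 : 0 ≤ s) (hs : s ≤ G.lev v l) : G.forestHeight (G.geo v l s) = s ∧
      ∀ h, G.forestLower (G.geo v l s) h = G.geo v l (min h s) := by
  induction l generalizing v s with
  | nil =>
    have hs0 : s = 0 := le_antisymm (by simpa [lev] using hs) h0
    have hh : G.forestHeight (G.geo v [] s) = 0 := by
      rw [geo, forestHeight_vertPt, toWord_mk_of_isReduced hl]; simp [lev]
    refine ⟨by rw [hh, hs0], fun h ↦ ?_⟩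
    rw [forestLower, hh]
    split_ifs
    · rfl
    · simp [geo, forestTop_vertPt, toWord_mk_of_isReduced hl]
  | cons a l ih =>
    by_cases ha : G.otgt a = v
    · have hl' : FreeGroup.IsReduced l := hl.infix ⟨[a], [], by simp⟩
      set m := G.lev (G.osrc a) l with hm
      simp only [lev, if_pos ha, Nat.cast_add, Nat.cast_one] at hs
      rcases le_or_gt s m with hsm | hsm
      · have hgeo : ∀ s' : ℝ, s' ≤ m → G.geo v (a :: l) s' = G.geo (G.osrc a) l s' := by
          intro s' hs'
          rw [geo, if_pos ha]
          split_ifs with h1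
          · have h2 : s' = m := le_antisymm hs' h1
            rw [h2, sub_self, G.oPt_of_le _ _ le_rfl, G.geo_of_ge _ _ le_rfl]
          · rfl
        obtain ⟨h1, h2⟩ := ih (G.osrc a) hl' h0 hsm
        rw [hgeo s hsm]
        refine ⟨h1, fun h ↦ ?_⟩
        rw [h2, hgeo _ ((min_le_right _ _).trans hsm)]
      · have hgeo : G.geo v (a :: l) s = G.oPt a (FreeGroup.mk l) (s - m) := by
          rw [geo, if_pos ha, if_pos hsm.le]
        have hlev : G.lev (G.otgt a) (FreeGroup.mk [a] * FreeGroup.mk l).toWord = m + 1 := by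
          rw [mk_mul_mk, toWord_mk_of_isReduced hl, lev, if_pos rfl]
        have hh : G.forestHeight (G.geo v (a :: l) s) = s := by
          rw [hgeo, G.forestHeight_oPt _ _ ⟨by linarith, by linarith⟩, hlev,
            toWord_mk_of_isReduced hl', ← hm]
          push_cast
          ring
        refine ⟨hh, fun h ↦ ?_⟩
        rw [forestLower, hh]
        split_ifs with hsh
        · rw [min_eq_right hsh]
        · rw [min_eq_left (not_le.1 hsh).le]
          have htop : G.forestTop (G.geo v (a :: l) s) = (v, a :: l) := by
            rcases hs.eq_or_lt with h1 | h1
            · rw [G.geo_of_ge _ _ (by simp [lev, if_pos ha, h1]), forestTop_vertPt,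
                toWord_mk_of_isReduced hl]
            · rw [hgeo, G.forestTop_oPt _ _ ⟨by linarith, by linarith⟩, mk_mul_mk,
                toWord_mk_of_isReduced hl, ha]
              rw [hlev, toWord_mk_of_isReduced hl', ← hm]
              exact Nat.lt_succ_self _
          rw [htop]
    · have hs0 : s = 0 := le_antisymm (by simpa [lev, if_neg ha] using hs) h0
      have hg : ∀ h, G.geo v (a :: l) h = G.vertPt v (FreeGroup.mk (a :: l)) := fun h ↦ by
        rw [geo, if_neg ha]
      have hh : G.forestHeight (G.geo v (a :: l) s) = 0 := by
        rw [hg, forestHeight_vertPt, toWord_mk_of_isReduced hl]; simp [lev, if_neg ha]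
      refine ⟨by rw [hh, hs0], fun h ↦ ?_⟩
      rw [forestLower, hh]
      split_ifs
      · rw [hg, hg]
      · rw [hg s, forestTop_vertPt, toWord_mk_of_isReduced hl, hg, hg]

/-- If an edge of the covering adds a letter to the label, this is the last piece of a descending
path traversed upwards. -/
lemma oPt_eq_geo (a : E × Bool) (g : FreeGroup E) {t : ℝ} (ht : 0 ≤ t) :
    G.oPt a g t = G.geo (G.otgt a) (a :: g.toWord) (G.lev (G.osrc a) g.toWord + t) := by
  rw [geo, if_pos rfl, if_pos (by linarith), FreeGroup.mk_toWord]
  congr 1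
  ring

/-- An edge of the covering that cancels a letter of the label descends. -/
lemma oPt_descending {a : E × Bool} {g : FreeGroup E} {l : List (E × Bool)}
    (hw : g.toWord = rev a :: l) (hl : (FreeGroup.mk [a] * g).toWord = l) :
    1 ≤ G.lev (G.osrc a) g.toWord ∧ ∀ t ≤ 1,
      G.oPt a g t = G.geo (G.osrc a) g.toWord (G.lev (G.osrc a) g.toWord - t) := by
  have hlev : G.lev (G.osrc a) g.toWord = G.lev (G.otgt a) l + 1 := by
    rw [hw, lev, if_pos (G.otgt_rev a), G.osrc_rev]
  refine ⟨by omega, fun t ht ↦ ?_⟩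
  rw [hlev, hw, geo, if_pos (G.otgt_rev a), G.osrc_rev, if_pos, ← hl, FreeGroup.mk_toWord,
    ← G.oPt_rev]
  · rw [hl]
    congr 1
    push_cast
    ring
  · push_cast
    linarith

lemma vertPt_eq_geo (v : V) (g : FreeGroup E) :
    G.vertPt v g = G.geo v g.toWord (G.lev v g.toWord) := by
  rw [G.geo_of_ge _ _ le_rfl, FreeGroup.mk_toWord]

/-- Every point off the vertices lies in the interior of an ascending edge. -/
lemma exists_ascending (e : E) (g : FreeGroup E) {t : ℝ} (ht : t ∈ Ioo (0 : ℝ) 1) :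
    ∃ a g', ∃ s ∈ Ioo (0 : ℝ) 1, G.edgePt e g t = G.oPt a g' s ∧
      (FreeGroup.mk [a] * g').toWord = a :: g'.toWord := by
  rcases toWord_mk_mul (e, true) g with ⟨l, hw, hl⟩ | hw
  · refine ⟨rev (e, true), FreeGroup.mk [(e, true)] * g, 1 - t, one_sub_mem_Ioo ht,
      (G.oPt_rev (e, true) g t).symm, ?_⟩
    rw [hl, ← hw, ← FreeGroup.mk_toWord (x := FreeGroup.mk [(e, true)] * g), hl, mk_mul_mk, ← hw,
      FreeGroup.mk_toWord]
  · exact ⟨(e, true), g, t, ht, rfl, hw⟩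

/-- A point of the forest is on a descending path. -/
lemma exists_eq_geo (q : G.Forest) : ∃ v l, ∃ s : ℝ, FreeGroup.IsReduced l ∧ 0 ≤ s ∧ s ≤ G.lev v l ∧
    q = G.geo v l s := by
  rcases G.forest_cases q with ⟨v, g, rfl⟩ | ⟨e, g, t, ht, rfl⟩
  · exact ⟨v, _, _, FreeGroup.isReduced_toWord, Nat.cast_nonneg _, le_rfl, G.vertPt_eq_geo v g⟩
  · obtain ⟨a, g', s, hs, h1, h2⟩ := G.exists_ascending e g ht
    refine ⟨G.otgt a, a :: g'.toWord, G.lev (G.osrc a) g'.toWord + s,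
      h2 ▸ FreeGroup.isReduced_toWord, ?_, ?_, h1.trans (G.oPt_eq_geo a g' hs.1.le)⟩
    · have := hs.1; positivity
    · rw [lev, if_pos rfl]
      push_cast
      linarith [hs.2]

lemma forestLower_geo {v : V} {l : List (E × Bool)} (hl : FreeGroup.IsReduced l) {s h : ℝ}
    (h0 : 0 ≤ s) (hs : s ≤ G.lev v l) : G.forestLower (G.geo v l s) h = G.geo v l (min h s) :=
  (G.forestHeight_geo v l hl h0 hs).2 h

/-- Along an edge of the covering that adds a letter to the label the height has slope `1`. -/
lemma oPt_ascending {a : E × Bool} {g : FreeGroup E}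
    (hw : (FreeGroup.mk [a] * g).toWord = a :: g.toWord) {t : ℝ} (ht : t ∈ Icc (0 : ℝ) 1) :
    G.forestHeight (G.oPt a g t) = G.lev (G.osrc a) g.toWord + t ∧
      ∀ h : ℝ, G.lev (G.osrc a) g.toWord ≤ h → G.forestLower (G.oPt a g t) h =
        G.oPt a g (min (h - G.lev (G.osrc a) g.toWord) t) := by
  set m := G.lev (G.osrc a) g.toWord with hm
  have hr : FreeGroup.IsReduced (a :: g.toWord) := hw ▸ FreeGroup.isReduced_toWord
  have hlev : (G.lev (G.otgt a) (a :: g.toWord) : ℝ) = m + 1 := by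
    rw [lev, if_pos rfl]; push_cast; rfl
  have h0 : 0 ≤ (m : ℝ) + t := by have := ht.1; positivity
  have h1 : (m : ℝ) + t ≤ G.lev (G.otgt a) (a :: g.toWord) := by rw [hlev]; linarith [ht.2]
  refine ⟨?_, fun h hh ↦ ?_⟩
  · rw [G.oPt_eq_geo a g ht.1]
    exact (G.forestHeight_geo _ _ hr h0 h1).1
  · rw [G.oPt_eq_geo a g ht.1, G.forestLower_geo hr h0 h1,
      G.oPt_eq_geo a g (le_min (by linarith) ht.1)]
    congr 1
    rw [← min_add_add_left, add_sub_cancel]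

/-- Along an oriented edge of the covering the height changes with slope `1` or `-1`, and the edge
is on a descending path. -/
lemma oPt_cases (a : E × Bool) (g : FreeGroup E) :
    (∀ t ∈ Icc (0 : ℝ) 1, G.forestHeight (G.oPt a g t) = G.lev (G.osrc a) g.toWord + t ∧
      ∀ h : ℝ, G.lev (G.osrc a) g.toWord ≤ h → G.forestLower (G.oPt a g t) h =
        G.oPt a g (min (h - G.lev (G.osrc a) g.toWord) t)) ∨
    (1 ≤ G.lev (G.osrc a) g.toWord ∧ ∀ t ∈ Icc (0 : ℝ) 1,
      G.forestHeight (G.oPt a g t) = G.lev (G.osrc a) g.toWord - t ∧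
      G.oPt a g t = G.forestLower (G.vertPt (G.osrc a) g) (G.lev (G.osrc a) g.toWord - t)) := by
  rcases toWord_mk_mul a g with ⟨l, hw, hl⟩ | hw
  · obtain ⟨h1, h2⟩ := G.oPt_descending hw hl
    have h1' : (1 : ℝ) ≤ G.lev (G.osrc a) g.toWord := by exact_mod_cast h1
    refine .inr ⟨h1, fun t ht ↦ ?_⟩
    rw [h2 t ht.2, G.vertPt_eq_geo, G.forestLower_geo FreeGroup.isReduced_toWord
      (Nat.cast_nonneg _) le_rfl, min_eq_left (by linarith [ht.1])]
    exact ⟨(G.forestHeight_geo _ _ FreeGroup.isReduced_toWord (by linarith [ht.2])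
      (by linarith [ht.1])).1, rfl⟩
  · exact .inl fun t ht ↦ G.oPt_ascending hw ht

lemma abs_forestHeight_oPt_sub (a : E × Bool) (g : FreeGroup E) {s t : ℝ} (hs : s ∈ Icc (0 : ℝ) 1)
    (ht : t ∈ Icc (0 : ℝ) 1) :
    |G.forestHeight (G.oPt a g s) - G.forestHeight (G.oPt a g t)| = |s - t| := by
  rcases G.oPt_cases a g with h | ⟨-, h⟩
  · rw [(h s hs).1, (h t ht).1]; congr 1; ring
  · rw [(h s hs).1, (h t ht).1, abs_sub_comm]; congr 1; ring

/-- Near every point of the forest, deck transformations move all points of an `ε`-neighbourhood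
to points of nearly the same height. -/
lemma eventually_abs_forestHeight_deck (q : G.Forest) {ε : ℝ} (hε : 0 < ε) :
    ∀ᶠ q' in 𝓝 q, ∀ k, |G.forestHeight (G.deck k q') - G.forestHeight (G.deck k q)| ≤ ε := by
  rcases G.forest_cases q with ⟨v, g, rfl⟩ | ⟨e, g, t, ht, rfl⟩
  · filter_upwards [G.eventually_vertPt v g hε]
    rintro q' (rfl | ⟨a, t, rfl, ht, ht1, rfl⟩) k
    · simpa using hε.le
    · rw [deck_oPt, deck_vertPt, ← G.oPt_of_le a (g * k) le_rfl,
        G.abs_forestHeight_oPt_sub a _ ⟨ht.1.le, ht1.le⟩ ⟨le_rfl, zero_le_one⟩, sub_zero,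
        abs_of_pos ht.1]
      exact ht.2.le
  · filter_upwards [G.eventually_edgePt e g ht hε]
    rintro q' ⟨t', ht', h1, rfl⟩ k
    rw [deck_edgePt, deck_edgePt]
    have := G.abs_forestHeight_oPt_sub (e, true) (g * k) (Ioo_subset_Icc_self ht')
      (Ioo_subset_Icc_self ht)
    exact this.trans_le h1.le

lemma deck_one (q : G.Forest) : G.deck 1 q = q := by
  obtain ⟨g, hq⟩ := G.exists_eq_pt q
  conv_lhs => rw [hq, deck_pt, mul_one, ← hq]

lemma continuous_forestHeight : Continuous G.forestHeight := by
  rw [continuous_iff_continuousAt]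
  intro q
  rw [Metric.continuousAt_iff']
  intro ε hε
  filter_upwards [G.eventually_abs_forestHeight_deck q (half_pos hε)] with q' h
  have := h 1
  rw [deck_one, deck_one] at this
  rw [Real.dist_eq]
  linarith

lemma forestLower_of_le (q : G.Forest) {h : ℝ} (hh : G.forestHeight q ≤ h) :
    G.forestLower q h = q := if_pos hh

/-- The covering forest with its height function and downward flow. -/
noncomputable def heightedForest : HeightedForest G.Forest where
  height := G.forestHeight
  lower := G.forestLower
  continuous_height := G.continuous_forestHeight
  height_nonneg q := by
    obtain ⟨v, l, s, hl, h0, hs, rfl⟩ := G.exists_eq_geo q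
    rw [(G.forestHeight_geo v l hl h0 hs).1]
    exact h0
  lower_of_le q h hh := G.forestLower_of_le q hh
  height_lower q h h0 hh := by
    obtain ⟨v, l, s, hl, h0', hs, rfl⟩ := G.exists_eq_geo q
    rw [(G.forestHeight_geo v l hl h0' hs).1] at hh
    rw [G.forestLower_geo hl h0' hs, min_eq_left hh,
      (G.forestHeight_geo v l hl h0 (hh.trans hs)).1]
  lower_lower q h h' hh := by
    obtain ⟨v, l, s, hl, h0', hs, rfl⟩ := G.exists_eq_geo q
    rw [G.forestLower_geo hl h0' hs, G.forestLower_geo hl h0' hs]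
    rcases le_total 0 (min h s) with h1 | h1
    · rw [G.forestLower_geo hl h1 ((min_le_right _ _).trans hs), ← min_assoc, min_eq_left hh]
    · rw [G.geo_of_le _ _ h1, G.forestLower_geo hl le_rfl (Nat.cast_nonneg _),
        G.geo_of_le _ _ (min_le_right _ _), G.geo_of_le (h := min h' s)]
      exact (min_le_min_right s hh).trans h1
  continuous_lower q := by
    obtain ⟨v, l, s, hl, h0', hs, rfl⟩ := G.exists_eq_geo q
    have : G.forestLower (G.geo v l s) = fun h ↦ G.geo v l (min h s) := by
      ext1 h; exact G.forestLower_geo hl h0' hs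
    rw [this]
    exact (G.continuous_geo v l).comp (by fun_prop)
  eventually_comparable q := by
    rcases G.forest_cases q with ⟨v, g, rfl⟩ | ⟨e, g, t, ht, rfl⟩
    · filter_upwards [G.eventually_vertPt v g one_pos]
      rintro q' (rfl | ⟨a, t, rfl, ht, ht1, rfl⟩)
      · exact .inl (G.forestLower_of_le _ le_rfl).symm
      · rcases G.oPt_cases a g with h | ⟨-, h⟩
        · right
          rw [forestHeight_vertPt, (h t ⟨ht.1.le, ht1.le⟩).2 _ le_rfl, sub_self,
            min_eq_left ht.1.le, G.oPt_of_le _ _ le_rfl]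
        · left
          rw [(h t ⟨ht.1.le, ht1.le⟩).1, ← (h t ⟨ht.1.le, ht1.le⟩).2]
    · obtain ⟨a, g', s, hs, h1, h2⟩ := G.exists_ascending e g ht
      rw [h1]
      filter_upwards [G.eventually_oPt a g' hs one_pos]
      rintro q' ⟨t', ht', -, rfl⟩
      have hr : FreeGroup.IsReduced (a :: g'.toWord) := h2 ▸ FreeGroup.isReduced_toWord
      have key : ∀ t ∈ Ioo (0 : ℝ) 1, 0 ≤ G.lev (G.osrc a) g'.toWord + t ∧
          G.lev (G.osrc a) g'.toWord + t ≤ G.lev (G.otgt a) (a :: g'.toWord) := fun t ht ↦ by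
        refine ⟨by have := ht.1; positivity, ?_⟩
        rw [lev, if_pos rfl]
        push_cast
        linarith [ht.2]
      have e1 : ∀ t ∈ Ioo (0 : ℝ) 1, ∀ t' ∈ Ioo (0 : ℝ) 1, t ≤ t' →
          G.oPt a g' t = G.forestLower (G.oPt a g' t') (G.forestHeight (G.oPt a g' t)) := by
        intro t ht t' ht' htt
        rw [G.oPt_eq_geo a g' ht.1.le, G.oPt_eq_geo a g' ht'.1.le,
          (G.forestHeight_geo _ _ hr (key t ht).1 (key t ht).2).1,
          G.forestLower_geo hr (key t' ht').1 (key t' ht').2, min_eq_left (by linarith)]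
      rcases le_total t' s with h | h
      · exact .inl (e1 t' ht' s hs h)
      · exact .inr (e1 s hs t' ht' h)
  eventually_lower_mem q W hW := by
    rcases G.forest_cases q with ⟨v, g, rfl⟩ | ⟨e, g, t, ht, rfl⟩
    · have hex : ∀ a : E × Bool, ∃ ε > 0, G.osrc a = v → ∀ t ∈ Ico 0 ε, G.oPt a g t ∈ W := by
        intro a
        by_cases ha : G.osrc a = v
        · have : G.oPt a g ⁻¹' W ∈ 𝓝 0 := (G.continuous_oPt a g).continuousAt.preimage_mem_nhds
            (by rwa [G.oPt_of_le _ _ le_rfl, ha])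
          obtain ⟨ε, hε, hb⟩ := Metric.mem_nhds_iff.1 this
          refine ⟨ε, hε, fun _ t ht ↦ hb ?_⟩
          rw [Metric.mem_ball, Real.dist_eq, sub_zero, abs_of_nonneg ht.1]
          exact ht.2
        · exact ⟨1, one_pos, fun h ↦ absurd h ha⟩
      choose ε hε hεW using hex
      obtain ⟨δ, hδ, hδε⟩ : ∃ δ > 0, ∀ a, δ ≤ ε a := by
        cases isEmpty_or_nonempty (E × Bool) with
        | inl h => exact ⟨1, one_pos, fun a ↦ h.elim a⟩
        | inr h =>
          obtain ⟨a, ha⟩ := Finite.exists_min ε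
          exact ⟨ε a, hε a, ha⟩
      filter_upwards [G.eventually_vertPt v g hδ]
      rintro q' (rfl | ⟨a, t, rfl, ht, ht1, rfl⟩) h hh
      · rw [G.forestLower_of_le _ hh]
        exact mem_of_mem_nhds hW
      · have hmem : ∀ s ∈ Icc 0 t, G.oPt a g s ∈ W := fun s hs ↦
          hεW a rfl s ⟨hs.1, (hs.2.trans_lt ht.2).trans_le (hδε a)⟩
        rw [forestHeight_vertPt] at hh
        rcases G.oPt_cases a g with h' | ⟨-, h'⟩
        · rw [(h' t ⟨ht.1.le, ht1.le⟩).2 _ hh]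
          exact hmem _ ⟨le_min (sub_nonneg.2 hh) ht.1.le, min_le_right _ _⟩
        · rw [G.forestLower_of_le]
          · exact hmem t ⟨ht.1.le, le_rfl⟩
          · rw [(h' t ⟨ht.1.le, ht1.le⟩).1]
            linarith [ht.1]
    · obtain ⟨a, g', s, hs, h1, h2⟩ := G.exists_ascending e g ht
      rw [h1] at hW ⊢
      have : G.oPt a g' ⁻¹' W ∈ 𝓝 s := (G.continuous_oPt a g').continuousAt.preimage_mem_nhds hW
      obtain ⟨ε, hε, hb⟩ := Metric.mem_nhds_iff.1 this
      have hW' : ∀ t, |t - s| < ε → G.oPt a g' t ∈ W := fun t ht ↦ hb (by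
        rwa [Metric.mem_ball, Real.dist_eq])
      filter_upwards [G.eventually_oPt a g' hs hε]
      rintro q' ⟨t', ht', h3, rfl⟩ h hh
      rw [(G.oPt_ascending h2 (Ioo_subset_Icc_self hs)).1] at hh
      rw [(G.oPt_ascending h2 (Ioo_subset_Icc_self ht')).2 _ (by linarith [hs.1])]
      refine hW' _ ?_
      rcases le_total (h - G.lev (G.osrc a) g'.toWord) t' with h4 | h4
      · rw [min_eq_left h4, abs_of_nonneg (by linarith)]
        exact (by linarith : _ ≤ t' - s).trans_lt ((le_abs_self _).trans_lt h3)
      · rw [min_eq_right h4]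
        exact h3

/-- The heights of the translates of a point take discrete values. -/
lemma finite_forestHeight_fibre (q : G.Forest) (B : ℝ) :
    {r | ∃ k, G.forestHeight (G.deck k q) = r ∧ r ≤ B}.Finite := by
  obtain ⟨N, hN⟩ := exists_nat_gt (B + 1)
  rcases G.forest_cases q with ⟨v, g, rfl⟩ | ⟨e, g, t, ht, rfl⟩
  · refine ((finite_lt_nat N).image (fun n : ℕ ↦ (n : ℝ))).subset ?_
    rintro r ⟨k, rfl, hB⟩
    rw [deck_vertPt, forestHeight_vertPt] at hB ⊢
    exact ⟨_, Nat.cast_lt (α := ℝ).1 (by linarith), rfl⟩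
  · refine (((finite_lt_nat N).image (fun n : ℕ ↦ (n : ℝ) + t)).union
      ((finite_lt_nat N).image (fun n : ℕ ↦ (n : ℝ) - t))).subset ?_
    rintro r ⟨k, rfl, hB⟩
    rw [deck_edgePt] at hB ⊢
    have he : G.edgePt e (g * k) t = G.oPt (e, true) (g * k) t := rfl
    rw [he] at hB ⊢
    rcases G.oPt_cases (e, true) (g * k) with h | ⟨-, h⟩
    · rw [(h t (Ioo_subset_Icc_self ht)).1] at hB ⊢
      exact .inl ⟨_, Nat.cast_lt (α := ℝ).1 (by linarith [ht.1]), rfl⟩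
    · rw [(h t (Ioo_subset_Icc_self ht)).1] at hB ⊢
      exact .inr ⟨_, Nat.cast_lt (α := ℝ).1 (by linarith [ht.2]), rfl⟩

instance : T2Space G.Forest := by
  refine ⟨fun q q' hq ↦ ?_⟩
  by_cases h : G.forestProj q = G.forestProj q'
  · exact G.isCoveringMap_forestProj.isSeparatedMap q q' h hq
  · obtain ⟨u, v, hu, hv, hqu, hqv, huv⟩ := t2_separation h
    have hc := G.isCoveringMap_forestProj.continuous
    exact ⟨_, _, hu.preimage hc, hv.preimage hc, hqu, hqv, huv.preimage _⟩

end GraphOn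

/-! ### Forest coverings -/

/-- A covering `proj : T → X` by a forest `T` with a height function, together with a set of
deck transformations that is transitive on fibres and compatible with the height function. -/
structure ForestCovering (X T : Type*) [TopologicalSpace X] [TopologicalSpace T] extends
    HeightedForest T where
  /-- the covering projection -/
  proj : T → X
  isCoveringMap_proj : IsCoveringMap proj
  surjective_proj : Function.Surjective proj
  /-- the deck transformations -/
  deck : Set (T → T)
  continuous_of_mem_deck : ∀ k ∈ deck, Continuous k
  proj_of_mem_deck : ∀ k ∈ deck, ∀ q, proj (k q) = proj q
  exists_deck_eq : ∀ q q', proj q = proj q' → ∃ k ∈ deck, k q = q'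
  /-- the heights of the translates of a point take discrete values -/
  finite_height : ∀ q B, {r | ∃ k ∈ deck, height (k q) = r ∧ r ≤ B}.Finite
  /-- height differences near a point are bounded uniformly in all translates -/
  eventually_abs_height_sub : ∀ q, ∀ᶠ q' in 𝓝 q, ∀ k ∈ deck, |height (k q') - height (k q)| ≤ 1

universe u in
/-- A finite graph has a covering by a forest with a height function. -/
theorem exists_forestCovering (X : Type u) [TopologicalSpace X] [T2Space X]
    [CWComplex (univ : Set X)] [RelCWComplex.Finite (univ : Set X)]
    (hdim : IsOneDimensional (univ : Set X)) :
    ∃ (T : Type u) (_ : TopologicalSpace T) (_ : T2Space T), Nonempty (ForestCovering X T) := by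
  classical
  have hfin := fun n ↦ RelCWComplex.FiniteType.finite_cell (C := (univ : Set X)) (D := ∅) n
  have := hfin 0
  have := hfin 1
  let G := graphOfCW (univ : Set X) hdim
  refine ⟨G.Forest, inferInstance, inferInstance, ⟨{
    toHeightedForest := G.heightedForest
    proj := G.forestProj
    isCoveringMap_proj := G.isCoveringMap_forestProj
    surjective_proj := G.surjective_forestProj
    deck := range G.deck
    continuous_of_mem_deck := ?_
    proj_of_mem_deck := ?_
    exists_deck_eq := ?_
    finite_height := ?_
    eventually_abs_height_sub := ?_ }⟩⟩
  · rintro _ ⟨k, rfl⟩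
    exact G.continuous_deck k
  · rintro _ ⟨k, rfl⟩ q
    exact G.forestProj_deck k q
  · intro q q' h
    obtain ⟨k, hk⟩ := G.exists_deck_eq h
    exact ⟨_, ⟨k, rfl⟩, hk⟩
  · intro q B
    refine (G.finite_forestHeight_fibre q B).subset ?_
    rintro r ⟨_, ⟨k, rfl⟩, h⟩
    exact ⟨k, h⟩
  · intro q
    filter_upwards [G.eventually_abs_forestHeight_deck q one_pos]
    rintro q' h _ ⟨k, rfl⟩
    exact h k

/-! ### Homotopies of immersed paths and loops -/

lemma IsLocallyInjective.of_comp {A B C : Type*} [TopologicalSpace A] {g : B → C} {k : A → B}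
    (h : IsLocallyInjective (g ∘ k)) : IsLocallyInjective k := fun a ↦ by
  obtain ⟨U, hU, ha, hi⟩ := h a
  exact ⟨U, hU, ha, fun x hx y hy hxy ↦ hi hx hy (congrArg g hxy)⟩

lemma IsLocallyInjective.comp {A B C : Type*} [TopologicalSpace A] [TopologicalSpace B] {g : B → C}
    {k : A → B} (hg : IsLocallyInjective g) (hc : Continuous k) (hk : IsLocallyInjective k) :
    IsLocallyInjective (g ∘ k) := fun a ↦ by
  obtain ⟨U, hU, ha, hi⟩ := hk a
  obtain ⟨W, hW, hka, hj⟩ := hg (k a)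
  exact ⟨U ∩ k ⁻¹' W, hU.inter (hW.preimage hc), ⟨ha, hka⟩, fun x hx y hy hxy ↦
    hi hx.1 hy.1 (hj hx.2 hy.2 hxy)⟩

namespace ForestCovering

variable {X T : Type*} [TopologicalSpace X] [TopologicalSpace T] (P : ForestCovering X T)

lemma isLocallyInjective_proj : IsLocallyInjective P.proj :=
  P.isCoveringMap_proj.isLocalHomeomorph.isLocallyInjective

/-- A locally injective path in the base of a forest covering is not null-homotopic: its lift is
injective, hence does not close up. -/
lemma not_homotopicRel_const (P : ForestCovering X T) {γ : C(unitInterval, X)}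
    (hγ : IsLocallyInjective γ) (z : X) :
    ¬ γ.HomotopicRel (ContinuousMap.const unitInterval z) {0, 1} := by
  intro h
  have h0 : γ 0 = z := by obtain ⟨H⟩ := h; exact H.fst_eq_snd (by simp)
  obtain ⟨q, hq⟩ := P.surjective_proj z
  have hend := P.isCoveringMap_proj.liftPath_apply_one_eq_of_homotopicRel h q (h0.trans hq.symm)
    hq.symm
  rw [P.isCoveringMap_proj.liftPath_const hq.symm, ContinuousMap.const_apply] at hend
  have hzero := P.isCoveringMap_proj.liftPath_zero γ q (h0.trans hq.symm)
  have hlift := P.isCoveringMap_proj.liftPath_lifts γ q (h0.trans hq.symm)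
  set k := P.isCoveringMap_proj.liftPath γ q (h0.trans hq.symm)
  have hk : IsLocallyInjective k := IsLocallyInjective.of_comp (g := P.proj) (by rwa [hlift])
  have hinj := P.injOn_of_locallyInjOn (γ := IccExtend zero_le_one k) (S := Icc 0 1)
    ordConnected_Icc k.continuous.Icc_extend'.continuousOn (fun t ht ↦ by
      obtain ⟨U, hU, hm, hi⟩ := hk ⟨t, ht⟩
      obtain ⟨W, hW, hUW⟩ := mem_nhds_subtype (Icc (0 : ℝ) 1) ⟨t, ht⟩ U |>.1 (hU.mem_nhds hm)
      refine ⟨Icc 0 1 ∩ W, Filter.inter_mem self_mem_nhdsWithin (mem_nhdsWithin_of_mem_nhds hW), ?_⟩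
      intro x hx y hy hxy
      rw [IccExtend_of_mem _ _ hx.1, IccExtend_of_mem _ _ hy.1] at hxy
      exact congrArg Subtype.val (hi (@hUW ⟨x, hx.1⟩ hx.2) (@hUW ⟨y, hy.1⟩ hy.2) hxy))
  refine zero_ne_one' ℝ (hinj ⟨le_rfl, zero_le_one⟩ ⟨zero_le_one, le_rfl⟩ ?_)
  rw [IccExtend_left, IccExtend_right]
  exact hzero.trans hend.symm

/-- A path whose image under an immersion is null-homotopic is a loop. The path can be replaced by
the projection of an injective path of the forest. -/
lemma eq_of_comp_homotopicRel_const [T2Space T] (P : ForestCovering X T) {F : C(X, X)}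
    (hF : IsLocallyInjective F) (c : C(unitInterval, X)) {z : X}
    (h : (F.comp c).HomotopicRel (ContinuousMap.const unitInterval z) {0, 1}) : c 0 = c 1 := by
  obtain ⟨q, hq⟩ := P.surjective_proj (c 0)
  have hzero := P.isCoveringMap_proj.liftPath_zero c q hq.symm
  have hlift := P.isCoveringMap_proj.liftPath_lifts c q hq.symm
  set k := P.isCoveringMap_proj.liftPath c q hq.symm with hk
  by_contra hne
  have hne' : k 0 ≠ k 1 := fun h ↦ hne (by
    rw [← hlift, Function.comp_apply, Function.comp_apply, h])
  obtain ⟨p, hp⟩ := P.exists_injective_path hne' (P.lower_zero_eq k.continuous 0 1)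
  let k' : Path (k 0) (k 1) := ⟨k, rfl, rfl⟩
  have hcov : Continuous P.proj := P.isCoveringMap_proj.continuous
  have hhom : (F.comp (ContinuousMap.comp ⟨P.proj, hcov⟩ p.toContinuousMap)).HomotopicRel
      (F.comp c) {0, 1} := by
    have h1 := P.homotopic p k'
    obtain ⟨H⟩ := h1
    have h2 : F.comp c = (F.comp ⟨P.proj, hcov⟩).comp k'.toContinuousMap := by
      ext t
      exact congrArg F (congrFun hlift t).symm
    rw [h2, ← ContinuousMap.comp_assoc]
    exact ⟨H.compContinuousMap (F.comp ⟨P.proj, hcov⟩)⟩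
  refine P.not_homotopicRel_const ?_ z (hhom.trans h)
  exact IsLocallyInjective.comp (g := F) (k := P.proj ∘ p) hF (hcov.comp p.continuous)
    (IsLocallyInjective.comp P.isLocallyInjective_proj p.continuous hp.IsLocallyInjective)

lemma exists_lift (G : C(ℝ × ℝ, X)) : ∃ k : C(ℝ × ℝ, T), ∀ x, P.proj (k x) = G x := by
  obtain ⟨q, hq⟩ := P.surjective_proj (G 0)
  obtain ⟨k, hk, -⟩ := P.isCoveringMap_proj.existsUnique_continuousMap_lifts G 0 q hq
  exact ⟨k, congrFun hk.2⟩

/-- On a compact connected set the heights of the translates differ by a bounded amount. -/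
lemma exists_abs_height_sub_le {Z : Set T} (hc : IsCompact Z) (hp : IsPreconnected Z) :
    ∃ C, ∀ q ∈ Z, ∀ q' ∈ Z, ∀ k ∈ P.deck, P.height (k q) ≤ P.height (k q') + C := by
  have key : ∀ q ∈ Z, ∀ q' ∈ Z, ∃ C, ∀ k ∈ P.deck, |P.height (k q') - P.height (k q)| ≤ C := by
    intro q hq q' hq'
    refine hp.induction₂ (fun q q' ↦ ∃ C, ∀ k ∈ P.deck, |P.height (k q') - P.height (k q)| ≤ C)
      ?_ ?_ ?_ hq hq'
    · intro x hx
      filter_upwards [mem_nhdsWithin_of_mem_nhds (P.eventually_abs_height_sub x)] with y hy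
      exact ⟨1, hy⟩
    · rintro x y z - - - ⟨C, hC⟩ ⟨D, hD⟩
      exact ⟨D + C, fun k hk ↦ (abs_sub_le _ _ _).trans (add_le_add (hD k hk) (hC k hk))⟩
    · rintro x y - - ⟨C, hC⟩
      exact ⟨C, fun k hk ↦ by rw [abs_sub_comm]; exact hC k hk⟩
  rcases Z.eq_empty_or_nonempty with rfl | ⟨q₀, h₀⟩
  · exact ⟨0, by simp⟩
  have : ∃ C, ∀ q ∈ Z, ∀ k ∈ P.deck, |P.height (k q) - P.height (k q₀)| ≤ C := by
    refine hc.induction_on (p := fun S ↦ ∃ C, ∀ q ∈ S, ∀ k ∈ P.deck,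
      |P.height (k q) - P.height (k q₀)| ≤ C) ⟨0, by simp⟩ ?_ ?_ ?_
    · rintro S S' hS ⟨C, hC⟩
      exact ⟨C, fun q hq ↦ hC q (hS hq)⟩
    · rintro S S' ⟨C, hC⟩ ⟨C', hC'⟩
      refine ⟨max C C', fun q hq k hk ↦ ?_⟩
      rcases hq with hq | hq
      · exact (hC q hq k hk).trans (le_max_left _ _)
      · exact (hC' q hq k hk).trans (le_max_right _ _)
    · intro q hq
      obtain ⟨C, hC⟩ := key q₀ h₀ q hq
      exact ⟨_, mem_nhdsWithin_of_mem_nhds (P.eventually_abs_height_sub q), 1 + C, fun q' h k hk ↦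
        (abs_sub_le _ _ _).trans (add_le_add (h k hk) (hC k hk))⟩
  obtain ⟨C, hC⟩ := this
  refine ⟨C + C, fun q hq q' hq' k hk ↦ ?_⟩
  have h1 := abs_le.1 (hC q hq k hk)
  have h2 := abs_le.1 (hC q' hq' k hk)
  linarith [h1.2, h2.1]

/-- Two homotopic immersed loops agree up to reparametrization, since their lifts to the forest are
lines at bounded distance. The reparametrization is compatible with the homotopy `G`: the points
`(s, a)` and `(φ s, b)` have the same lift, so that paths from them to a common point have homotopic
images under `G`. -/
theorem exists_reparametrization_of_homotopy (P : ForestCovering X T) (G : C(ℝ × ℝ, X))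
    (hG : ∀ s t, G (s + 1, t) = G (s, t)) {a b : ℝ}
    (ha : IsLocallyInjective fun s ↦ G (s, a)) (hb : IsLocallyInjective fun s ↦ G (s, b)) :
    ∃ φ : ℝ → ℝ, Continuous φ ∧ Function.Injective φ ∧ (∀ s, φ (s + 1) = φ s + 1) ∧
      (∀ s, G (s, a) = G (φ s, b)) ∧ ∀ s x (p : Path (s, a) x) (p' : Path (φ s, b) x),
        (G.comp p.toContinuousMap).HomotopicRel (G.comp p'.toContinuousMap) {0, 1} := by
  obtain ⟨k, hk⟩ := P.exists_lift G
  have hGz : ∀ (n : ℤ) s t, G (s + n, t) = G (s, t) := fun n s t ↦ by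
    have : Function.Periodic (fun s ↦ G (s, t)) 1 := fun s ↦ hG s t
    simpa using this.int_mul n s
  -- translation by a period acts on the lift as a deck transformation
  have hd : ∀ n : ℤ, ∃ d ∈ P.deck, ∀ s t, k (s + n, t) = d (k (s, t)) := by
    intro n
    obtain ⟨d, hd, h0⟩ := P.exists_deck_eq (k (0, a)) (k (0 + n, a)) (by rw [hk, hk, hGz])
    refine ⟨d, hd, fun s t ↦ ?_⟩
    have h1 : Continuous (fun p : ℝ × ℝ ↦ k (p.1 + n, p.2)) := by fun_prop
    have h2 : Continuous (fun p : ℝ × ℝ ↦ d (k p)) :=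
      (P.continuous_of_mem_deck d hd).comp k.continuous
    exact congrFun (P.isCoveringMap_proj.eq_of_comp_eq h1 h2 (funext fun p ↦ by
      simp only [Function.comp_apply, hk, P.proj_of_mem_deck d hd, hGz]) (0, a) h0.symm) (s, t)
  have hcont : ∀ c, Continuous fun s ↦ k (s, c) := fun c ↦ by fun_prop
  have hloc : ∀ c, IsLocallyInjective (fun s ↦ G (s, c)) → IsLocallyInjective fun s ↦ k (s, c) :=
    fun c h ↦ IsLocallyInjective.of_comp (g := P.proj) (by
      have : P.proj ∘ (fun s ↦ k (s, c)) = fun s ↦ G (s, c) := funext fun s ↦ hk _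
      rwa [this])
  have hinj : ∀ c, IsLocallyInjective (fun s ↦ G (s, c)) → Function.Injective fun s ↦ k (s, c) :=
    fun c h ↦ injOn_univ.1 (P.injOn_of_locallyInjOn ordConnected_univ
      (hcont c).continuousOn (HeightedForest.locallyInjOn_univ (hloc c h)))
  have hfin : ∀ c B, {r | ∃ n : ℤ, P.height (k (n, c)) = r ∧ r ≤ B}.Finite := fun c B ↦ by
    refine (P.finite_height (k (0, c)) B).subset ?_
    rintro r ⟨n, h1, h2⟩
    obtain ⟨d, hdd, h⟩ := hd n
    exact ⟨d, hdd, by rw [← h, zero_add, h1], h2⟩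
  -- the translates of the lifted trace `Z` of the basepoint keep the two lifted loops close
  let Z : Set T := (fun t ↦ k (0, t)) '' uIcc a b
  have hkc : Continuous fun t ↦ k (0, t) := by fun_prop
  obtain ⟨C, hC⟩ := P.exists_abs_height_sub_le (isCompact_uIcc.image hkc)
    (isPreconnected_uIcc.image _ hkc.continuousOn)
  obtain ⟨φ, hφ, hφe⟩ := HeightedForest.exists_reparametrization (P := P.toHeightedForest)
    (hcont a) (hcont b) (hloc a ha) (hloc b hb) (hfin a) (hfin b) (C := C) (fun n ↦ by
      obtain ⟨d, hdd, h⟩ := hd n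
      have h0 : ∀ t, k (n, t) = d (k (0, t)) := fun t ↦ by rw [← h, zero_add]
      refine ⟨d '' Z, (isPreconnected_uIcc.image _ hkc.continuousOn).image _
        (P.continuous_of_mem_deck d hdd).continuousOn, ⟨_, ⟨a, left_mem_uIcc, rfl⟩, (h0 a).symm⟩,
        ⟨_, ⟨b, right_mem_uIcc, rfl⟩, (h0 b).symm⟩, ?_⟩
      rintro _ ⟨q, hq, rfl⟩ _ ⟨q', hq', rfl⟩
      exact hC q hq q' hq' d hdd)
  refine ⟨φ, hφ, fun s s' h ↦ hinj a ha (by simp only [hφe, h]), fun s ↦ hinj b hb ?_, fun s ↦ ?_,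
    fun s x p p' ↦ ?_⟩
  · obtain ⟨d, hdd, h⟩ := hd 1
    simp only [Int.cast_one] at h
    simp only [h, ← hφe]
  · rw [← hk, ← hk, hφe]
  · let r : Path (k (s, a)) (k x) := (p'.map k.continuous).cast (hφe s) rfl
    obtain ⟨H⟩ := P.homotopic (p.map k.continuous) r
    have hcov : Continuous P.proj := P.isCoveringMap_proj.continuous
    have h1 : G.comp p.toContinuousMap =
        ContinuousMap.comp ⟨P.proj, hcov⟩ (p.map k.continuous).toContinuousMap := by
      ext t
      exact (hk _).symm
    have h2 : G.comp p'.toContinuousMap =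
        ContinuousMap.comp ⟨P.proj, hcov⟩ r.toContinuousMap := by
      ext t
      exact (hk _).symm
    rw [h1, h2]
    exact ⟨H.compContinuousMap _⟩

end ForestCovering

/-! ### Immersed loops and core graphs -/

/-- Continuity can be checked on the preimages of the intervals `[n, n + 1]`. -/
lemma continuous_of_forall_Icc {Y Z : Type*} [TopologicalSpace Y] [TopologicalSpace Z] {F : Y → Z}
    {h : Y → ℝ} (hh : Continuous h) (hF : ∀ n : ℤ, ContinuousOn F (h ⁻¹' Icc n (n + 1))) :
    Continuous F := by
  have hf : LocallyFinite fun n : ℤ ↦ Icc (n : ℝ) (n + 1) := by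
    intro x
    refine ⟨Ioo (x - 1) (x + 1), Ioo_mem_nhds (by linarith) (by linarith),
      (finite_Icc (⌊x⌋ - 2) (⌊x⌋ + 2)).subset ?_⟩
    rintro n ⟨y, hy, hy'⟩
    have h1 := Int.floor_le x
    have h2 := Int.lt_floor_add_one x
    constructor
    · have : (⌊x⌋ : ℝ) - 2 < n := by linarith [hy'.1, hy.2]
      exact_mod_cast this.le
    · have : (n : ℝ) < ⌊x⌋ + 2 := by linarith [hy'.2, hy.1]
      exact_mod_cast this.le
  refine (hf.preimage_continuous hh).continuous ?_ (fun n ↦ isClosed_Icc.preimage hh) hF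
  refine eq_univ_of_forall fun y ↦ mem_iUnion.2 ⟨⌊h y⌋, ?_⟩
  exact ⟨Int.floor_le _, (Int.lt_floor_add_one _).le⟩

namespace GraphOn

variable {X V E : Type*} [TopologicalSpace X] {C : Set X} (G : GraphOn C V E)

/-- The line in a graph that runs through a given sequence of oriented edges. -/
noncomputable def line (a : ℤ → E × Bool) (t : ℝ) : X := G.oedge (a ⌊t⌋) (Int.fract t)

lemma line_of_mem {a : ℤ → E × Bool} (ha : ∀ n, G.osrc (a (n + 1)) = G.otgt (a n)) {n : ℤ} {t : ℝ}
    (ht : t ∈ Icc (n : ℝ) (n + 1)) : G.line a t = G.oedge (a n) (t - n) := by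
  rcases ht.2.eq_or_lt with h | h
  · have : ⌊t⌋ = n + 1 := by rw [h]; exact_mod_cast Int.floor_intCast (n + 1)
    rw [line, Int.fract, this, h]
    push_cast
    rw [sub_self, oedge_zero, ha, ← oedge_one, add_sub_cancel_left]
  · rw [line, Int.fract, Int.floor_eq_iff.2 ⟨ht.1, h⟩]

lemma continuous_line {a : ℤ → E × Bool} (ha : ∀ n, G.osrc (a (n + 1)) = G.otgt (a n)) :
    Continuous (G.line a) := by
  refine continuous_of_forall_Icc continuous_id fun n ↦ ?_
  refine ContinuousOn.congr (f := fun t ↦ G.oedge (a n) (t - n)) ?_ fun t ht ↦ G.line_of_mem ha ht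
  refine (G.continuousOn_oedge _).comp (by fun_prop) fun t ht ↦ ?_
  have : (n : ℝ) ≤ t ∧ t ≤ n + 1 := ht
  constructor <;> linarith [this.1, this.2]

/-- A line without backtracking is locally injective. -/
lemma isLocallyInjective_line {a : ℤ → E × Bool} (ha : ∀ n, G.osrc (a (n + 1)) = G.otgt (a n))
    (hr : ∀ n, a (n + 1) ≠ rev (a n)) : IsLocallyInjective (G.line a) := by
  have hne : ∀ c : E × Bool, c ≠ rev c := by rintro ⟨e, _ | _⟩ h <;> simp [rev] at h
  have h1 : ∀ n : ℤ, InjOn (G.line a) (Ioo (n : ℝ) (n + 1)) := by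
    intro n t ht s hs h
    rw [G.line_of_mem ha (Ioo_subset_Icc_self ht), G.line_of_mem ha (Ioo_subset_Icc_self hs)] at h
    rcases G.oedge_eq (by constructor <;> linarith [ht.1, ht.2])
      (by constructor <;> linarith [hs.1, hs.2]) h with h | h
    · linarith [h.2]
    · exact absurd h.1 (hne _)
  -- near an integer: the two sides of a vertex
  have h2 : ∀ n : ℤ, ∀ t ∈ Ioo ((n : ℝ) + 1 / 2) (n + 1), ∀ s ∈ Ico ((n : ℝ) + 1) (n + 1 + 1 / 2),
      G.line a t ≠ G.line a s := by
    intro n t ht s hs h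
    rw [G.line_of_mem (n := n) ha ⟨by linarith [ht.1], ht.2.le⟩, G.line_of_mem (n := n + 1) ha
      ⟨by push_cast; exact hs.1, by push_cast; linarith [hs.2]⟩] at h
    push_cast at h
    have ht' : t - n ∈ Ioo (0 : ℝ) 1 := by constructor <;> linarith [ht.1, ht.2]
    rcases hs.1.eq_or_lt with h0 | h0
    · rw [← h0, sub_self, oedge_zero] at h
      exact G.oedge_ne_vert ht' h
    · rcases G.oedge_eq ht' (by constructor <;> linarith [hs.2]) h with h | h
      · linarith [h.2, ht.1, hs.2]
      · exact hr n h.1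
  have h3 : ∀ n : ℤ, ∀ t ∈ Ioo (n : ℝ) (n + 1), G.line a t ≠ G.line a n := by
    intro n t ht h
    rw [G.line_of_mem (n := n) ha ⟨ht.1.le, ht.2.le⟩, G.line_of_mem (n := n) ha
      ⟨le_rfl, by linarith⟩, sub_self, oedge_zero] at h
    exact G.oedge_ne_vert (by constructor <;> linarith [ht.1, ht.2]) h
  intro x
  by_cases hx : Int.fract x = 0
  · obtain ⟨n, hn⟩ : ∃ n : ℤ, x = n + 1 := ⟨⌊x⌋ - 1, by
      rw [Int.fract] at hx; push_cast; linarith⟩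
    refine ⟨Ioo ((n : ℝ) + 1 / 2) (n + 1 + 1 / 2), isOpen_Ioo,
      by rw [hn]; constructor <;> linarith, ?_⟩
    have key : ∀ t ∈ Ioo ((n : ℝ) + 1 / 2) (n + 1 + 1 / 2),
        ∀ s ∈ Ioo ((n : ℝ) + 1 / 2) (n + 1 + 1 / 2), t < s → G.line a t ≠ G.line a s := by
      intro t ht s hs hts
      rcases lt_or_ge t (n + 1) with h4 | h4
      · rcases lt_or_ge s (n + 1) with h5 | h5
        · intro h
          exact hts.ne (h1 n ⟨by linarith [ht.1], h4⟩ ⟨by linarith [hs.1], h5⟩ h)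
        · exact h2 n t ⟨ht.1, h4⟩ s ⟨h5, hs.2⟩
      · rcases h4.eq_or_lt with h5 | h5
        · have := h3 (n + 1) s (by push_cast; constructor <;> linarith [hs.2])
          push_cast at this
          rw [← h5]
          exact this.symm
        · intro h
          refine hts.ne (h1 (n + 1) ?_ ?_ h) <;> push_cast <;> constructor <;>
            linarith [hs.2, ht.2]
    intro t ht s hs h
    rcases lt_trichotomy t s with h4 | h4 | h4
    · exact absurd h (key t ht s hs h4)
    · exact h4
    · exact absurd h.symm (key s hs t ht h4)
  · exact ⟨_, isOpen_Ioo, ⟨lt_of_le_of_ne (Int.floor_le x) fun h ↦ hx (by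
      rw [Int.fract, h, sub_self]), Int.lt_floor_add_one x⟩, h1 ⌊x⌋⟩

/-- In a finite graph whose edges can all be continued without backtracking there is an immersed
loop, because the continuation map has a periodic orbit. -/
lemma exists_immersed_loop [Finite E] [Nonempty E]
    (h : ∀ a : E × Bool, ∃ b, G.osrc b = G.otgt a ∧ b ≠ rev a) :
    ∃ g : ℝ → X, Continuous g ∧ IsLocallyInjective g ∧ (∀ s, g (s + 1) = g s) ∧ ∀ s, g s ∈ C := by
  choose next hsrc hne using h
  obtain ⟨e₀⟩ := ‹Nonempty E›
  obtain ⟨i, j, hij, heq⟩ : ∃ i j : ℕ, i < j ∧ next^[i] (e₀, true) = next^[j] (e₀, true) := by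
    obtain ⟨i, j, hij, h⟩ := Finite.exists_ne_map_eq_of_infinite fun n ↦ next^[n] (e₀, true)
    rcases lt_or_gt_of_ne hij with h' | h'
    · exact ⟨i, j, h', h⟩
    · exact ⟨j, i, h', h.symm⟩
  set a₀ := next^[i] (e₀, true) with ha₀
  obtain ⟨N, rfl⟩ := Nat.exists_eq_add_of_lt hij
  have hper : next^[N + 1] a₀ = a₀ := by
    rw [ha₀, ← Function.iterate_add_apply, ← ha₀, heq]
    exact congrArg (fun k ↦ next^[k] (e₀, true)) (by ring)
  have hN : (0 : ℤ) < N + 1 := by positivity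
  let a : ℤ → E × Bool := fun n ↦ next^[(n % (N + 1)).toNat] a₀
  have hper' : ∀ n, a (n + (N + 1)) = a n := fun n ↦ by simp only [a, Int.add_emod_right]
  have hstep : ∀ n, a (n + 1) = next (a n) := by
    intro n
    have h0 := Int.emod_nonneg n hN.ne'
    have h1 := Int.emod_lt_of_pos n hN
    simp only [a]
    rw [← Function.iterate_succ_apply' next]
    rcases (Int.add_one_le_iff.2 h1).eq_or_lt with h2 | h2
    · have h3 : (n + 1) % (N + 1 : ℤ) = 0 := by
        rw [← Int.emod_add_emod, h2, Int.emod_self]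
      have h4 : (n % (N + 1 : ℤ)).toNat.succ = N + 1 := by omega
      rw [h3, h4, hper]
      rfl
    · have h3 : (n + 1) % (N + 1 : ℤ) = n % (N + 1) + 1 := by
        rw [← Int.emod_add_emod, Int.emod_eq_of_lt (by omega) h2]
      rw [h3]
      congr 2
      omega
  have hs : ∀ n, G.osrc (a (n + 1)) = G.otgt (a n) := fun n ↦ by rw [hstep]; exact hsrc _
  have hr : ∀ n, a (n + 1) ≠ rev (a n) := fun n ↦ by rw [hstep]; exact hne _
  have hN' : ((N : ℝ) + 1) ≠ 0 := by positivity
  refine ⟨fun s ↦ G.line a ((N + 1) * s), (G.continuous_line hs).comp (by fun_prop),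
    (G.isLocallyInjective_line hs hr).comp_right (by fun_prop) (mul_right_injective₀ hN'),
    fun s ↦ ?_, fun s ↦ G.oedge_mem ⟨Int.fract_nonneg _, (Int.fract_lt_one _).le⟩⟩
  have : ((N : ℝ) + 1) * (s + 1) = (N + 1) * s + ((N + 1 : ℤ) : ℝ) := by push_cast; ring
  simp only [line]
  rw [this, Int.floor_add_intCast, Int.fract_add_intCast, hper']

end GraphOn

/-- A nonempty core graph contains an immersed loop: by the condition on valencies every edge can
be continued without backtracking. -/
lemma IsCoreGraph.exists_immersed_loop {X : Type*} [TopologicalSpace X] [T2Space X] {K : Set X}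
    (hK : IsCoreGraph K) (hne : K.Nonempty) : ∃ g : ℝ → X, Continuous g ∧ IsLocallyInjective g ∧
      (∀ s, g (s + 1) = g s) ∧ ∀ s, g s ∈ K := by
  obtain ⟨_, hfin, hdim, hval⟩ := hK
  have := RelCWComplex.FiniteType.finite_cell (C := K) (D := ∅) 1
  let G := graphOfCW K hdim
  have hne' : Nonempty (RelCWComplex.cell K 1) := by
    obtain ⟨x, hx⟩ := hne
    rcases G.exists_eq hx with ⟨v, -⟩ | ⟨e, -⟩
    · have h2 : (edgeEnds K v).Nonempty := by
        rw [← encard_ne_zero]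
        intro h0
        have := hval v
        rw [valency, h0] at this
        simp at this
      exact ⟨h2.some.1⟩
    · exact ⟨e⟩
  refine G.exists_immersed_loop fun a ↦ ?_
  have h1 : 1 < (edgeEnds K (G.otgt a)).encard :=
    lt_of_lt_of_le (by norm_num) (hval (G.otgt a))
  obtain ⟨b, hb, hne⟩ := exists_ne_of_one_lt_encard h1 a
  refine ⟨GraphOn.rev b, ?_, fun h ↦ hne ?_⟩
  · rw [G.osrc_rev]
    exact (mem_edgeEnds_iff K hdim _ b).1 hb
  · rw [← GraphOn.rev_rev b, h, GraphOn.rev_rev]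

/-- The cells of a circle with one vertex and one edge. -/
def CircleCell.{u} : ℕ → Type u
  | 0 => PUnit
  | 1 => PUnit
  | _ => PEmpty

/-- The characteristic maps of a circle, parametrized by a loop `c` on `[0, 1]`. -/
noncomputable def circleChar {X : Type*} (c : ℝ → X) : (n : ℕ) → (Fin n → ℝ) → X
  | 0, _ => c 0
  | _ + 1, y => c ((y 0 + 1) / 2)

section Circle

open Metric

lemma half_mem_Ioo_iff {y : Fin 1 → ℝ} : y ∈ ball (0 : Fin 1 → ℝ) 1 ↔
    (y 0 + 1) / 2 ∈ Ioo (0 : ℝ) 1 := by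
  obtain ⟨t, rfl⟩ := exists_cwArg_eq y
  rw [cwArg_mem_ball]
  congr! 1
  ring

lemma half_mem_Icc_iff {y : Fin 1 → ℝ} : y ∈ closedBall (0 : Fin 1 → ℝ) 1 ↔
    (y 0 + 1) / 2 ∈ Icc (0 : ℝ) 1 := by
  obtain ⟨t, rfl⟩ := exists_cwArg_eq y
  rw [cwArg_mem_closedBall]
  congr! 1
  ring

lemma mapsTo_circleChar_sphere {X : Type*} {c : ℝ → X} (h01 : c 0 = c 1) {y : Fin 1 → ℝ}
    (hy : y ∈ sphere (0 : Fin 1 → ℝ) 1) : circleChar c 1 y = c 0 := by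
  have h1 : (y 0 + 1) / 2 ∈ Icc (0 : ℝ) 1 := half_mem_Icc_iff.1 (sphere_subset_closedBall hy)
  have h2 : (y 0 + 1) / 2 ∉ Ioo (0 : ℝ) 1 := fun h ↦
    (mem_ball.1 (half_mem_Ioo_iff.2 h)).ne (mem_sphere.1 hy)
  change c ((y 0 + 1) / 2) = c 0
  rcases h1.1.eq_or_lt with h | h
  · rw [← h]
  · rcases h1.2.eq_or_lt with h' | h'
    · rw [h', h01]
    · exact absurd ⟨h, h'⟩ h2

/-- An embedded circle is a core graph with one vertex and one edge. -/
lemma isCoreGraph_image {X : Type*} [TopologicalSpace X] [T2Space X] {c : ℝ → X}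
    (hc : ContinuousOn c (Icc 0 1)) (h01 : c 0 = c 1) (hinj : InjOn c (Ico 0 1)) :
    IsCoreGraph (c '' Icc 0 1) := by
  have hcell : ∀ {n : ℕ} (P : ℕ → Prop), CircleCell n → P 0 → P 1 → P n := by
    rintro (_ | _ | n) P i h0 h1
    · exact h0
    · exact h1
    · exact i.elim
  have hmc : ∀ n, CircleCell n → ContinuousOn (circleChar c n) (closedBall 0 1) := fun n i ↦ by
    refine hcell (fun n ↦ ContinuousOn (circleChar c n) (closedBall 0 1)) i continuousOn_const ?_
    exact hc.comp (by fun_prop) fun y hy ↦ half_mem_Icc_iff.1 hy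
  have hmi : ∀ n, CircleCell n → InjOn (circleChar c n) (ball 0 1) := fun n i ↦ by
    refine hcell (fun n ↦ InjOn (circleChar c n) (ball 0 1)) i
      (fun x _ y _ _ ↦ Subsingleton.elim x y) ?_
    intro x hx y hy h
    have := hinj (Ioo_subset_Ico_self (half_mem_Ioo_iff.1 hx))
      (Ioo_subset_Ico_self (half_mem_Ioo_iff.1 hy)) h
    ext j
    rw [Subsingleton.elim j 0]
    linarith
  have hopen : ∀ y : Fin 1 → ℝ, y ∈ ball (0 : Fin 1 → ℝ) 1 → circleChar c 1 y ≠ c 0 := by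
    intro y hy h
    have h1 := half_mem_Ioo_iff.1 hy
    exact h1.1.ne' (hinj (Ioo_subset_Ico_self h1) ⟨le_rfl, one_pos⟩ h)
  have himg0 : circleChar c 0 '' closedBall 0 1 = {c 0} := by
    ext x
    constructor
    · rintro ⟨y, -, rfl⟩
      rfl
    · rintro rfl
      exact ⟨0, by simp, rfl⟩
  have himg1 : circleChar c 1 '' closedBall 0 1 = c '' Icc 0 1 := by
    ext x
    constructor
    · rintro ⟨y, hy, rfl⟩
      exact ⟨_, half_mem_Icc_iff.1 hy, rfl⟩
    · rintro ⟨t, ht, rfl⟩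
      refine ⟨fun _ ↦ 2 * t - 1, cwArg_mem_closedBall.2 ht, ?_⟩
      change c _ = c t
      congr 1
      ring
  have hsph : ∀ n, CircleCell n → ∀ y ∈ sphere (0 : Fin n → ℝ) 1, ∀ y' ∈ ball (0 : Fin n → ℝ) 1,
      circleChar c n y ≠ circleChar c n y' := fun n i ↦ by
    refine hcell (fun n ↦ ∀ y ∈ sphere (0 : Fin n → ℝ) 1, ∀ y' ∈ ball (0 : Fin n → ℝ) 1,
      circleChar c n y ≠ circleChar c n y') i ?_ ?_
    · intro y hy
      rw [mem_sphere_zero_iff_norm, Subsingleton.elim y 0, norm_zero] at hy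
      exact absurd hy zero_ne_one
    · intro y hy y' hy' h
      exact hopen y' hy' (h ▸ mapsTo_circleChar_sphere h01 hy)
  have hsymm : ∀ n (i : CircleCell n), ContinuousOn
      ((hmi n i).toPartialEquiv (circleChar c n) (ball 0 1)).symm
      (circleChar c n '' ball 0 1) := fun n i ↦ by
    -- the boundary of the cell is mapped off the open cell, so closed sets have closed images
    set e := (hmi n i).toPartialEquiv (circleChar c n) (ball 0 1)
    rw [continuousOn_iff_isClosed]
    intro F hF
    refine ⟨circleChar c n '' (F ∩ closedBall 0 1),
      (((isCompact_closedBall _ _).inter_left hF).image_of_continuousOn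
        ((hmc n i).mono inter_subset_right)).isClosed, ?_⟩
    ext x
    constructor
    · rintro ⟨hx, y, hy, rfl⟩
      refine ⟨⟨y, ⟨?_, ball_subset_closedBall hy⟩, rfl⟩, y, hy, rfl⟩
      have : e.symm (circleChar c n y) = y := e.left_inv hy
      rwa [mem_preimage, this] at hx
    · rintro ⟨⟨y, hy, rfl⟩, y', hy', h⟩
      refine ⟨?_, y', hy', h⟩
      have hyb : y ∈ ball (0 : Fin n → ℝ) 1 := by
        by_contra hyb
        exact hsph n i y (mem_sphere.2 (le_antisymm hy.2 (not_lt.1 fun h ↦ hyb h))) y' hy' h.symm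
      have : e.symm (circleChar c n y) = y := e.left_inv hyb
      rw [mem_preimage, this]
      exact hy.1
  have hev : ∀ᶠ n in Filter.atTop, IsEmpty (CircleCell n) :=
    Filter.eventually_atTop.2 ⟨2, fun n hn ↦ by
      obtain ⟨k, rfl⟩ := Nat.exists_eq_add_of_le' hn
      exact inferInstanceAs (IsEmpty PEmpty)⟩
  have hfin : ∀ n, Finite (CircleCell n) := by
    rintro (_ | _ | n)
    · exact inferInstanceAs (Finite PUnit)
    · exact inferInstanceAs (Finite PUnit)
    · exact inferInstanceAs (Finite PEmpty)
  have hpd : (univ : Set (Σ n, CircleCell n)).PairwiseDisjoint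
      (fun ni ↦ circleChar c ni.1 '' ball 0 1) := by
    have h0 : Disjoint (circleChar c 0 '' ball 0 1) (circleChar c 1 '' ball 0 1) := by
      rw [disjoint_left]
      rintro _ ⟨y, -, rfl⟩ ⟨y', hy', h⟩
      exact hopen y' hy' h
    rintro ⟨_ | _ | n, i⟩ - ⟨_ | _ | m, j⟩ - hne
    · exact absurd rfl hne
    · exact h0
    · exact j.elim
    · exact h0.symm
    · exact absurd rfl hne
    · exact j.elim
    all_goals exact i.elim
  have hmt : ∀ (n : ℕ) (_ : CircleCell n), MapsTo (circleChar c n) (sphere 0 1)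
      (⋃ (m < n) (_ : CircleCell m), circleChar c m '' closedBall 0 1) := by
    rintro (_ | _ | n) i y hy
    · rw [mem_sphere_zero_iff_norm, Subsingleton.elim y 0, norm_zero] at hy
      exact absurd hy zero_ne_one
    · simp only [mem_iUnion]
      refine ⟨0, one_pos, PUnit.unit, ?_⟩
      rw [himg0]
      exact mapsTo_circleChar_sphere h01 hy
    · exact i.elim
  have hun : ⋃ (n : ℕ) (_ : CircleCell n), circleChar c n '' closedBall 0 1 = c '' Icc 0 1 := by
    refine subset_antisymm (iUnion₂_subset ?_) ?_
    · rintro (_ | _ | n) i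
      · rw [himg0, singleton_subset_iff]
        exact ⟨0, ⟨le_rfl, zero_le_one⟩, rfl⟩
      · rw [himg1]
      · exact i.elim
    · rw [← himg1]
      exact subset_iUnion₂ (s := fun n (_ : CircleCell n) ↦ circleChar c n '' closedBall 0 1) 1
        PUnit.unit
  refine ⟨CWComplex.mkFinite (c '' Icc 0 1) CircleCell
    (fun n i ↦ (hmi n i).toPartialEquiv (circleChar c n) (ball 0 1)) hev hfin (fun _ _ ↦ rfl) hmc
    hsymm hpd hmt hun, CWComplex.finite_mkFinite _ _ _ _ _ _ _ _ _ _ _, ?_, ?_⟩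
  · rintro (_ | _ | n) hn
    · omega
    · omega
    · exact inferInstanceAs (IsEmpty PEmpty)
  · intro v
    have hends : ∀ b : Bool, ((PUnit.unit : CircleCell 1), b) ∈ @edgeEnds _ _ (c '' Icc 0 1)
        (CWComplex.mkFinite (c '' Icc 0 1) CircleCell
          (fun n i ↦ (hmi n i).toPartialEquiv (circleChar c n) (ball 0 1)) hev hfin
          (fun _ _ ↦ rfl) hmc hsymm hpd hmt hun) v := by
      intro b
      refine mapsTo_circleChar_sphere (y := fun _ ↦ if b then 1 else -1) h01 ?_
      rw [mem_sphere_zero_iff_norm, pi_norm_const]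
      cases b <;> simp
    have h2 : ({((PUnit.unit : CircleCell 1), true), ((PUnit.unit : CircleCell 1), false)} :
        Set (CircleCell 1 × Bool)).encard = 2 := encard_pair fun h ↦
      Bool.noConfusion (congrArg Prod.snd h)
    rw [← h2]
    refine encard_le_encard ?_
    rintro _ (rfl | rfl)
    · exact hends true
    · exact hends false

end Circle

/-- The image of an immersed loop contains an embedded circle, the image of a shortest arc whose
endpoints have the same image. -/
lemma exists_isCoreGraph_of_immersed_loop {X : Type*} [TopologicalSpace X] [T2Space X] {g : ℝ → X}
    (hg : Continuous g) (hi : IsLocallyInjective g) (hp : ∀ s, g (s + 1) = g s) :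
    ∃ K ⊆ range g, K.Nonempty ∧ IsCoreGraph K := by
  have hper : Function.Periodic g 1 := hp
  choose U hU hxU hUi using hi
  obtain ⟨ε, hε, hball⟩ := lebesgue_number_lemma_of_metric (isCompact_Icc (a := (0 : ℝ)) (b := 1))
    hU fun x _ ↦ mem_iUnion.2 ⟨x, hxU x⟩
  -- distinct parameters with the same image have distance at least `ε`, so the pairs of such
  -- parameters, given by the first one and the difference, form a compact set `S`
  have hsep : ∀ x ∈ Icc (0 : ℝ) 1, ∀ l, 0 < l → g x = g (x + l) → ε ≤ l := by
    intro x hx l hl h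
    by_contra! hlt
    obtain ⟨i, hi⟩ := hball x hx
    have h1 : x + l ∈ Metric.ball x ε := by
      rw [Metric.mem_ball, Real.dist_eq, add_sub_cancel_left, abs_of_pos hl]
      exact hlt
    have := hUi i (hi (Metric.mem_ball_self hε)) (hi h1) h
    linarith
  let S : Set (ℝ × ℝ) := (Icc 0 1 ×ˢ Icc ε 1) ∩ {p | g p.1 = g (p.1 + p.2)}
  have hS : IsCompact S := (isCompact_Icc.prod isCompact_Icc).inter_right
    (isClosed_eq (by fun_prop) (by fun_prop))
  have hne : S.Nonempty := ⟨(0, 1), ⟨⟨le_rfl, zero_le_one⟩,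
    hsep 0 ⟨le_rfl, zero_le_one⟩ 1 one_pos (hp 0).symm, le_rfl⟩, (hp 0).symm⟩
  obtain ⟨⟨a, l⟩, ⟨⟨ha, hl⟩, hal⟩, hmin⟩ := hS.exists_isMinOn hne continuous_snd.continuousOn
  have hl0 : 0 < l := hε.trans_le hl.1
  have key : ∀ x y, x < y → y - x < l → g x ≠ g y := by
    intro x y hxy hlt h
    have h1 : g (Int.fract x) = g (Int.fract x + (y - x)) := by
      have e1 := hper.sub_int_mul_eq (x := x) ⌊x⌋
      have e2 := hper.sub_int_mul_eq (x := y) ⌊x⌋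
      rw [mul_one] at e1 e2
      rw [Int.fract, e1, h, ← e2]
      congr 1
      ring
    have hf : Int.fract x ∈ Icc (0 : ℝ) 1 := ⟨Int.fract_nonneg _, (Int.fract_lt_one _).le⟩
    have h2 := hmin (show (Int.fract x, y - x) ∈ S from ⟨⟨hf, hsep _ hf _ (sub_pos.2 hxy) h1,
      hlt.le.trans hl.2⟩, h1⟩)
    exact absurd h2 (not_le.2 hlt)
  refine ⟨(fun t ↦ g (a + l * t)) '' Icc 0 1, ?_, ⟨_, ⟨0, ⟨le_rfl, zero_le_one⟩, rfl⟩⟩,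
    isCoreGraph_image (by fun_prop) ?_ ?_⟩
  · rintro _ ⟨t, -, rfl⟩
    exact mem_range_self _
  · have : g a = g (a + l) := hal
    simpa using this
  · intro t ht s hs h
    have hlt : ∀ t ∈ Ico (0 : ℝ) 1, ∀ s ∈ Ico (0 : ℝ) 1, t < s → g (a + l * t) ≠ g (a + l * s) := by
      intro t ht s hs hts
      refine key _ _ ?_ ?_
      · linarith [mul_lt_mul_of_pos_left hts hl0]
      · have : l * (s - t) < l * 1 := mul_lt_mul_of_pos_left (by linarith [ht.1, hs.2]) hl0
        linarith
    rcases lt_trichotomy t s with h1 | h1 | h1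
    · exact absurd h (hlt t ht s hs h1)
    · exact h1
    · exact absurd h.symm (hlt s hs t ht h1)

/-- The maximal core subgraph of a set is nonempty if and only if the set contains an immersed
loop. -/
theorem maximalCoreSubgraph_nonempty_iff {X : Type*} [TopologicalSpace X] [T2Space X] {A : Set X} :
    (maximalCoreSubgraph A).Nonempty ↔ ∃ g : ℝ → X, Continuous g ∧ IsLocallyInjective g ∧
      (∀ s, g (s + 1) = g s) ∧ ∀ s, g s ∈ A := by
  constructor
  · rintro ⟨x, K, ⟨hKA, hK⟩, hx⟩
    obtain ⟨g, h1, h2, h3, h4⟩ := hK.exists_immersed_loop ⟨x, hx⟩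
    exact ⟨g, h1, h2, h3, fun s ↦ hKA (h4 s)⟩
  · rintro ⟨g, h1, h2, h3, h4⟩
    obtain ⟨K, hKg, ⟨x, hx⟩, hK⟩ := exists_isCoreGraph_of_immersed_loop h1 h2 h3
    exact ⟨x, K, ⟨hKg.trans (range_subset_iff.2 h4), hK⟩, hx⟩

/-! ### The mapping torus -/

namespace MappingTorus

variable {Γ : Type*} [TopologicalSpace Γ] {f : Γ → Γ}

/-- The flow line of the mapping torus that starts at height `-1/2` over `x`; it crosses the edge
space at the integers, and is constant on `(-∞, -1/2]`. -/
noncomputable def ray (f : Γ → Γ) (x : Γ) (h : ℝ) : MappingTorus f :=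
  Quot.mk _ (f^[⌊h + 1 / 2⌋₊] x, projIcc (-(1 / 2)) (1 / 2) (by norm_num) (h - ⌊h + 1 / 2⌋₊))

/-- The inclusion of the edge space. -/
def inc (f : Γ → Γ) (x : Γ) : MappingTorus f := Quot.mk _ (x, ⟨0, by norm_num, by norm_num⟩)

lemma isQuotientMap_mk :
    IsQuotientMap (Y := MappingTorus f) (Quot.mk (MappingTorusRel f)) :=
  isQuotientMap_quot_mk

lemma mk_eq_mk (x : Γ) : (Quot.mk _ (x, ⟨1 / 2, by norm_num, le_rfl⟩) : MappingTorus f) =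
    Quot.mk _ (f x, ⟨-(1 / 2), le_rfl, by norm_num⟩) :=
  Quot.sound ⟨rfl, rfl, rfl⟩

lemma ray_of_mem (x : Γ) {h : ℝ} {n : ℕ} (h1 : n - 1 / 2 ≤ h) (h2 : h ≤ n + 1 / 2) :
    ray f x h = Quot.mk _ (f^[n] x, projIcc (-(1 / 2)) (1 / 2) (by norm_num) (h - n)) := by
  rcases h2.eq_or_lt with rfl | h2
  · have : ⌊(n : ℝ) + 1 / 2 + 1 / 2⌋₊ = n + 1 := by
      rw [add_assoc, add_halves]; exact_mod_cast Nat.floor_natCast (R := ℝ) (n + 1)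
    rw [ray, this, Function.iterate_succ_apply', projIcc_of_le_left _ (by push_cast; linarith),
      projIcc_of_right_le _ (by linarith)]
    exact (mk_eq_mk _).symm
  · have : ⌊h + 1 / 2⌋₊ = n := (Nat.floor_eq_iff (by linarith [n.cast_nonneg (α := ℝ)])).2
      ⟨by linarith, by linarith⟩
    rw [ray, this]

lemma ray_of_le (x : Γ) {h : ℝ} (hh : h ≤ 1 / 2) :
    ray f x h = Quot.mk _ (x, projIcc (-(1 / 2)) (1 / 2) (by norm_num) h) := by
  rcases le_total (-(1 / 2)) h with h1 | h1
  · rw [ray_of_mem (n := 0) x (by simpa using h1) (by simpa using hh)]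
    simp only [Function.iterate_zero, id, Nat.cast_zero, sub_zero]
    rfl
  · rw [ray, Nat.floor_eq_zero.2 (by linarith)]
    simp only [Function.iterate_zero, id, Nat.cast_zero, sub_zero]
    rfl

lemma mk_eq_ray (x : Γ) (t : Icc (-(1 / 2) : ℝ) (1 / 2)) :
    (Quot.mk _ (x, t) : MappingTorus f) = ray f x t := by
  rw [ray_of_le x t.2.2, projIcc_val]

lemma ray_natCast (x : Γ) (n : ℕ) : ray f x n = inc f (f^[n] x) := by
  rw [ray_of_mem (n := n) x (by linarith) (by linarith), inc, sub_self]
  congr 2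
  exact projIcc_of_mem _ _

lemma ray_add_one (x : Γ) {h : ℝ} (hh : -(1 / 2) ≤ h) : ray f x (h + 1) = ray f (f x) h := by
  have h1 := Nat.floor_le (a := h + 1 / 2) (by linarith)
  have h2 := Nat.lt_floor_add_one (h + 1 / 2)
  rw [ray_of_mem (n := ⌊h + 1 / 2⌋₊) (f x) (by linarith) (by linarith),
    ray_of_mem (n := ⌊h + 1 / 2⌋₊ + 1) x (by push_cast; linarith) (by push_cast; linarith),
    Function.iterate_succ_apply]
  congr 3
  push_cast
  ring

lemma continuous_ray (hf : Continuous f) : Continuous fun p : Γ × ℝ ↦ ray f p.1 p.2 := by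
  refine continuous_of_forall_Icc (h := fun p : Γ × ℝ ↦ p.2 + 1 / 2) (by fun_prop) fun n ↦ ?_
  have hmk : Continuous (Quot.mk (MappingTorusRel f)) := continuous_quot_mk
  refine ContinuousOn.congr (f := fun p : Γ × ℝ ↦ Quot.mk _ (f^[n.toNat] p.1,
    projIcc (-(1 / 2)) (1 / 2) (by norm_num) (p.2 - n.toNat))) ?_ ?_
  · have := hf.iterate n.toNat
    exact (hmk.comp ((this.comp continuous_fst).prodMk
      (continuous_projIcc.comp (by fun_prop)))).continuousOn
  · rintro ⟨x, h⟩ ⟨h1, h2⟩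
    rcases lt_or_ge n 0 with hn | hn
    · have : (n : ℝ) + 1 ≤ 0 := by exact_mod_cast hn
      simp only at h1 h2 ⊢
      rw [ray_of_le x (by linarith), Int.toNat_of_nonpos hn.le]
      simp
    · have : ((n.toNat : ℕ) : ℝ) = n := by exact_mod_cast Int.toNat_of_nonneg hn
      simp only at h1 h2 ⊢
      rw [ray_of_mem (n := n.toNat) x (by rw [this]; linarith) (by rw [this]; linarith)]

/-- The semiflow of the mapping torus; it is constant in time for negative times. -/
noncomputable def flow (f : Γ → Γ) (z : MappingTorus f) (r : ℝ) : MappingTorus f :=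
  Quot.lift (fun p ↦ ray f p.1 (p.2 + max r 0)) (by
    rintro ⟨x, t⟩ ⟨y, t'⟩ ⟨h1, h2, h3⟩
    simp only at h1 h2 h3 ⊢
    rw [h1, h2, h3, ← ray_add_one _ (by linarith [le_max_right r 0])]
    congr 1
    ring) z

lemma flow_ray (x : Γ) {h r : ℝ} (hh : -(1 / 2) ≤ h) (hr : 0 ≤ r) :
    flow f (ray f x h) r = ray f x (h + r) := by
  have key : ∀ n : ℕ, ∀ x : Γ, ∀ h : ℝ, -(1 / 2) ≤ h → h ≤ n + 1 / 2 →
      flow f (ray f x h) r = ray f x (h + r) := by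
    intro n
    induction n with
    | zero =>
      intro x h h1 h2
      rw [ray_of_le x (by simpa using h2), projIcc_of_mem _ ⟨h1, by simpa using h2⟩]
      change ray f x (h + max r 0) = _
      rw [max_eq_left hr]
    | succ n ih =>
      intro x h h1 h2
      rcases le_total h (n + 1 / 2) with h3 | h3
      · exact ih x h h1 h3
      · have e1 := ih (f x) (h - 1) (by linarith [n.cast_nonneg (α := ℝ)])
          (by push_cast at h2; linarith)
        rw [← ray_add_one _ (by linarith [n.cast_nonneg (α := ℝ)]),
          ← ray_add_one _ (by linarith [n.cast_nonneg (α := ℝ)])] at e1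
        rw [sub_add_cancel, sub_add_eq_add_sub, sub_add_cancel] at e1
        exact e1
  obtain ⟨n, hn⟩ := exists_nat_ge h
  exact key n x h hh (by linarith)

lemma exists_eq_ray (z : MappingTorus f) :
    ∃ x, ∃ t ∈ Icc (-(1 / 2) : ℝ) (1 / 2), z = ray f x t := by
  obtain ⟨⟨x, t⟩, rfl⟩ := Quot.exists_rep z
  exact ⟨x, t, t.2, mk_eq_ray x t⟩

lemma inc_eq_ray (x : Γ) : inc f x = ray f x 0 := by
  have := ray_natCast (f := f) x 0
  simpa using this.symm

lemma flow_zero (z : MappingTorus f) : flow f z 0 = z := by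
  obtain ⟨x, t, ht, rfl⟩ := exists_eq_ray z
  rw [flow_ray x ht.1 le_rfl, add_zero]

lemma flow_inc (x : Γ) (n : ℕ) : flow f (inc f x) n = inc f (f^[n] x) := by
  rw [inc_eq_ray, flow_ray x (by norm_num) n.cast_nonneg, zero_add, ray_natCast]

lemma continuous_flow (hf : Continuous f) :
    Continuous fun p : MappingTorus f × ℝ ↦ flow f p.1 p.2 := by
  refine isQuotientMap_mk.continuous_lift_prod_left ?_
  change Continuous fun p : (Γ × Icc (-(1 / 2) : ℝ) (1 / 2)) × ℝ ↦
    ray f p.1.1 ((p.1.2 : ℝ) + max p.2 0)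
  exact (continuous_ray hf).comp (by fun_prop :
    Continuous fun p : (Γ × Icc (-(1 / 2) : ℝ) (1 / 2)) × ℝ ↦ (p.1.1, (p.1.2 : ℝ) + max p.2 0))

lemma continuous_proj : Continuous (proj f) := by
  rw [isQuotientMap_mk.continuous_iff]
  change Continuous fun p : Γ × Icc (-(1 / 2) : ℝ) (1 / 2) ↦ ((p.2 : ℝ) : UnitAddCircle)
  exact (AddCircle.continuous_mk' 1).comp (by fun_prop)

lemma coe_intCast (n : ℤ) : ((n : ℝ) : UnitAddCircle) = 0 := by
  rw [AddCircle.coe_eq_zero_iff]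
  exact ⟨n, by simp⟩

lemma coe_eq_zero_iff {t : ℝ} : (t : UnitAddCircle) = 0 ↔ ∃ n : ℤ, (n : ℝ) = t := by
  rw [AddCircle.coe_eq_zero_iff]
  simp

lemma proj_ray (x : Γ) {h : ℝ} (hh : -(1 / 2) ≤ h) : proj f (ray f x h) = (h : UnitAddCircle) := by
  have h1 := Nat.floor_le (a := h + 1 / 2) (by linarith)
  have h2 := Nat.lt_floor_add_one (h + 1 / 2)
  rw [ray, projIcc_of_mem _ ⟨by linarith, by linarith⟩]
  change ((h - ⌊h + 1 / 2⌋₊ : ℝ) : UnitAddCircle) = h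
  rw [AddCircle.coe_sub]
  have := coe_intCast ⌊h + 1 / 2⌋₊
  rw [Int.cast_natCast] at this
  rw [this, sub_zero]

lemma proj_flow (z : MappingTorus f) {r : ℝ} (hr : 0 ≤ r) :
    proj f (flow f z r) = proj f z + (r : UnitAddCircle) := by
  obtain ⟨x, t, ht, rfl⟩ := exists_eq_ray z
  rw [flow_ray x ht.1 hr, proj_ray x ht.1, proj_ray x (by linarith [ht.1]), AddCircle.coe_add]

lemma range_inc : range (inc f) = edgeSpace f := by
  ext z
  constructor
  · rintro ⟨x, rfl⟩
    exact ⟨x, ⟨0, by norm_num, by norm_num⟩, rfl, rfl⟩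
  · rintro ⟨x, t, ht, rfl⟩
    exact ⟨x, by rw [inc]; congr 2; exact Subtype.ext ht.symm⟩

lemma mem_edgeSpace_iff {z : MappingTorus f} : z ∈ edgeSpace f ↔ proj f z = 0 := by
  constructor
  · rintro ⟨x, t, ht, rfl⟩
    change (t : UnitAddCircle) = 0
    rw [ht, AddCircle.coe_zero]
  · obtain ⟨⟨x, t⟩, rfl⟩ := Quot.exists_rep z
    intro h
    change ((t : ℝ) : UnitAddCircle) = 0 at h
    obtain ⟨n, hn⟩ := coe_eq_zero_iff.1 h
    refine ⟨x, t, ?_, rfl⟩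
    have h1 : ((-1 : ℤ) : ℝ) < n := by push_cast; linarith [t.2.1]
    have h2 : (n : ℝ) < ((1 : ℤ) : ℝ) := by push_cast; linarith [t.2.2]
    have : n = 0 := by
      have := Int.cast_lt.1 h1
      have := Int.cast_lt.1 h2
      omega
    rw [← hn, this, Int.cast_zero]

/-- The first coordinate on the open collar `Γ × (-1/2, 1/2)`. -/
noncomputable def collar (f : Γ → Γ) : MappingTorus f → Option Γ :=
  Quot.lift (fun p ↦ if |(p.2 : ℝ)| < 1 / 2 then some p.1 else none) (by
    rintro p q ⟨h1, h2, -⟩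
    rw [h1, h2, abs_neg, abs_of_pos (by norm_num), if_neg (lt_irrefl _), if_neg (lt_irrefl _)])

lemma collar_inc (x : Γ) : collar f (inc f x) = some x := by
  change (if |(0 : ℝ)| < 1 / 2 then some x else none) = some x
  norm_num

/-- The edge space has the topology of `Γ`. -/
lemma isEmbedding_inc : IsEmbedding (inc f) := by
  refine ⟨⟨le_antisymm ?_ ?_⟩, fun x y h ↦ by
    simpa [collar_inc] using congrArg (collar f) h⟩
  · exact continuous_iff_le_induced.1 (continuous_quot_mk.comp (by fun_prop))
  · intro U hU
    refine ⟨collar f ⁻¹' (some '' U), ?_, by ext x; simp [collar_inc]⟩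
    rw [← isQuotientMap_mk.isOpen_preimage]
    have h1 : IsOpen {p : Γ × Icc (-(1 / 2) : ℝ) (1 / 2) | |(p.2 : ℝ)| < 1 / 2} :=
      isOpen_lt (by fun_prop) continuous_const
    refine (congrArg IsOpen ?_).mpr ((hU.preimage continuous_fst).inter h1)
    ext ⟨x, t⟩
    change (if |(t : ℝ)| < 1 / 2 then some x else none) ∈ some '' U ↔ x ∈ U ∧ |(t : ℝ)| < 1 / 2
    split_ifs with h
    · simp only [mem_image, Option.some.injEq, exists_eq_right, h, and_true]
    · simp only [mem_image, reduceCtorEq, and_false, exists_false, h]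

lemma exists_eq_inc_comp {Y : Type*} [TopologicalSpace Y] {F : Y → MappingTorus f}
    (hF : Continuous F) (h : ∀ y, F y ∈ edgeSpace f) : ∃ G : C(Y, Γ), ∀ y, inc f (G y) = F y := by
  simp only [← range_inc, mem_range] at h
  choose G hG using h
  refine ⟨⟨G, ?_⟩, hG⟩
  rw [isEmbedding_inc (f := f) |>.continuous_iff]
  exact hF.congr fun y ↦ (hG y).symm

/-- A continuous family of points with heights `h ≤ N` can be pushed along the flow to the copy of
the edge space at height `N`. -/
lemma exists_push (hf : Continuous f) {Y : Type*} [TopologicalSpace Y] {F : Y → MappingTorus f}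
    (hF : Continuous F) {h : Y → ℝ} (hh : Continuous h)
    (hp : ∀ y, (h y : UnitAddCircle) = proj f (F y)) {N : ℤ} (hN : ∀ y, h y ≤ N) :
    ∃ G : C(Y, Γ), ∀ y, inc f (G y) = flow f (F y) (N - h y) := by
  refine exists_eq_inc_comp ((continuous_flow hf).comp (hF.prodMk (continuous_const.sub hh)))
    fun y ↦ ?_
  rw [mem_edgeSpace_iff]
  rw [proj_flow _ (sub_nonneg.2 (hN y)), ← hp, ← AddCircle.coe_add, add_sub_cancel, coe_intCast]

lemma normalCoordinate_eq {z : MappingTorus f} {t : ℝ} (ht : t ∈ Ico (-(1 / 2) : ℝ) (1 / 2))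
    (h : proj f z = (t : UnitAddCircle)) : normalCoordinate f z = t := by
  rw [normalCoordinate, h]
  exact AddCircle.equivIco_coe_of_mem ⟨ht.1, by linarith [ht.2]⟩

/-- Heights lift to the real numbers. -/
lemma exists_height {F : ℝ × ℝ → MappingTorus f} (hF : Continuous F) {x₀ : ℝ × ℝ} {h₀ : ℝ}
    (h : (h₀ : UnitAddCircle) = proj f (F x₀)) : ∃ k : C(ℝ × ℝ, ℝ), k x₀ = h₀ ∧
      ∀ x, (k x : UnitAddCircle) = proj f (F x) := by
  obtain ⟨k, hk, -⟩ := (AddCircle.isCoveringMap_coe (1 : ℝ)).existsUnique_continuousMap_lifts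
    ⟨_, continuous_proj.comp hF⟩ x₀ h₀ h
  exact ⟨k, hk.1, congrFun hk.2⟩

/-- Two lifts to `ℝ` of the same map on a connected set differ by an integer. -/
lemma eq_of_coe_eq {Y : Type*} [TopologicalSpace Y] {S : Set Y} (hS : IsPreconnected S)
    {h k : Y → ℝ} (hh : ContinuousOn h S) (hk : ContinuousOn k S)
    (heq : ∀ y ∈ S, (h y : UnitAddCircle) = k y) {x y : Y} (hx : x ∈ S) (hy : y ∈ S) :
    h x - k x = h y - k y := by
  have hd : ContinuousOn (fun y ↦ h y - k y) S := hh.sub hk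
  have : MapsTo (fun y ↦ h y - k y) S (range ((↑) : ℤ → ℝ)) := fun y hy ↦ by
    obtain ⟨n, hn⟩ := coe_eq_zero_iff.1
      (show ((h y - k y : ℝ) : UnitAddCircle) = 0 by rw [AddCircle.coe_sub, heq y hy, sub_self])
    exact ⟨n, hn⟩
  exact hS.constant_of_mapsTo Int.isClosedEmbedding_coe_real.isEmbedding.isDiscrete_range hd this
    hx hy

end MappingTorus

/-! ### Annuli from pairs of immersed loops -/

lemma isLocallyInjective_coe_addCircle : IsLocallyInjective ((↑) : ℝ → UnitAddCircle) :=
  (AddCircle.isCoveringMap_coe (1 : ℝ)).isLocalHomeomorph.isLocallyInjective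

lemma isLocallyInjective_of_comp_coe {Y : Type*} {F : UnitAddCircle → Y}
    (h : IsLocallyInjective fun s : ℝ ↦ F s) : IsLocallyInjective F := by
  intro x
  obtain ⟨s, rfl⟩ := QuotientAddGroup.mk_surjective x
  obtain ⟨U, hU, hs, hi⟩ := h s
  refine ⟨(fun s : ℝ ↦ (s : UnitAddCircle)) '' U, QuotientAddGroup.isOpenMap_coe U hU, ⟨s, hs, rfl⟩,
    ?_⟩
  rintro _ ⟨u, hu, rfl⟩ _ ⟨v, hv, rfl⟩ h
  exact congrArg _ (hi hu hv h)

lemma IsLocallyInjective.iterate {X : Type*} [TopologicalSpace X] {f : X → X} (hc : Continuous f)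
    (hi : IsLocallyInjective f) : ∀ n, IsLocallyInjective f^[n]
  | 0 => Function.injective_id.IsLocallyInjective
  | n + 1 => by
    rw [Function.iterate_succ]
    exact IsLocallyInjective.comp (IsLocallyInjective.iterate hc hi n) hc hi

namespace MappingTorus

variable {Γ : Type*} [TopologicalSpace Γ] {f : Γ → Γ}

/-- The lifted height of a homotopy rel endpoints of a path into the edge space. On three sides of
the square it is constant, and so the path has the same height at both ends. -/
lemma exists_height_homotopy {H : C(unitInterval × unitInterval, MappingTorus f)}
    {b : unitInterval → ℝ} (hb : Continuous b)
    (hbH : ∀ u, (b u : UnitAddCircle) = proj f (H (0, u)))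
    (h1 : ∀ u, H (1, u) ∈ edgeSpace f)
    (hr : ∀ r, H (r, 0) = H (0, 0) ∧ H (r, 1) = H (0, 1)) :
    ∃ k : C(unitInterval × unitInterval, ℝ), (∀ x, (k x : UnitAddCircle) = proj f (H x)) ∧
      (∀ u, k (0, u) = b u) ∧ (∀ u, k (1, u) = b 0) ∧ (∀ r, k (r, 0) = b 0) ∧
      ∀ r, k (r, 1) = b 0 := by
  let e : ℝ × ℝ → unitInterval × unitInterval :=
    fun x ↦ (projIcc 0 1 zero_le_one x.1, projIcc 0 1 zero_le_one x.2)
  have he : Continuous e := (continuous_projIcc.comp continuous_fst).prodMk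
    (continuous_projIcc.comp continuous_snd)
  have hev : ∀ x : unitInterval × unitInterval, e (x.1, x.2) = x := fun x ↦
    Prod.ext (projIcc_val zero_le_one _) (projIcc_val zero_le_one _)
  obtain ⟨k', hk0, hk'⟩ := exists_height (H.continuous.comp he) (x₀ := (0, 0)) (h₀ := b 0) (by
    rw [hbH, Function.comp_apply]
    congr 2
    exact (hev (0, 0)).symm)
  let k : C(unitInterval × unitInterval, ℝ) := ⟨fun x ↦ k' (x.1, x.2), by fun_prop⟩
  have hk : ∀ x, (k x : UnitAddCircle) = proj f (H x) := fun x ↦ by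
    refine (hk' (x.1, x.2)).trans ?_
    rw [Function.comp_apply, hev]
  have hk00 : k (0, 0) = b 0 := hk0
  have key : ∀ (g : unitInterval → unitInterval × unitInterval) (h : unitInterval → ℝ),
      Continuous g → Continuous h → (∀ u, (h u : UnitAddCircle) = k (g u)) →
      ∀ u v, k (g u) - h u = k (g v) - h v := fun g h hg hh heq u v ↦
    eq_of_coe_eq isPreconnected_univ (k.continuous.comp hg).continuousOn hh.continuousOn
      (fun u _ ↦ (heq u).symm) (mem_univ u) (mem_univ v)
  have hA : ∀ u, k (0, u) = b u := fun u ↦ by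
    have := key (fun u ↦ (0, u)) b (by fun_prop) hb (fun u ↦ by rw [hk, hbH]) u 0
    rw [hk00] at this
    linarith
  have hB : ∀ r, k (r, 0) = b 0 := fun r ↦ by
    have := key (fun r ↦ (r, 0)) (fun _ ↦ b 0) (by fun_prop) continuous_const
      (fun r ↦ by rw [hk, hbH, (hr r).1]) r 0
    rw [hk00] at this
    linarith
  have hC : ∀ u, k (1, u) = b 0 := fun u ↦ by
    have := key (fun u ↦ (1, u)) (fun _ ↦ 0) (by fun_prop) continuous_const
      (fun u ↦ by rw [hk, mem_edgeSpace_iff.1 (h1 u), AddCircle.coe_zero]) u 0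
    rw [hB 1] at this
    linarith
  refine ⟨k, hk, hA, hC, hB, fun r ↦ ?_⟩
  have := key (fun r ↦ (r, 1)) (fun _ ↦ b 1) (by fun_prop) continuous_const
    (fun r ↦ by rw [hk, hbH, (hr r).2]) r 1
  rw [hC 1] at this
  linarith

end MappingTorus

namespace Annulus

open MappingTorus

variable {Γ : Type*} [TopologicalSpace Γ] {f : Γ → Γ} {γ δ : ℝ → Γ} {m : ℕ}

/-- The trace height of the annulus built from two loops. -/
noncomputable def foldHeight (m : ℕ) (t : ℝ) : ℝ := if t ≤ 1 / 2 then t + m else m + 1 - t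

/-- The map on the universal cover `ℝ × [-m, m]` of the annulus that rises along the flow lines of
`γ` for `t ≤ 1/2` and descends along the flow lines of `δ` afterwards. -/
noncomputable def fold (f : Γ → Γ) (γ δ : ℝ → Γ) (m : ℕ) (s t : ℝ) : MappingTorus f :=
  if t ≤ 1 / 2 then ray f (γ s) (t + m) else ray f (δ s) (m + 1 - t)

lemma continuous_foldHeight : Continuous (foldHeight m) := by
  refine Continuous.if_le (by fun_prop) (by fun_prop) continuous_id continuous_const ?_
  intro t ht
  rw [ht]
  ring

lemma continuous_fold (hf : Continuous f) (hγ : Continuous γ) (hδ : Continuous δ)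
    (heq : ∀ s, f^[m + 1] (γ s) = f^[m + 1] (δ s)) :
    Continuous fun p : ℝ × ℝ ↦ fold f γ δ m p.1 p.2 := by
  have hr := continuous_ray hf
  refine Continuous.if_le (hr.comp (f := fun p : ℝ × ℝ ↦ (γ p.1, p.2 + (m : ℝ))) (by fun_prop))
    (hr.comp (f := fun p : ℝ × ℝ ↦ (δ p.1, (m : ℝ) + 1 - p.2)) (by fun_prop))
    continuous_snd continuous_const ?_
  rintro ⟨s, t⟩ ht
  simp only at ht
  subst ht
  simp only
  rw [ray_of_mem (n := m + 1) (γ s) (by push_cast; linarith) (by push_cast; linarith),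
    ray_of_mem (n := m + 1) (δ s) (by push_cast; linarith) (by push_cast; linarith), heq]
  congr 4
  ring

lemma proj_fold (s : ℝ) {t : ℝ} (ht : t ∈ Icc (-(m : ℝ)) m) :
    proj f (fold f γ δ m s t) = (foldHeight m t : UnitAddCircle) := by
  rw [fold, foldHeight]
  split_ifs with h
  · exact proj_ray _ (by linarith [ht.1])
  · exact proj_ray _ (by linarith [ht.2])

lemma fold_intCast_of_nonpos (s : ℝ) {i : ℤ} (hi : i ≤ 0) (him : -(m : ℤ) ≤ i) :
    fold f γ δ m s i = inc f (f^[(i + m).toNat] (γ s)) := by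
  have h0 : (i : ℝ) ≤ 0 := by exact_mod_cast hi
  have h1 : (((i + m).toNat : ℕ) : ℝ) = i + m := by
    exact_mod_cast Int.toNat_of_nonneg (by omega : 0 ≤ i + m)
  rw [fold, if_pos (by linarith), ← h1, ray_natCast]

lemma fold_intCast_of_pos (s : ℝ) {i : ℤ} (hi : 0 < i) (him : i ≤ m) :
    fold f γ δ m s i = inc f (f^[(m + 1 - i).toNat] (δ s)) := by
  have h0 : (1 : ℝ) ≤ i := by exact_mod_cast hi
  have h1 : (((m + 1 - i).toNat : ℕ) : ℝ) = m + 1 - i := by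
    exact_mod_cast Int.toNat_of_nonneg (by omega : 0 ≤ m + 1 - i)
  rw [fold, if_neg (by linarith), ← h1, ray_natCast]

lemma isLocallyInjective_fold (hf : Continuous f) (hi : IsLocallyInjective f) (hγ : Continuous γ)
    (hδ : Continuous δ) (hγi : IsLocallyInjective γ) (hδi : IsLocallyInjective δ) {i : ℤ}
    (him : (i : ℝ) ∈ Icc (-(m : ℝ)) m) : IsLocallyInjective fun s ↦ fold f γ δ m s i := by
  have h1 : -(m : ℤ) ≤ i := by exact_mod_cast him.1
  have h2 : i ≤ m := by exact_mod_cast him.2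
  rcases le_or_gt i 0 with h | h
  · simp only [fold_intCast_of_nonpos _ h h1]
    exact IsLocallyInjective.comp (g := inc f)
      (k := fun s ↦ f^[(i + m).toNat] (γ s)) isEmbedding_inc.injective.IsLocallyInjective
      ((hf.iterate _).comp hγ)
      (IsLocallyInjective.comp (hi.iterate hf _) hγ hγi)
  · simp only [fold_intCast_of_pos _ h h2]
    exact IsLocallyInjective.comp (g := inc f)
      (k := fun s ↦ f^[(m + 1 - i).toNat] (δ s)) isEmbedding_inc.injective.IsLocallyInjective
      ((hf.iterate _).comp hδ)
      (IsLocallyInjective.comp (hi.iterate hf _) hδ hδi)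

/-- Along a trace of a basepoint with distinct points at the two ends of the turn, no piece is
homotopic into the edge space: pieces that rise or descend have distinct heights at the ends, and
for the turn this is the injectivity of immersions on homotopy classes of paths. -/
lemma fold_trace_not_homotopic {T : Type*} [TopologicalSpace T] [T2Space T]
    (P : ForestCovering Γ T) (hf : Continuous f) (hi : IsLocallyInjective f)
    (heq : f^[m + 1] (γ 0) = f^[m + 1] (δ 0)) (hne : f^[m] (γ 0) ≠ f^[m] (δ 0))
    {i : ℤ} (him : -(m : ℤ) ≤ i) (him' : i + 1 ≤ m) :
    ¬ ∃ H : C(unitInterval × unitInterval, MappingTorus f),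
      (∀ u : unitInterval, H (0, u) = fold f γ δ m 0 (i + u)) ∧
      (∀ u : unitInterval, H (1, u) ∈ edgeSpace f) ∧
      (∀ r : unitInterval, H (r, 0) = fold f γ δ m 0 i ∧ H (r, 1) = fold f γ δ m 0 (i + 1)) := by
  rintro ⟨H, h0, h1, hr⟩
  have hi1 : -(m : ℝ) ≤ i := by exact_mod_cast him
  have hi2 : (i : ℝ) + 1 ≤ m := by exact_mod_cast him'
  let b : unitInterval → ℝ := fun u ↦ foldHeight m (i + u)
  have hmem : ∀ u : unitInterval, (i : ℝ) + u ∈ Icc (-(m : ℝ)) m := fun u ↦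
    ⟨by linarith [u.2.1], by linarith [u.2.2]⟩
  obtain ⟨k, hk, hk0, hk1, hkr0, hkr1⟩ := exists_height_homotopy (H := H) (b := b)
    (continuous_foldHeight.comp (by fun_prop)) (fun u ↦ by rw [h0, proj_fold _ (hmem u)])
    h1 (fun r ↦ by rw [(hr r).1, (hr r).2, (hr 0).1, (hr 0).2]; exact ⟨rfl, rfl⟩)
  have hb : foldHeight m (i + 1) = foldHeight m i := by
    have e1 := (hk0 1).symm.trans (hkr1 0)
    simpa [b] using e1
  -- the heights at the ends agree only for the turn
  have hi0 : i = 0 := by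
    rcases lt_trichotomy i 0 with h | h | h
    · have : (i : ℝ) + 1 ≤ 0 := by exact_mod_cast h
      rw [foldHeight, foldHeight, if_pos (by linarith), if_pos (by linarith)] at hb
      linarith
    · exact h
    · have : (1 : ℝ) ≤ i := by exact_mod_cast h
      rw [foldHeight, foldHeight, if_neg (by linarith), if_neg (by linarith)] at hb
      linarith
  subst hi0
  simp only [Int.cast_zero, zero_add] at h0 hr hi1 hi2
  have hb0 : b 0 = m := by simp [b, foldHeight]
  -- push the homotopy to a height `N` above all its points: the turn becomes a constant path, and
  -- the path `c` in the edge space becomes its image under a power of `f`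
  obtain ⟨B, hB⟩ := (isCompact_range k.continuous).bddAbove
  obtain ⟨N', hN'⟩ := exists_nat_ge (max B 0)
  set N := N' + (m + 1) with hN
  have hkN : ∀ x, k x ≤ ((N : ℤ) : ℝ) := fun x ↦ by
    have := hB (mem_range_self x)
    have := (le_max_left B 0).trans hN'
    rw [hN]
    push_cast
    linarith [m.cast_nonneg (α := ℝ)]
  obtain ⟨G, hG⟩ := exists_push hf H.continuous k.continuous hk hkN
  have hinj := (isEmbedding_inc (f := f)).injective
  have heqN : f^[N] (γ 0) = f^[N] (δ 0) := by
    rw [hN, Function.iterate_add_apply, heq, ← Function.iterate_add_apply]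
  have hmN : (m : ℝ) + 1 ≤ N := by rw [hN]; push_cast; linarith [N'.cast_nonneg (α := ℝ)]
  have hbot : ∀ u, G (0, u) = f^[N] (γ 0) := fun u ↦ by
    refine hinj ((hG _).trans ?_)
    rw [hk0, h0]
    simp only [b, Int.cast_zero, zero_add]
    have hu1 := u.2.1
    have hu2 := u.2.2
    rw [fold, foldHeight]
    split_ifs with h
    · rw [flow_ray _ (by linarith) (by push_cast; linarith), ← ray_natCast]
      congr 1
      push_cast
      ring
    · rw [flow_ray _ (by linarith) (by push_cast; linarith), heqN, ← ray_natCast]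
      congr 1
      push_cast
      ring
  obtain ⟨c, hc⟩ := exists_eq_inc_comp (F := fun u ↦ H (1, u)) (by fun_prop) h1
  have hNm : (((N : ℤ) : ℝ)) - m = ((N - m : ℕ) : ℝ) := by
    rw [Nat.cast_sub (by omega)]
    push_cast
    rfl
  have htop : ∀ u, G (1, u) = f^[N - m] (c u) := fun u ↦ by
    refine hinj ((hG _).trans ?_)
    rw [hk1, hb0, hNm, ← hc, flow_inc]
  have hside0 : ∀ r, G (r, 0) = f^[N] (γ 0) := fun r ↦ by
    rw [← hbot 0]
    refine hinj ?_
    rw [hG, hG, hkr0, hkr0, (hr r).1, (hr 0).1]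
  have hside1 : ∀ r, G (r, 1) = f^[N] (γ 0) := fun r ↦ by
    rw [← hbot 1]
    refine hinj ?_
    rw [hG, hG, hkr1, hkr1, (hr r).2, (hr 0).2]
  have hend := P.eq_of_comp_homotopicRel_const (F := ⟨f^[N - m], hf.iterate _⟩)
    (hi.iterate hf (N - m)) c (z := f^[N] (γ 0)) (by
      refine ContinuousMap.HomotopicRel.symm ⟨{
        toFun := G
        continuous_toFun := G.continuous
        map_zero_left := hbot
        map_one_left := htop
        prop' := ?_ }⟩
      rintro r _ (rfl | rfl)
      · exact hside0 r
      · exact hside1 r)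
  refine hne (hinj ?_)
  have e0 := hc 0
  have e1 := hc 1
  rw [(hr 1).1] at e0
  rw [(hr 1).2] at e1
  have e2 := fold_intCast_of_nonpos (f := f) (γ := γ) (δ := δ) (m := m) 0 (le_refl (0 : ℤ))
    (by omega)
  have hm1 : (1 : ℤ) ≤ m := by omega
  have e3 := fold_intCast_of_pos (f := f) (γ := γ) (δ := δ) (m := m) 0 (i := 1) one_pos hm1
  simp only [Int.cast_zero, Int.cast_one, zero_add, Int.toNat_natCast, add_sub_cancel_right]
    at e2 e3
  rw [← e2, ← e3, ← e0, ← e1, hend]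

/-- Two immersed loops whose images under `f^(m+1)` but not under `f^m` agree are the ends of a
tight strictly bidirectional annulus of length `2 m`. -/
theorem exists_of_immersed_loops {T : Type*} [TopologicalSpace T] [T2Space T]
    (P : ForestCovering Γ T) (hf : Continuous f) (hi : IsLocallyInjective f) (hm : 0 < m)
    (hγ : Continuous γ) (hδ : Continuous δ) (hγi : IsLocallyInjective γ)
    (hδi : IsLocallyInjective δ) (hγp : ∀ s, γ (s + 1) = γ s) (hδp : ∀ s, δ (s + 1) = δ s)
    (heq : ∀ s, f^[m + 1] (γ s) = f^[m + 1] (δ s)) (hne : f^[m] (γ 0) ≠ f^[m] (δ 0)) :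
    ∃ α : Annulus f m, α.IsTight ∧ α.IsStrictlyBidirectional := by
  have hper : ∀ t, Function.Periodic (fun s ↦ fold f γ δ m s t) 1 := fun t s ↦ by
    simp only [fold, hγp, hδp]
  let F : UnitAddCircle → ℝ → MappingTorus f := fun s t ↦ (hper t).lift s
  have hF : ∀ s t : ℝ, F s t = fold f γ δ m s t := fun s t ↦ (hper t).lift_coe s
  have hproj : ∀ (s : UnitAddCircle), ∀ t ∈ Icc (-(m : ℝ)) m,
      proj f (F s t) = (foldHeight m t : UnitAddCircle) := by
    intro s t ht
    obtain ⟨s, rfl⟩ := QuotientAddGroup.mk_surjective s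
    exact (congrArg (proj f) (hF s t)).trans (proj_fold s ht)
  have hpre : ∀ (s : UnitAddCircle), ∀ t ∈ Icc (-(m : ℝ)) m,
      (F s t ∈ edgeSpace f ↔ ∃ i : ℤ, (i : ℝ) = t) := by
    intro s t ht
    rw [mem_edgeSpace_iff, hproj s t ht, coe_eq_zero_iff, foldHeight]
    split_ifs
    · constructor
      · rintro ⟨n, hn⟩
        exact ⟨n - m, by push_cast; linarith⟩
      · rintro ⟨n, hn⟩
        exact ⟨n + m, by push_cast; linarith⟩
    · constructor
      · rintro ⟨n, hn⟩
        exact ⟨m + 1 - n, by push_cast; linarith⟩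
      · rintro ⟨n, hn⟩
        exact ⟨m + 1 - n, by push_cast; linarith⟩
  have hloc : ∀ i : ℤ, (i : ℝ) ∈ Icc (-(m : ℝ)) m → IsLocallyInjective fun s ↦ F s i :=
    fun i him ↦ isLocallyInjective_of_comp_coe (by
      simp only [hF]
      exact isLocallyInjective_fold hf hi hγ hδ hγi hδi him)
  refine ⟨{
    toFun := F
    pos := hm
    continuousOn := ?_
    transverse := ?_
    preimage_edgeSpace := hpre
    ring_locallyInjective := fun i him s _ ↦ ?_
    trace_not_homotopic := fun i him him' ↦ ?_ }, hloc, foldHeight m, ⟨?_, ?_⟩, ?_, ?_⟩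
  · refine Continuous.continuousOn ?_
    have hq : IsOpenQuotientMap (Prod.map ((↑) : ℝ → UnitAddCircle) (id : ℝ → ℝ)) :=
      QuotientAddGroup.isOpenQuotientMap_mk.prodMap .id
    rw [hq.isQuotientMap.continuous_iff]
    exact (continuous_fold hf hγ hδ heq).congr fun p ↦ (hF p.1 p.2).symm
  · intro s t ht hst
    obtain ⟨i, rfl⟩ := (hpre s t ht).1 hst
    have hV : Icc (-(m : ℝ)) m ∩ Ioo (i - 1 / 2 : ℝ) (i + 1 / 2) ∈
        𝓝[Icc (-(m : ℝ)) m] (i : ℝ) :=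
      Filter.inter_mem self_mem_nhdsWithin
        (mem_nhdsWithin_of_mem_nhds (Ioo_mem_nhds (by linarith) (by linarith)))
    refine ⟨univ, Filter.univ_mem, _, hV, ?_⟩
    rcases le_or_gt i 0 with h | h
    · have h0 : (i : ℝ) ≤ 0 := by exact_mod_cast h
      have hn : ∀ s' t', t' ∈ Icc (-(m : ℝ)) m ∩ Ioo (i - 1 / 2 : ℝ) (i + 1 / 2) →
          normalCoordinate f (F s' t') = t' - i := by
        rintro s' t' ⟨h1, h2⟩
        refine normalCoordinate_eq ⟨by linarith [h2.1], by linarith [h2.2]⟩ ?_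
        rw [hproj s' t' h1, foldHeight, if_pos (by linarith [h2.2]),
          show t' + (m : ℝ) = t' - i + ((i + m : ℤ) : ℝ) by push_cast; ring, AddCircle.coe_add,
          coe_intCast, add_zero]
      refine .inl fun s' _ t₁ h1 t₂ h2 h12 ↦ ?_
      simp only [hn s' t₁ h1, hn s' t₂ h2]
      linarith
    · have h0 : (1 : ℝ) ≤ i := by exact_mod_cast h
      have hn : ∀ s' t', t' ∈ Icc (-(m : ℝ)) m ∩ Ioo (i - 1 / 2 : ℝ) (i + 1 / 2) →
          normalCoordinate f (F s' t') = i - t' := by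
        rintro s' t' ⟨h1, h2⟩
        refine normalCoordinate_eq ⟨by linarith [h2.2], by linarith [h2.1]⟩ ?_
        rw [hproj s' t' h1, foldHeight, if_neg (by linarith [h2.1]),
          show (m : ℝ) + 1 - t' = i - t' + ((m + 1 - i : ℤ) : ℝ) by push_cast; ring,
          AddCircle.coe_add, coe_intCast, add_zero]
      refine .inr fun s' _ t₁ h1 t₂ h2 h12 ↦ ?_
      simp only [hn s' t₁ h1, hn s' t₂ h2]
      linarith
  · obtain ⟨U, hU, hs, hinj⟩ := hloc i him s
    exact ⟨U, hU.mem_nhds hs, hinj⟩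
  · have h0 : ∀ t, F 0 t = fold f γ δ m 0 t := fun t ↦ hF 0 t
    simp only [h0]
    exact fold_trace_not_homotopic P hf hi (heq 0) hne him him'
  · exact continuous_foldHeight.continuousOn
  · exact fun t ht ↦ (hproj 0 t ht).symm
  all_goals
    have hm1 : (1 : ℝ) ≤ m := by exact_mod_cast hm
    have e1 : foldHeight m m = 1 := by rw [foldHeight, if_neg (by linarith)]; ring
  · rw [e1, foldHeight, if_pos (by linarith)]
    ring
  · rw [e1, foldHeight, if_pos (by norm_num)]
    linarith

end Annulus

/-! ### The shape of a strictly bidirectional annulus -/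

/-- A sequence of levels `a` whose `n`-th step runs in `[j n, j n + 1]`, does not leave `j n + 1`
downwards to return to it, and crosses the intermediate levels, rises first and then descends. If it
has `2 m` steps and gains `1`, the turn is the step number `m`. -/
lemma levels_of_steps {m : ℕ} (hm : 0 < m) {a j : ℕ → ℤ}
    (h1 : ∀ n < 2 * m, a n = j n ∨ a n = j n + 1)
    (h2 : ∀ n < 2 * m, a (n + 1) = j n ∨ a (n + 1) = j n + 1)
    (h3 : ∀ n < 2 * m, ¬ (a n = j n + 1 ∧ a (n + 1) = j n + 1))
    (h4 : ∀ n, n + 1 < 2 * m → (a (n + 1) = j n + 1 ↔ a (n + 1) = j (n + 1)))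
    (h0 : a 0 = 0) (hend : a (2 * m) = 1) :
    (∀ n ≤ m, a n = n ∧ j n = n) ∧ ∀ n, m < n → n < 2 * m →
      a n = 2 * m + 1 - n ∧ j n = 2 * m - n := by
  have key : ∀ n < 2 * m, (∀ q ≤ n, a q = q ∧ j q = q) ∨
      (∃ p < n, (∀ q ≤ p, a q = q ∧ j q = q) ∧
        ∀ q, p < q → q ≤ n → a q = 2 * p + 1 - q ∧ j q = 2 * p - q) ∨
      ∀ q ≤ n, a q = -q ∧ j q = -q - 1 := by
    intro n
    induction n with
    | zero =>
      intro hn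
      rcases h1 0 hn with h | h
      · left
        rintro q hq
        obtain rfl : q = 0 := by omega
        constructor <;> push_cast <;> omega
      · right; right
        rintro q hq
        obtain rfl : q = 0 := by omega
        constructor <;> push_cast <;> omega
    | succ n ih =>
      intro hn
      have e1 := h1 (n + 1) hn
      have e2 := h2 n (by omega)
      have e3 := h3 n (by omega)
      have e4 := h4 n hn
      rcases ih (by omega) with h | ⟨p, hp, hpl, hpr⟩ | h
      · have en := h n le_rfl
        rcases e2 with e2 | e2
        · right; left
          refine ⟨n, by omega, h, fun q hq hq' ↦ ?_⟩
          obtain rfl : q = n + 1 := by omega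
          constructor <;> push_cast <;> omega
        · left
          intro q hq
          rcases Nat.lt_or_ge n q with hq' | hq'
          · obtain rfl : q = n + 1 := by omega
            constructor <;> push_cast <;> omega
          · exact h q hq'
      · right; left
        refine ⟨p, by omega, hpl, fun q hq hq' ↦ ?_⟩
        have en := hpr n hp le_rfl
        rcases Nat.lt_or_ge n q with hq'' | hq''
        · obtain rfl : q = n + 1 := by omega
          constructor <;> push_cast <;> omega
        · exact hpr q hq hq''
      · right; right
        intro q hq
        have en := h n le_rfl
        rcases Nat.lt_or_ge n q with hq'' | hq''
        · obtain rfl : q = n + 1 := by omega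
          constructor <;> push_cast <;> omega
        · exact h q hq''
  have e2 := h2 (2 * m - 1) (by omega)
  have e3 := h3 (2 * m - 1) (by omega)
  rw [show 2 * m - 1 + 1 = 2 * m by omega, hend] at e2 e3
  rcases key (2 * m - 1) (by omega) with h | ⟨p, hp, hpl, hpr⟩ | h
  · have en := h (2 * m - 1) le_rfl
    obtain rfl : m = 1 := by omega
    exact ⟨fun n hn ↦ h n (by omega), fun n hn hn' ↦ by omega⟩
  · have en := hpr (2 * m - 1) hp le_rfl
    obtain rfl : p = m := by omega
    exact ⟨hpl, fun n hn hn' ↦ hpr n hn (by omega)⟩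
  · have en := h (2 * m - 1) le_rfl
    omega

namespace Annulus

open MappingTorus

variable {Γ : Type*} [TopologicalSpace Γ] {f : Γ → Γ} {m : ℕ} (α : Annulus f m)

lemma continuous_toFun_comp {Y : Type*} [TopologicalSpace Y] {s t : Y → ℝ} (hs : Continuous s)
    (ht : Continuous t) (h : ∀ y, t y ∈ Icc (-(m : ℝ)) m) :
    Continuous fun y ↦ α.toFun (s y) (t y) :=
  α.continuousOn.comp_continuous (f := fun y ↦ ((s y : UnitAddCircle), t y))
    (((AddCircle.continuous_mk' 1).comp hs).prodMk ht) fun y ↦ ⟨mem_univ _, h y⟩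

/-- A lift to the universal cover of the height of the points of an annulus. -/
def IsHeight (k : C(ℝ × ℝ, ℝ)) : Prop :=
  ∀ s t : ℝ, t ∈ Icc (-(m : ℝ)) m → (k (s, t) : UnitAddCircle) = proj f (α.toFun s t)

lemma exists_isHeight : ∃ k, α.IsHeight k ∧ k (0, -(m : ℝ)) = 0 := by
  have hm : -(m : ℝ) ≤ m := by linarith [m.cast_nonneg (α := ℝ)]
  have hc : Continuous fun x : ℝ × ℝ ↦ α.toFun x.1 (projIcc (-(m : ℝ)) m hm x.2) :=
    α.continuous_toFun_comp continuous_fst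
      (continuous_subtype_val.comp (continuous_projIcc.comp continuous_snd)) fun x ↦ Subtype.prop _
  obtain ⟨k, hk0, hk⟩ := exists_height hc (x₀ := (0, -(m : ℝ))) (h₀ := 0) (by
    refine (mem_edgeSpace_iff.1 ((α.preimage_edgeSpace _ _ (Subtype.prop _)).2 ⟨-m, ?_⟩)).symm
    rw [projIcc_left]
    push_cast
    rfl)
  exact ⟨k, fun s t ht ↦ by rw [hk, projIcc_of_mem hm ht], hk0⟩

variable {α} {k : C(ℝ × ℝ, ℝ)}

lemma IsHeight.exists_eq_intCast_iff (hk : α.IsHeight k) {s t : ℝ} (ht : t ∈ Icc (-(m : ℝ)) m) :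
    (∃ n : ℤ, (n : ℝ) = k (s, t)) ↔ ∃ i : ℤ, (i : ℝ) = t := by
  rw [← α.preimage_edgeSpace s t ht, mem_edgeSpace_iff, ← hk s t ht, coe_eq_zero_iff]

/-- Every ring has a constant height. -/
lemma IsHeight.eq_of_intCast (hk : α.IsHeight k) {i : ℤ} (hi : (i : ℝ) ∈ Icc (-(m : ℝ)) m)
    (s s' : ℝ) : k (s, i) = k (s', i) := by
  have := eq_of_coe_eq (h := fun s ↦ k (s, i)) (k := fun _ ↦ 0) isPreconnected_univ
    (by fun_prop) continuousOn_const (fun s _ ↦ by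
      rw [AddCircle.coe_zero, coe_eq_zero_iff, hk.exists_eq_intCast_iff hi]
      exact ⟨i, rfl⟩) (mem_univ s) (mem_univ s')
  simpa using this

lemma IsHeight.add_one (hk : α.IsHeight k) (s : ℝ) {t : ℝ} (ht : t ∈ Icc (-(m : ℝ)) m) :
    k (s + 1, t) = k (s, t) := by
  have h0 : ((0 : ℤ) : ℝ) ∈ Icc (-(m : ℝ)) m := by simp
  have := eq_of_coe_eq (S := univ ×ˢ Icc (-(m : ℝ)) m) (h := fun p : ℝ × ℝ ↦ k (p.1 + 1, p.2))
    (k := k) (isPreconnected_univ.prod isPreconnected_Icc) (by fun_prop) k.continuous.continuousOn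
    (fun p hp ↦ by
      rw [hk _ _ hp.2, hk p.1 p.2 hp.2, AddCircle.coe_add_period])
    (x := (s, t)) ⟨mem_univ _, ht⟩ (y := (0, (0 : ℤ))) ⟨mem_univ _, h0⟩
  rw [hk.eq_of_intCast h0 _ 0, sub_self] at this
  exact sub_eq_zero.1 this

/-- Between two consecutive rings the height stays between two consecutive integers. -/
lemma IsHeight.exists_step (hk : α.IsHeight k) {i : ℤ} (hi : -(m : ℤ) ≤ i) (hi' : i + 1 ≤ m) :
    ∃ j : ℤ, ∀ s, (∀ t ∈ Ioo (i : ℝ) (i + 1), k (s, t) ∈ Ioo (j : ℝ) (j + 1)) ∧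
      ∀ t ∈ Icc (i : ℝ) (i + 1), k (s, t) ∈ Icc (j : ℝ) (j + 1) := by
  have hi1 : -(m : ℝ) ≤ i := by exact_mod_cast hi
  have hi2 : (i : ℝ) + 1 ≤ m := by exact_mod_cast hi'
  let Ω : Set (ℝ × ℝ) := univ ×ˢ Ioo (i : ℝ) (i + 1)
  -- heights are not integers off the rings
  have hint : ∀ p ∈ Ω, ∀ n : ℤ, (n : ℝ) ≠ k p := by
    rintro ⟨s, t⟩ ⟨-, ht⟩ n hn
    obtain ⟨l, hl⟩ := (hk.exists_eq_intCast_iff (s := s)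
      ⟨by linarith [ht.1], by linarith [ht.2]⟩).1 ⟨n, hn⟩
    simp only [← hl] at ht
    have h1 : i < l := by exact_mod_cast ht.1
    have h2 : l < i + 1 := by exact_mod_cast ht.2
    omega
  have hord : (k '' Ω).OrdConnected :=
    ((isPreconnected_univ.prod isPreconnected_Ioo).image k k.continuous.continuousOn).ordConnected
  have hp₀ : ((0 : ℝ), (i : ℝ) + 1 / 2) ∈ Ω := ⟨mem_univ _, by constructor <;> linarith⟩
  set j := ⌊k (0, (i : ℝ) + 1 / 2)⌋ with hj
  have h1 := Int.floor_le (k (0, (i : ℝ) + 1 / 2))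
  have h2 := Int.lt_floor_add_one (k (0, (i : ℝ) + 1 / 2))
  rw [← hj] at h1 h2
  have hopen : ∀ p ∈ Ω, k p ∈ Ioo (j : ℝ) (j + 1) := by
    intro p hp
    constructor
    · by_contra! h
      obtain ⟨q, hq, hqe⟩ := hord.out ⟨p, hp, rfl⟩ ⟨_, hp₀, rfl⟩ ⟨h, h1⟩
      exact hint q hq j hqe.symm
    · by_contra! h
      obtain ⟨q, hq, hqe⟩ := hord.out ⟨_, hp₀, rfl⟩ ⟨p, hp, rfl⟩ ⟨h2.le, h⟩
      exact hint q hq (j + 1) (by push_cast; exact hqe.symm)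
  refine ⟨j, fun s ↦ ⟨fun t ht ↦ hopen (s, t) ⟨mem_univ _, ht⟩, fun t ht ↦ ?_⟩⟩
  have hcl : closure (Ioo (i : ℝ) (i + 1)) ⊆ (fun t ↦ k (s, t)) ⁻¹' Icc (j : ℝ) (j + 1) :=
    closure_minimal (fun t ht ↦ Ioo_subset_Icc_self (hopen (s, t) ⟨mem_univ _, ht⟩))
      (isClosed_Icc.preimage (by fun_prop))
  rw [closure_Ioo (by linarith)] at hcl
  exact hcl ht

/-- No piece of the trace of the basepoint leaves a level downwards and returns to it: such a piece
would be pushed into the edge space by the semiflow. -/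
lemma IsHeight.not_turn_below (hf : Continuous f) (hk : α.IsHeight k) {i j : ℤ}
    (hi : -(m : ℤ) ≤ i) (hi' : i + 1 ≤ m)
    (hj : ∀ t ∈ Icc (i : ℝ) (i + 1), k (0, t) ∈ Icc (j : ℝ) (j + 1)) :
    ¬ (k (0, i) = j + 1 ∧ k (0, i + 1) = j + 1) := by
  rintro ⟨h0, h1⟩
  have hi1 : -(m : ℝ) ≤ i := by exact_mod_cast hi
  have hi2 : (i : ℝ) + 1 ≤ m := by exact_mod_cast hi'
  have hmem : ∀ u : unitInterval, (i : ℝ) + u ∈ Icc (-(m : ℝ)) m := fun u ↦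
    ⟨by linarith [u.2.1], by linarith [u.2.2]⟩
  have hmem' : ∀ u : unitInterval, (i : ℝ) + u ∈ Icc (i : ℝ) (i + 1) := fun u ↦
    ⟨by linarith [u.2.1], by linarith [u.2.2]⟩
  have hA : Continuous fun x : unitInterval × unitInterval ↦ α.toFun (0 : ℝ) (i + x.2) :=
    α.continuous_toFun_comp (s := fun _ ↦ 0) continuous_const (by fun_prop) fun x ↦ hmem x.2
  refine α.trace_not_homotopic i hi hi' ⟨⟨fun x ↦ flow f (α.toFun (0 : ℝ) (i + x.2))
    (x.1 * (j + 1 - k (0, i + x.2))), (continuous_flow hf).comp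
      (hA.prodMk (by fun_prop))⟩, fun u ↦ ?_, fun u ↦ ?_, fun r ↦ ⟨?_, ?_⟩⟩
  · simp [flow_zero]
  · rw [mem_edgeSpace_iff]
    simp only [ContinuousMap.coe_mk, Icc.coe_one, one_mul]
    rw [proj_flow _ (by linarith [(hj _ (hmem' u)).2]), ← hk 0 _ (hmem u), ← AddCircle.coe_add,
      add_sub_cancel]
    exact_mod_cast coe_intCast (j + 1)
  · simp [h0, flow_zero]
  · simp [h1, flow_zero]

/-- At an interior ring the trace of the basepoint passes from one side to the other. -/
lemma IsHeight.crossing (hk : α.IsHeight k) {i : ℤ} (hi : -(m : ℤ) < i) (hi' : i < m) {a b : ℤ}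
    (ha : ∀ t ∈ Ioo ((i : ℝ) - 1) i, k (0, t) ∈ Ioo (a : ℝ) (a + 1))
    (hb : ∀ t ∈ Ioo (i : ℝ) (i + 1), k (0, t) ∈ Ioo (b : ℝ) (b + 1))
    (ha' : k (0, i) ∈ Icc (a : ℝ) (a + 1)) (hb' : k (0, i) ∈ Icc (b : ℝ) (b + 1)) :
    k (0, i) = a + 1 ↔ k (0, i) = b := by
  have hi1 : -(m : ℝ) < i := by exact_mod_cast hi
  have hi2 : (i : ℝ) < m := by exact_mod_cast hi'
  have him : (i : ℝ) ∈ Icc (-(m : ℝ)) m := ⟨hi1.le, hi2.le⟩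
  obtain ⟨n, hn⟩ := (hk.exists_eq_intCast_iff (s := 0) him).2 ⟨i, rfl⟩
  obtain ⟨U, hU, V, hV, hUV⟩ := α.transverse (0 : ℝ) i him
    ((α.preimage_edgeSpace (0 : ℝ) i him).2 ⟨i, rfl⟩)
  have h0U := mem_of_mem_nhds hU
  have hS : Icc (-(m : ℝ)) m ∈ 𝓝 (i : ℝ) := Icc_mem_nhds hi1 hi2
  rw [nhdsWithin_eq_nhds.2 hS] at hV
  have hW : {t | |k (0, t) - n| < 1 / 2} ∈ 𝓝 (i : ℝ) := by
    refine (isOpen_lt (by fun_prop) continuous_const).mem_nhds ?_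
    simp [hn]
  obtain ⟨ε, hε, hball⟩ := Metric.mem_nhds_iff.1 (Filter.inter_mem (Filter.inter_mem hS hV) hW)
  obtain ⟨r, hr, hrε, hr1⟩ : ∃ r > 0, r < ε ∧ r < 1 :=
    ⟨min ε 1 / 2, by positivity, by linarith [min_le_left ε 1], by linarith [min_le_right ε 1]⟩
  have hmem : ∀ t : ℝ, |t - i| < ε →
      t ∈ V ∧ normalCoordinate f (α.toFun (0 : ℝ) t) = k (0, t) - n := by
    intro t ht
    obtain ⟨⟨h1, h2⟩, h3⟩ := hball (by rwa [Metric.mem_ball, Real.dist_eq] : t ∈ Metric.ball _ _)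
    have h4 := abs_lt.1 (show |k (0, t) - n| < 1 / 2 from h3)
    refine ⟨h2, normalCoordinate_eq ⟨h4.1.le, h4.2⟩ ?_⟩
    rw [← hk 0 t h1, AddCircle.coe_sub, coe_intCast, sub_zero]
  obtain ⟨v0, e0⟩ := hmem i (by simpa using hε)
  obtain ⟨v1, e1⟩ := hmem (i - r) (by rw [abs_lt]; constructor <;> linarith)
  obtain ⟨v2, e2⟩ := hmem (i + r) (by rw [abs_lt]; constructor <;> linarith)
  have k1 := ha (i - r) ⟨by linarith, by linarith⟩
  have k2 := hb (i + r) ⟨by linarith, by linarith⟩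
  rw [← hn] at ha' hb' e0 ⊢
  have za : a ≤ n ∧ n ≤ a + 1 := ⟨by exact_mod_cast ha'.1, by exact_mod_cast ha'.2⟩
  have zb : b ≤ n ∧ n ≤ b + 1 := ⟨by exact_mod_cast hb'.1, by exact_mod_cast hb'.2⟩
  have goal : n = a + 1 ↔ n = b := by
    rcases hUV with h | h
    · have h1 := h 0 h0U v1 v0 (by linarith)
      have h2 := h 0 h0U v0 v2 (by linarith)
      simp only [AddCircle.coe_zero] at e0 e1 e2
      simp only [e0, e1, e2] at h1 h2
      have z1 : (a : ℝ) < n := by linarith [k1.1]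
      have z2 : (n : ℝ) < (b + 1 : ℤ) := by push_cast; linarith [k2.2]
      have z1 := Int.cast_lt.1 z1
      have z2 := Int.cast_lt.1 z2
      omega
    · have h1 := h 0 h0U v1 v0 (by linarith)
      have h2 := h 0 h0U v0 v2 (by linarith)
      simp only [AddCircle.coe_zero] at e0 e1 e2
      simp only [e0, e1, e2] at h1 h2
      have z1 : (n : ℝ) < (a + 1 : ℤ) := by push_cast; linarith [k1.2]
      have z2 : (b : ℝ) < n := by linarith [k2.1]
      have z1 := Int.cast_lt.1 z1
      have z2 := Int.cast_lt.1 z2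
      omega
  exact_mod_cast goal

/-- The heights of a strictly bidirectional annulus: `m` pieces of the trace rise, then there is
one turn, and `m - 1` pieces descend. -/
theorem exists_height_bounds (hf : Continuous f) (hα : α.IsStrictlyBidirectional) :
    ∃ k : C(ℝ × ℝ, ℝ), α.IsHeight k ∧ (∀ s, k (s, -(m : ℝ)) = 0) ∧ (∀ s, k (s, 0) = m) ∧
      (∀ s, k (s, 1) = m) ∧ (∀ s, k (s, m) = 1) ∧
      (∀ s, ∀ t ∈ Icc (-(m : ℝ)) 0, k (s, t) ≤ m) ∧
      (∀ s, ∀ t ∈ Icc (0 : ℝ) 1, k (s, t) ≤ m + 1) ∧ ∀ s, ∀ t ∈ Icc (1 : ℝ) m, k (s, t) ≤ m := by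
  have hm := α.pos
  have hm1 : (1 : ℝ) ≤ m := by exact_mod_cast hm
  obtain ⟨k, hk, hk0⟩ := α.exists_isHeight
  obtain ⟨β, ⟨hβc, hβ⟩, hβe, -⟩ := hα
  have hkm : k (0, (m : ℝ)) = 1 := by
    have := eq_of_coe_eq (h := fun t ↦ k (0, t)) (k := β) isPreconnected_Icc (by fun_prop) hβc
      (fun t ht ↦ by rw [hβ t ht]; exact hk 0 t ht) (x := (m : ℝ)) (y := -(m : ℝ))
      ⟨by linarith, le_rfl⟩ ⟨le_rfl, by linarith⟩
    linarith
  -- the heights between the rings number `n` and `n + 1` lie between `j n` and `j n + 1`, and ring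
  -- number `n` has height `a n`
  have hstep : ∀ n : ℕ, ∃ j : ℤ, n < 2 * m → ∀ s,
      (∀ t ∈ Ioo (-(m : ℝ) + n) (-(m : ℝ) + n + 1), k (s, t) ∈ Ioo (j : ℝ) (j + 1)) ∧
      ∀ t ∈ Icc (-(m : ℝ) + n) (-(m : ℝ) + n + 1), k (s, t) ∈ Icc (j : ℝ) (j + 1) := by
    intro n
    by_cases hn : n < 2 * m
    · obtain ⟨j, hj⟩ := hk.exists_step (i := -m + n) (by omega) (by omega)
      push_cast at hj
      exact ⟨j, fun _ ↦ hj⟩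
    · exact ⟨0, fun h ↦ absurd h hn⟩
  choose j hj using hstep
  have hlev : ∀ n : ℕ, ∃ a : ℤ, n ≤ 2 * m → ∀ s, k (s, -(m : ℝ) + n) = a := by
    intro n
    by_cases hn : n ≤ 2 * m
    · have hn' : (n : ℝ) ≤ 2 * m := by exact_mod_cast hn
      have hmem : ((-m + n : ℤ) : ℝ) ∈ Icc (-(m : ℝ)) m := by
        push_cast
        constructor <;> linarith [n.cast_nonneg (α := ℝ)]
      obtain ⟨a, ha⟩ := (hk.exists_eq_intCast_iff (s := 0) hmem).2 ⟨_, rfl⟩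
      refine ⟨a, fun _ s ↦ ?_⟩
      rw [ha, ← hk.eq_of_intCast hmem s]
      push_cast
      rfl
    · exact ⟨0, fun h ↦ absurd h hn⟩
  choose a ha using hlev
  have hends : ∀ n : ℕ, n < 2 * m → ((a n : ℝ) ∈ Icc (j n : ℝ) (j n + 1)) ∧
      ((a (n + 1) : ℝ) ∈ Icc (j n : ℝ) (j n + 1)) := by
    intro n hn
    have e1 := (hj n hn 0).2 (-(m : ℝ) + n) ⟨le_rfl, by linarith⟩
    have e2 := (hj n hn 0).2 (-(m : ℝ) + n + 1) ⟨by linarith, le_rfl⟩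
    rw [ha n hn.le] at e1
    have e3 := ha (n + 1) hn 0
    push_cast at e3
    rw [add_assoc, e3] at e2
    exact ⟨e1, e2⟩
  have hcast : ∀ n : ℕ, n < 2 * m → (a n = j n ∨ a n = j n + 1) ∧
      (a (n + 1) = j n ∨ a (n + 1) = j n + 1) := by
    intro n hn
    obtain ⟨⟨h1, h2⟩, h3, h4⟩ := hends n hn
    have h1 : j n ≤ a n := by exact_mod_cast h1
    have h2 : a n ≤ j n + 1 := by exact_mod_cast h2
    have h3 : j n ≤ a (n + 1) := by exact_mod_cast h3
    have h4 : a (n + 1) ≤ j n + 1 := by exact_mod_cast h4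
    omega
  have ha0 : a 0 = 0 := by
    have := ha 0 (by omega) 0
    rw [Nat.cast_zero, add_zero, hk0] at this
    exact_mod_cast this.symm
  have ham : a (2 * m) = 1 := by
    have := ha (2 * m) le_rfl 0
    push_cast at this
    rw [show -(m : ℝ) + 2 * m = m by ring, hkm] at this
    exact_mod_cast this.symm
  have hturn : ∀ n < 2 * m, ¬ (a n = j n + 1 ∧ a (n + 1) = j n + 1) := by
    intro n hn
    rintro ⟨h1, h2⟩
    refine hk.not_turn_below hf (i := -m + n) (j := j n) (by omega) (by omega) ?_ ⟨?_, ?_⟩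
    · push_cast
      exact (hj n hn 0).2
    · push_cast
      rw [ha n hn.le, h1]
      push_cast
      rfl
    · have := ha (n + 1) hn 0
      push_cast at this ⊢
      rw [add_assoc, this, h2]
      push_cast
      rfl
  have hcross : ∀ n, n + 1 < 2 * m → (a (n + 1) = j n + 1 ↔ a (n + 1) = j (n + 1)) := by
    intro n hn
    have e := ha (n + 1) hn.le 0
    have := hk.crossing (i := -m + (n + 1)) (by omega) (by omega) (a := j n) (b := j (n + 1))
      (by
        push_cast
        rw [← add_assoc, add_sub_cancel_right]
        exact (hj n (by omega) 0).1)
      (by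
        have := (hj (n + 1) hn 0).1
        push_cast at this ⊢
        exact this)
      (by
        push_cast at e ⊢
        rw [e]
        exact (hends n (by omega)).2)
      (by
        push_cast at e ⊢
        rw [e]
        exact (hends (n + 1) hn).1)
    push_cast at e this
    rw [e] at this
    exact_mod_cast this
  obtain ⟨hl, hr⟩ := levels_of_steps hm (fun n hn ↦ (hcast n hn).1) (fun n hn ↦ (hcast n hn).2)
    hturn hcross ha0 ham
  have hbound : ∀ n : ℕ, n < 2 * m → ∀ s, ∀ t ∈ Icc (-(m : ℝ) + n) (-(m : ℝ) + n + 1),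
      k (s, t) ≤ j n + 1 := fun n hn s t ht ↦ ((hj n hn s).2 t ht).2
  have hone : ∀ s, k (s, 1) = m := fun s ↦ by
    have := ha (m + 1) (by omega) s
    have e : a (m + 1) = m := by
      rcases Nat.lt_or_ge (m + 1) (2 * m) with h | h
      · have := (hr (m + 1) (by omega) h).1
        push_cast at this
        omega
      · have : m + 1 = 2 * m := by omega
        rw [this, ham]
        omega
    rw [e] at this
    push_cast at this
    rwa [neg_add_cancel_left] at this
  have hlast : ∀ s, k (s, (m : ℝ)) = 1 := fun s ↦ by
    have := ha (2 * m) le_rfl s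
    rw [ham] at this
    push_cast at this
    rwa [show -(m : ℝ) + 2 * m = m by ring] at this
  refine ⟨k, hk, fun s ↦ ?_, fun s ↦ ?_, hone, hlast, fun s t ht ↦ ?_, fun s t ht ↦ ?_,
    fun s t ht ↦ ?_⟩
  · simpa [ha0] using ha 0 (by omega) s
  · have := ha m (by omega) s
    rw [(hl m le_rfl).1, neg_add_cancel] at this
    exact_mod_cast this
  · obtain ⟨n, hn, hnt⟩ : ∃ n < m, t ∈ Icc (-(m : ℝ) + n) (-(m : ℝ) + n + 1) := by
      rcases ht.2.eq_or_lt with h | h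
      · refine ⟨m - 1, by omega, ?_⟩
        rw [Nat.cast_sub hm]
        push_cast
        constructor <;> linarith
      · have h1 := Nat.floor_le (a := t + m) (by linarith [ht.1])
        have h2 := Nat.lt_floor_add_one (t + m)
        exact ⟨⌊t + m⌋₊, by rw [Nat.floor_lt (by linarith [ht.1])]; linarith, by linarith,
          by linarith⟩
    have h1 := hbound n (by omega) s t hnt
    rw [(hl n hn.le).2] at h1
    have h2 : (n : ℝ) + 1 ≤ m := by exact_mod_cast hn
    push_cast at h1
    linarith
  · have h1 := hbound m (by omega) s t (by rwa [neg_add_cancel, zero_add])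
    rw [(hl m le_rfl).2] at h1
    exact_mod_cast h1
  · rcases ht.1.eq_or_lt with h | h
    · rw [← h, hone]
    rcases ht.2.eq_or_lt with h' | h'
    · rw [h', hlast]
      exact hm1
    have h1 := Nat.floor_le (a := t + m) (by linarith)
    have h2 := Nat.lt_floor_add_one (t + m)
    have hn1 : m < ⌊t + m⌋₊ := by
      refine Nat.lt_of_succ_le (Nat.le_floor ?_)
      push_cast
      linarith
    have hn2 : ⌊t + m⌋₊ < 2 * m := by
      rw [Nat.floor_lt (by linarith)]
      push_cast
      linarith
    have h3 := hbound _ hn2 s t ⟨by linarith, by linarith⟩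
    rw [(hr _ hn1 hn2).2] at h3
    have h4 : (m : ℝ) + 1 ≤ ⌊t + m⌋₊ := by exact_mod_cast hn1
    push_cast at h3
    linarith

end Annulus

/-! ### Immersed loops from annuli -/

/-- The bottom of a homotopy between two paths is homotopic to the path around the other three
sides of the square. -/
lemma Path.homotopic_of_square {Y : Type*} [TopologicalSpace Y] {a a' b b' : Y}
    (H : C(unitInterval × unitInterval, Y)) {l : Path a a'} {r : Path b b'} {top : Path a' b'}
    {bot : Path a b} (hl : ∀ t, H (t, 0) = l t) (hr : ∀ t, H (t, 1) = r t)
    (htop : ∀ u, H (1, u) = top u) (hbot : ∀ u, H (0, u) = bot u) :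
    bot.Homotopic ((l.trans top).trans r.symm) := by
  obtain rfl : H (0, 0) = a := by rw [hl, l.source]
  obtain rfl : H (0, 1) = b := by rw [hr, r.source]
  obtain rfl : H (1, 0) = a' := by rw [hl, l.target]
  obtain rfl : H (1, 1) = b' := by rw [hr, r.target]
  let pl : Path ((0, 0) : unitInterval × unitInterval) (1, 0) :=
    ⟨⟨fun t ↦ (t, 0), by fun_prop⟩, rfl, rfl⟩
  let pr : Path ((0, 1) : unitInterval × unitInterval) (1, 1) :=
    ⟨⟨fun t ↦ (t, 1), by fun_prop⟩, rfl, rfl⟩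
  let pt : Path ((1, 0) : unitInterval × unitInterval) (1, 1) :=
    ⟨⟨fun t ↦ (1, t), by fun_prop⟩, rfl, rfl⟩
  let pb : Path ((0, 0) : unitInterval × unitInterval) (0, 1) :=
    ⟨⟨fun t ↦ (0, t), by fun_prop⟩, rfl, rfl⟩
  have el : l = pl.map H.continuous := by ext t; exact (hl t).symm
  have er : r = pr.map H.continuous := by ext t; exact (hr t).symm
  have et : top = pt.map H.continuous := by ext t; exact (htop t).symm
  have eb : bot = pb.map H.continuous := by ext t; exact (hbot t).symm
  have : ContractibleSpace unitInterval := (convex_Icc (0 : ℝ) 1).contractibleSpace ⟨0, by simp⟩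
  have h : pb.Homotopic ((pl.trans pt).trans pr.symm) := SimplyConnectedSpace.paths_homotopic _ _
  have := h.map H
  rw [Path.map_trans, Path.map_trans] at this
  rw [el, er, et, eb]
  exact this

namespace Annulus

open MappingTorus

variable {Γ : Type*} [TopologicalSpace Γ] {f : Γ → Γ} {m : ℕ} {α : Annulus f m} {k : C(ℝ × ℝ, ℝ)}

/-- The rings of a tight annulus as immersed loops. -/
lemma IsTight.exists_ring (hα : α.IsTight) {i : ℤ} (hi : (i : ℝ) ∈ Icc (-(m : ℝ)) m) :
    ∃ ρ : ℝ → Γ, Continuous ρ ∧ IsLocallyInjective ρ ∧ (∀ s, ρ (s + 1) = ρ s) ∧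
      ∀ s : ℝ, inc f (ρ s) = α.toFun s i := by
  obtain ⟨ρ, hρ⟩ := exists_eq_inc_comp (F := fun s : ℝ ↦ α.toFun s i)
    (α.continuous_toFun_comp continuous_id continuous_const fun _ ↦ hi)
    fun s ↦ (α.preimage_edgeSpace s i hi).2 ⟨i, rfl⟩
  refine ⟨ρ, ρ.continuous, .of_comp (g := inc f) ?_, fun s ↦ ?_, hρ⟩
  · have : inc f ∘ ρ = (fun s ↦ α.toFun s i) ∘ ((↑) : ℝ → UnitAddCircle) := funext hρ
    rw [this]
    exact IsLocallyInjective.comp (hα i hi) (AddCircle.continuous_mk' 1)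
      isLocallyInjective_coe_addCircle
  · refine (isEmbedding_inc (f := f)).injective ?_
    rw [hρ, hρ, AddCircle.coe_add_period]

/-- The part of an annulus of height at most `N` can be pushed to the copy of the edge space at
height `N`. -/
lemma IsHeight.exists_push (hf : Continuous f) (hk : α.IsHeight k) {c d : ℝ} (hcd : c ≤ d)
    (hc : -(m : ℝ) ≤ c) (hd : d ≤ m) {N : ℕ} (hN : ∀ s, ∀ t ∈ Icc c d, k (s, t) ≤ N) :
    ∃ G : C(ℝ × ℝ, Γ), (∀ s t, G (s + 1, t) = G (s, t)) ∧ ∀ s : ℝ, ∀ t ∈ Icc c d,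
      inc f (G (s, t)) = flow f (α.toFun s t) (N - k (s, t)) := by
  have hmem : ∀ t, (projIcc c d hcd t : ℝ) ∈ Icc (-(m : ℝ)) m := fun t ↦
    ⟨hc.trans (projIcc c d hcd t).2.1, (projIcc c d hcd t).2.2.trans hd⟩
  have hp : Continuous fun x : ℝ × ℝ ↦ (projIcc c d hcd x.2 : ℝ) :=
    continuous_subtype_val.comp (continuous_projIcc.comp continuous_snd)
  obtain ⟨G, hG⟩ := MappingTorus.exists_push hf (N := N)
    (α.continuous_toFun_comp continuous_fst hp fun x ↦ hmem x.2)
    (h := fun x : ℝ × ℝ ↦ k (x.1, projIcc c d hcd x.2)) (by fun_prop)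
    (fun x ↦ hk x.1 _ (hmem x.2))
    (fun x ↦ (hN x.1 _ (Subtype.prop _)).trans_eq (Int.cast_natCast N).symm)
  refine ⟨G, fun s t ↦ (isEmbedding_inc (f := f)).injective ?_, fun s t ht ↦ ?_⟩
  · rw [hG, hG]
    simp only
    rw [hk.add_one s (hmem t), AddCircle.coe_add_period]
  · rw [hG]
    simp only
    rw [projIcc_of_mem hcd ht]
    rfl

/-- Pushing a ring of height `l` to height `N` applies `f^(N - l)`. -/
lemma eq_iterate_of_push {G : C(ℝ × ℝ, Γ)} {ρ : ℝ → Γ} {s t : ℝ} {N n l : ℕ}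
    (hG : inc f (G (s, t)) = flow f (α.toFun s t) (N - k (s, t)))
    (hρ : inc f (ρ s) = α.toFun s t) (hkl : k (s, t) = l) (hn : n + l = N) :
    G (s, t) = f^[n] (ρ s) := by
  refine (isEmbedding_inc (f := f)).injective ?_
  rw [hG, ← hρ, hkl, ← hn, ← flow_inc]
  push_cast
  rw [add_sub_cancel_right]

/-- The two rings next to the turn of the trace, identified along the homotopy between their
images under `f`, nowhere agree: otherwise they agree everywhere, and the turn is homotopic into
the second one. -/
lemma ring_ne_ring (hf : Continuous f) (hi : IsLocallyInjective f) [T2Space Γ]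
    (hk0 : ∀ s, k (s, 0) = m) (hk1 : ∀ s, k (s, 1) = m)
    {ρ₀ ρ₁ : ℝ → Γ} (hρ₀ : Continuous ρ₀) (hρ₁ : Continuous ρ₁)
    (h₀ : ∀ s : ℝ, inc f (ρ₀ s) = α.toFun s 0) (h₁ : ∀ s : ℝ, inc f (ρ₁ s) = α.toFun s 1)
    {G : C(ℝ × ℝ, Γ)} (hG : ∀ s : ℝ, ∀ t ∈ Icc (0 : ℝ) 1,
      inc f (G (s, t)) = flow f (α.toFun s t) ((m + 1 : ℕ) - k (s, t)))
    {φ : ℝ → ℝ} (hφ : Continuous φ) (hφG : ∀ s, G (s, 0) = G (φ s, 1))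
    (hhom : ∀ s x (p : Path (s, (0 : ℝ)) x) (p' : Path (φ s, (1 : ℝ)) x),
      (G.comp p.toContinuousMap).HomotopicRel (G.comp p'.toContinuousMap) {0, 1}) (s : ℝ) :
    ρ₀ s ≠ ρ₁ (φ s) := by
  have hm1 : (1 : ℝ) ≤ m := by exact_mod_cast α.pos
  have hG0 : ∀ s, G (s, 0) = f (ρ₀ s) := fun s ↦ by
    have := eq_iterate_of_push (n := 1) (hG s 0 ⟨le_rfl, zero_le_one⟩) (h₀ s) (hk0 s) (by ring)
    simpa using this
  have hG1 : ∀ s, G (s, 1) = f (ρ₁ s) := fun s ↦ by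
    have := eq_iterate_of_push (n := 1) (hG s 1 ⟨zero_le_one, le_rfl⟩) (h₁ s) (hk1 s) (by ring)
    simpa using this
  intro hs
  -- the two sides have the same image under `f`, so the set where they agree is open and closed
  have hall : {s | ρ₀ s = ρ₁ (φ s)} = univ := by
    refine IsClopen.eq_univ ⟨isClosed_eq hρ₀ (hρ₁.comp hφ), ?_⟩ ⟨s, hs⟩
    rw [isOpen_iff_mem_nhds]
    intro s hs
    obtain ⟨U, hU, hsU, hinj⟩ := hi (ρ₀ s)
    filter_upwards [(hU.preimage hρ₀).mem_nhds hsU, (hU.preimage (hρ₁.comp hφ)).mem_nhds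
      (show ρ₁ (φ s) ∈ U from (show ρ₀ s = _ from hs) ▸ hsU)] with s' h1 h2
    exact hinj h1 h2 (by rw [← hG0, hφG, hG1])
  have h00 : ρ₀ 0 = ρ₁ (φ 0) := by
    have := mem_univ (0 : ℝ)
    rwa [← hall] at this
  have hmem : ∀ u : unitInterval, (u : ℝ) ∈ Icc (-(m : ℝ)) m := fun u ↦
    ⟨by linarith [u.2.1], by linarith [u.2.2]⟩
  have hinc : Continuous (inc f) := isEmbedding_inc.continuous
  have hfl := continuous_flow hf
  have hray (x : MappingTorus f) : Continuous fun t : unitInterval ↦ flow f x t :=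
    hfl.comp (f := fun t : unitInterval ↦ (x, (t : ℝ)))
      (continuous_const.prodMk continuous_subtype_val)
  -- the parameters of the path in the second ring into which the turn is deformed
  let κ : unitInterval → ℝ := fun u ↦ (1 - u) * φ 0
  have hκ : Continuous κ := by fun_prop
  have hκ0 : κ 0 = φ 0 := by simp [κ]
  have hκ1 : κ 1 = 0 := by simp [κ]
  let l : Path (inc f (ρ₀ 0)) (inc f (f (ρ₀ 0))) := ⟨⟨fun t ↦ flow f (inc f (ρ₀ 0)) t,
    hray _⟩, by
      simp [flow_zero], by
      simpa using flow_inc (f := f) (ρ₀ 0) 1⟩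
  let r : Path (inc f (ρ₁ 0)) (inc f (f (ρ₁ 0))) := ⟨⟨fun t ↦ flow f (inc f (ρ₁ 0)) t,
    hray _⟩, by
      simp [flow_zero], by
      simpa using flow_inc (f := f) (ρ₁ 0) 1⟩
  let bot : Path (inc f (ρ₀ 0)) (inc f (ρ₁ 0)) := ⟨⟨fun u ↦ α.toFun (0 : ℝ) u,
    α.continuous_toFun_comp (s := fun _ ↦ 0) continuous_const continuous_subtype_val hmem⟩,
    (h₀ 0).symm, (h₁ 0).symm⟩
  let bot' : Path (inc f (ρ₀ 0)) (inc f (ρ₁ 0)) := ⟨⟨fun u ↦ inc f (ρ₁ (κ u)),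
    hinc.comp (hρ₁.comp hκ)⟩, by simp only [hκ0, h00], by simp only [hκ1]⟩
  let top : Path (inc f (f (ρ₀ 0))) (inc f (f (ρ₁ 0))) := ⟨⟨fun u ↦ inc f (G (0, u)),
    by fun_prop⟩, by simp [hG0], by simp [hG1]⟩
  let top' : Path (inc f (f (ρ₀ 0))) (inc f (f (ρ₁ 0))) := ⟨⟨fun u ↦ inc f (G (κ u, 1)),
    by fun_prop⟩, by simp only [hκ0, hG1, h00], by simp only [hκ1, hG1]⟩
  have htops : top.Homotopic top' := by
    let p : Path ((0 : ℝ), (0 : ℝ)) (0, 1) := ⟨⟨fun u ↦ (0, u), by fun_prop⟩, rfl, rfl⟩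
    let p' : Path (φ 0, (1 : ℝ)) (0, 1) := ⟨⟨fun u ↦ (κ u, 1), by fun_prop⟩,
      by simp only [hκ0], by simp only [hκ1]⟩
    obtain ⟨H⟩ := hhom 0 (0, 1) p p'
    exact ⟨H.compContinuousMap ⟨inc f, hinc⟩⟩
  have htrace : Continuous fun x : unitInterval × unitInterval ↦ α.toFun (0 : ℝ) x.2 :=
    α.continuous_toFun_comp (s := fun _ ↦ 0)
      (t := fun x : unitInterval × unitInterval ↦ (x.2 : ℝ)) continuous_const (by fun_prop)
      fun x ↦ hmem x.2
  have hpush : Continuous fun x : unitInterval × unitInterval ↦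
      (x.1 : ℝ) * ((m + 1 : ℕ) - k (0, (x.2 : ℝ))) := by fun_prop
  -- the turn, and its deformation `bot'` into the edge space, are pushed to homotopic paths `top`
  -- and `top'` along the same flow lines `l` and `r` at the ends
  have hbot := Path.homotopic_of_square (l := l) (r := r) (top := top) (bot := bot)
    ⟨fun x ↦ flow f (α.toFun (0 : ℝ) x.2) (x.1 * ((m + 1 : ℕ) - k (0, (x.2 : ℝ)))),
      hfl.comp (htrace.prodMk hpush)⟩
    (fun t ↦ by simp [l, hk0, h₀]) (fun t ↦ by simp [r, hk1, h₁])
    (fun u ↦ by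
      refine Eq.trans ?_ (hG 0 u u.2).symm
      simp) (fun u ↦ by simp [bot, flow_zero])
  have hbot' := Path.homotopic_of_square (l := l) (r := r) (top := top') (bot := bot')
    ⟨fun x ↦ flow f (inc f (ρ₁ (κ x.2))) x.1, hfl.comp
      ((hinc.comp (hρ₁.comp (hκ.comp continuous_snd))).prodMk (by fun_prop))⟩
    (fun t ↦ by simp [l, hκ0, h00]) (fun t ↦ by simp [r, hκ1])
    (fun u ↦ by
      refine Eq.trans ?_ (congrArg (inc f) (hG1 (κ u)).symm)
      simpa using flow_inc (f := f) (ρ₁ (κ u)) 1) (fun u ↦ by simp [bot', flow_zero])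
  have hhom' : bot.Homotopic bot' := hbot.trans
    ((((Path.Homotopic.refl l).hcomp htops).hcomp (Path.Homotopic.refl r.symm)).trans hbot'.symm)
  obtain ⟨H⟩ := hhom'
  have hmz : -(m : ℤ) ≤ 0 := by omega
  have hmz' : (0 : ℤ) + 1 ≤ m := by have := α.pos; omega
  refine α.trace_not_homotopic 0 hmz hmz' ⟨H.toContinuousMap, fun u ↦ ?_, fun u ↦ ?_,
    fun t ↦ ⟨?_, ?_⟩⟩
  · rw [Int.cast_zero, zero_add]
    exact H.apply_zero u
  · rw [← range_inc]
    exact ⟨ρ₁ (κ u), (H.apply_one u).symm⟩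
  · rw [Int.cast_zero]
    exact (H.source t).trans (h₀ 0)
  · rw [Int.cast_zero, zero_add]
    exact (H.target t).trans (h₁ 0)

/-- A tight strictly bidirectional annulus of length `2 m` gives an immersed loop in the
complement of `Γ_{m-1}` in `Γ_m`, formed by its two boundary rings. The first of them is moved on by
`f`, since the trace starts one level lower than it ends. -/
theorem exists_immersed_loop {T : Type*} [TopologicalSpace T] [T2Space Γ] (P : ForestCovering Γ T)
    (hf : Continuous f) (hi : IsLocallyInjective f) (hα : α.IsTight)
    (hs : α.IsStrictlyBidirectional) : ∃ g : ℝ → Γ × Γ, Continuous g ∧ IsLocallyInjective g ∧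
      (∀ s, g (s + 1) = g s) ∧ ∀ s, g s ∈ iteratePullback f m \ iteratePullback f (m - 1) := by
  have hm := α.pos
  have hm1 : (1 : ℝ) ≤ m := by exact_mod_cast hm
  obtain ⟨k, hk, ka, k0, k1, kb, hb0, hb1, hb2⟩ := exists_height_bounds hf hs
  obtain ⟨ρa, ca, ia, pa, ha⟩ := hα.exists_ring (i := -m) (by push_cast; constructor <;> linarith)
  obtain ⟨ρ₀, c0, i0, p0, h0⟩ := hα.exists_ring (i := 0) (by push_cast; constructor <;> linarith)
  obtain ⟨ρ₁, c1, i1, p1, h1⟩ := hα.exists_ring (i := 1) (by push_cast; constructor <;> linarith)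
  obtain ⟨ρb, cb, ib, pb, hb⟩ := hα.exists_ring (i := m) (by push_cast; constructor <;> linarith)
  push_cast at ha h0 h1 hb
  obtain ⟨G₀, per₀, hG₀⟩ := hk.exists_push hf (c := -m) (d := 0) (by linarith) le_rfl
    (by linarith) hb0
  obtain ⟨G₁, per₁, hG₁⟩ := hk.exists_push hf (c := 0) (d := 1) (N := m + 1) zero_le_one
    (by linarith) hm1 (by exact_mod_cast hb1)
  obtain ⟨G₂, per₂, hG₂⟩ := hk.exists_push hf (c := 1) (d := m) hm1 (by linarith) le_rfl hb2
  have e0a : ∀ s, G₀ (s, -(m : ℝ)) = f^[m] (ρa s) := fun s ↦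
    eq_iterate_of_push (l := 0) (hG₀ s _ ⟨le_rfl, by linarith⟩) (ha s)
      ((ka s).trans Nat.cast_zero.symm) (by omega)
  have e00 : ∀ s, G₀ (s, 0) = f^[0] (ρ₀ s) := fun s ↦
    eq_iterate_of_push (hG₀ s _ ⟨by linarith, le_rfl⟩) (h0 s) (k0 s) (by omega)
  have e10 : ∀ s, G₁ (s, 0) = f^[1] (ρ₀ s) := fun s ↦
    eq_iterate_of_push (hG₁ s _ ⟨le_rfl, zero_le_one⟩) (h0 s) (k0 s) (by omega)
  have e11 : ∀ s, G₁ (s, 1) = f^[1] (ρ₁ s) := fun s ↦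
    eq_iterate_of_push (hG₁ s _ ⟨zero_le_one, le_rfl⟩) (h1 s) (k1 s) (by omega)
  have e21 : ∀ s, G₂ (s, 1) = f^[0] (ρ₁ s) := fun s ↦
    eq_iterate_of_push (hG₂ s _ ⟨le_rfl, hm1⟩) (h1 s) (k1 s) (by omega)
  have e2b : ∀ s, G₂ (s, (m : ℝ)) = f^[m - 1] (ρb s) := fun s ↦
    eq_iterate_of_push (l := 1) (hG₂ s _ ⟨hm1, le_rfl⟩) (hb s)
      ((kb s).trans Nat.cast_one.symm) (by omega)
  have hloc : ∀ n {ρ : ℝ → Γ}, Continuous ρ → IsLocallyInjective ρ →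
      IsLocallyInjective fun s ↦ f^[n] (ρ s) := fun n ρ hc hρ ↦
    IsLocallyInjective.comp (hi.iterate hf n) hc hρ
  -- consecutive pushed rings are homotopic immersed loops, hence agree up to reparametrization
  obtain ⟨φ₀, cφ₀, -, pφ₀, eφ₀, -⟩ := P.exists_reparametrization_of_homotopy G₀ per₀
    (a := -(m : ℝ)) (b := 0) (by simp only [e0a]; exact hloc _ ca ia)
    (by simp only [e00]; exact hloc _ c0 i0)
  obtain ⟨φ₁, cφ₁, -, pφ₁, eφ₁, hhom⟩ := P.exists_reparametrization_of_homotopy G₁ per₁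
    (a := 0) (b := 1) (by simp only [e10]; exact hloc _ c0 i0)
    (by simp only [e11]; exact hloc _ c1 i1)
  obtain ⟨φ₂, cφ₂, -, pφ₂, eφ₂, -⟩ := P.exists_reparametrization_of_homotopy G₂ per₂
    (a := 1) (b := m) (by simp only [e21]; exact hloc _ c1 i1)
    (by simp only [e2b]; exact hloc _ cb ib)
  have hne := ring_ne_ring hf hi k0 k1 c0 c1 h0 h1 hG₁ cφ₁ eφ₁ hhom
  simp only [e0a, e00, e10, e11, e21, e2b, Function.iterate_zero, Function.iterate_one, id]
    at eφ₀ eφ₁ eφ₂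
  refine ⟨fun s ↦ (f (ρa s), ρb (φ₂ (φ₁ (φ₀ s)))), by fun_prop, ?_, fun s ↦ ?_, fun s ↦ ⟨?_, ?_⟩⟩
  · exact IsLocallyInjective.of_comp (g := Prod.fst) (hloc 1 ca ia)
  · simp only [pa, pφ₀, pφ₁, pφ₂, pb]
  · change f^[m] (f (ρa s)) = f^[m] (ρb (φ₂ (φ₁ (φ₀ s))))
    obtain ⟨n, rfl⟩ := Nat.exists_eq_succ_of_ne_zero hm.ne'
    rw [Nat.succ_sub_one] at eφ₂
    rw [Function.iterate_succ_apply' f n (ρb _), ← eφ₂, ← eφ₁, ← eφ₀,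
      ← Function.iterate_succ_apply, Function.iterate_succ_apply' f (n + 1)]
  · change f^[m - 1] (f (ρa s)) ≠ f^[m - 1] (ρb (φ₂ (φ₁ (φ₀ s))))
    rw [← eφ₂, ← Function.iterate_succ_apply, Nat.succ_eq_add_one, Nat.sub_add_cancel hm, eφ₀]
    exact hne _

end Annulus

/-! ### The equivalence -/

/-- The coordinates of an immersed loop in the pullback of `f^n` with itself are immersed loops: as
`f^n` is an immersion, each coordinate determines the other one locally. -/
lemma isLocallyInjective_of_prod {Γ : Type*} [TopologicalSpace Γ] {f : Γ → Γ} (hf : Continuous f)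
    (hi : IsLocallyInjective f) {g : ℝ → Γ × Γ} (hg : Continuous g) (hgi : IsLocallyInjective g)
    {n : ℕ} (h : ∀ s, f^[n] (g s).1 = f^[n] (g s).2) :
    IsLocallyInjective (fun s ↦ (g s).1) ∧ IsLocallyInjective (fun s ↦ (g s).2) := by
  constructor
  · intro s
    obtain ⟨U, hU, hsU, hinj⟩ := hgi s
    obtain ⟨W, hW, hsW, hinj'⟩ := hi.iterate hf n (g s).2
    refine ⟨U ∩ (fun s ↦ (g s).2) ⁻¹' W, hU.inter (hW.preimage (by fun_prop)), ⟨hsU, hsW⟩, ?_⟩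
    intro x hx y hy hxy
    exact hinj hx.1 hy.1 (Prod.ext hxy (hinj' hx.2 hy.2 (by
      rw [← h, ← h]; exact congrArg f^[n] hxy)))
  · intro s
    obtain ⟨U, hU, hsU, hinj⟩ := hgi s
    obtain ⟨W, hW, hsW, hinj'⟩ := hi.iterate hf n (g s).1
    refine ⟨U ∩ (fun s ↦ (g s).1) ⁻¹' W, hU.inter (hW.preimage (by fun_prop)), ⟨hsU, hsW⟩, ?_⟩
    intro x hx y hy hxy
    exact hinj hx.1 hy.1 (Prod.ext (hinj' hx.2 hy.2 (by
      rw [h, h]; exact congrArg f^[n] hxy)) hxy)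

theorem mainTheorem6 {Γ : Type*} [TopologicalSpace Γ] [T2Space Γ] [ConnectedSpace Γ]
    [CWComplex (univ : Set Γ)] [RelCWComplex.Finite (univ : Set Γ)]
    (hdim : IsOneDimensional (univ : Set Γ))
    (hcore : ∀ v : RelCWComplex.cell (univ : Set Γ) 0, 2 ≤ valency univ v)
    (f : Γ → Γ) (hcont : Continuous f) (himm : IsLocallyInjective f)
    (hvert : (∀ v : RelCWComplex.cell (univ : Set Γ) 0, 3 ≤ valency univ v) ∨
      MapsTo f (range (vertexPoint (univ : Set Γ))) (range (vertexPoint (univ : Set Γ)))) :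
    (∃ L : ℕ, 1 ≤ L ∧ pullbackCore f L = ∅) ↔
      ∃ L : ℕ, ∀ (m : ℕ) (α : Annulus f m),
        α.IsTight → α.IsStrictlyBidirectional → α.length ≤ 2 * L := by
  obtain ⟨T, _, _, ⟨P⟩⟩ := exists_forestCovering Γ hdim
  constructor
  · rintro ⟨L, hL, hempty⟩
    refine ⟨L, fun m α hα hs ↦ ?_⟩
    by_contra! hlt
    have hLm : L ≤ m := by rw [Annulus.length] at hlt; omega
    obtain ⟨g, hg, hgi, hgp, hgm⟩ := Annulus.exists_immersed_loop P hcont himm hα hs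
    have hloc := (isLocallyInjective_of_prod hcont himm hg hgi fun s ↦ (hgm s).1).1
    -- `f × f` maps the complement of `Γ_{i-1}` in `Γ_i` to the one for `i - 1`
    have : (maximalCoreSubgraph (iteratePullback f L \ iteratePullback f (L - 1))).Nonempty := by
      have hF := hcont.iterate (m - L)
      refine maximalCoreSubgraph_nonempty_iff.2
        ⟨fun s ↦ (f^[m - L] (g s).1, f^[m - L] (g s).2), by fun_prop, ?_, fun s ↦ ?_,
          fun s ↦ ⟨?_, ?_⟩⟩
      · exact IsLocallyInjective.of_comp (g := Prod.fst)
          (IsLocallyInjective.comp (g := f^[m - L]) (k := fun s ↦ (g s).1)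
          (himm.iterate hcont (m - L)) (continuous_fst.comp hg) hloc)
      · simp only [hgp]
      · change f^[L] (f^[m - L] _) = f^[L] (f^[m - L] _)
        rw [← Function.iterate_add_apply, ← Function.iterate_add_apply, Nat.add_sub_cancel' hLm]
        exact (hgm s).1
      · change f^[L - 1] (f^[m - L] _) ≠ f^[L - 1] (f^[m - L] _)
        rw [← Function.iterate_add_apply, ← Function.iterate_add_apply,
          show L - 1 + (m - L) = m - 1 by omega]
        exact (hgm s).2
    exact this.ne_empty hempty
  · rintro ⟨L, hL⟩
    refine ⟨L + 2, by omega, ?_⟩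
    by_contra hne
    obtain ⟨g, hg, hgi, hgp, hgm⟩ :=
      maximalCoreSubgraph_nonempty_iff.1 (nonempty_iff_ne_empty.2 hne)
    obtain ⟨h1, h2⟩ := isLocallyInjective_of_prod hcont himm hg hgi fun s ↦ (hgm s).1
    obtain ⟨α, hα, hs⟩ := Annulus.exists_of_immersed_loops P hcont himm (m := L + 1) (by omega)
      (γ := fun s ↦ (g s).1) (δ := fun s ↦ (g s).2) (by fun_prop) (by fun_prop) h1 h2
      (fun s ↦ by rw [hgp]) (fun s ↦ by rw [hgp]) (fun s ↦ (hgm s).1) (hgm 0).2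
    have := hL _ α hα hs
    rw [Annulus.length] at this
    omega
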